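/- **Setting.** Let $d\ge k\ge 1$ be integers and $q\ge p\ge 1$ real numbers. Let $\mathbb S_{d,k}=\{E\in\mathbb R^{d\times k}: E^\top E=I_k\}$, and for $E\in\mathbb S_{d,k}$ let $E^\star(x)=E^\top x$ and let $E^\star_\#\mu$ be the push-forward of $\mu$ by $E^\star$. With $\mathcal W_p$ the Wasserstein distance of order $p$ for the Euclidean distance on $\mathbb R^k$, the projection robust Wasserstein distance is $$\overline{\mathcal{PW}}_{p,k}(\mu,\nu)=\sup_{E\in\mathbb S_{d,k}}\mathcal W_p(E^\star_\#\mu,E^\star_\#\nu).$$ A Borel probability measure $\mu$ on $\mathbb R^d$ satisfies a projection Poincaré inequality with constant $M>0$ if for every $E\in\mathbb S_{d,k}$ and $X\sim E^\star_\#\mu$ one has $\mathrm{Var}(f(X))\le M\,\mathbb E\|\nabla f(X)\|^2$ for every continuously differentiable $f:\mathbb R^k\to\mathbb R$ with $\mathbb E f(X)^2<\infty$ and $\mathbb E\|\nabla f(X)\|^2<\infty$. Put $$\zeta_{p,q,k}=\begin{cases}2&\text{if }k=q=2p,\\ 1&\text{if }\bigl(k\ne 2p\text{ and }q=\tfrac{kp}{k-p}\bigr)\text{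 or }(q>k=2p),\\ 0&\text{otherwise.}\end{cases}$$ **Theorem.** For all real $q\ge p\ge 1$ there is a constant $C_{p,q}>0$, depending only on $(p,q)$, such that the following holds. Let $1\le k\le d$, let $\mu_\star$ be a Borel probability measure on $\mathbb R^d$ with $M_q(\mu_\star)=\int\|x\|^q\,d\mu_\star(x)<\infty$ that satisfies a projection Poincaré inequality with constant $M>0$, let $X_1,\dots,X_n$ be i.i.d. with law $\mu_\star$, where $n\ge1$, and let $\widehat\mu_n=\frac1n\sum_{i=1}^n\delta_{X_i}$. Then $\overline{\mathcal{PW}}_{p,k}(\widehat\mu_n,\mu_\star)$ is a random variable (measurable up to null sets), and, with $A=M_q(\mu_\star)^{1/q}+\sqrt M$: 1. if $n\ge 2$, or if $n=1$ and $\zeta_{p,q,k}=0$, then $$\mathbb E\bigl[\overline{\mathcal{PW}}_{p,k}(\widehat\mu_n,\mu_\star)\bigr]\le C_{p,q}\,A\Bigl(n^{-\left[\frac1{(2p)\vee k}\wedge\left(\frac1p-\frac1q\right)\right]}(\log n)^{\zeta_{p,q,k}/p}+n^{-\frac1{2\vee p}}\sqrt{dk\log n}+n^{-\frac1p}\,dk\log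 n\Bigr),$$ where $0^0=1$; 2. if $p=1$ and $k\neq2$, then for all $n\ge1$ $$\mathbb E\bigl[\overline{\mathcal{PW}}_{1,k}(\widehat\mu_n,\mu_\star)\bigr]\le C_{p,q}\,A\Bigl(n^{-1/k}+n^{-1/2}\sqrt{dk\log n}\Bigr).$$ -/

import Mathlib

open MeasureTheory ProbabilityTheory
open scoped ENNReal

noncomputable section

namespace ProjOT

/-- The moment `M_q(μ) = ∫ ‖x‖^q dμ(x)`, with values in `[0, ∞]`. -/
def moment {d : ℕ} (q : ℝ) (μ : Measure (EuclideanSpace ℝ (Fin d))) : ℝ≥0∞ :=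
  ∫⁻ x, ‖x‖ₑ ^ q ∂μ

/-- The set `Π(μ, ν)` of couplings: measures on the product with marginals `μ` and `ν`
(they are probability measures when `μ` and `ν` are). -/
def couplings {k : ℕ} (μ ν : Measure (EuclideanSpace ℝ (Fin k))) :
    Set (Measure (EuclideanSpace ℝ (Fin k) × EuclideanSpace ℝ (Fin k))) :=
  {π | π.map Prod.fst = μ ∧ π.map Prod.snd = ν}

/-- The Wasserstein distance of order `p` for the Euclidean distance, with values in `[0, ∞]`. -/
def wasserstein {k : ℕ} (p : ℝ) (μ ν : Measure (EuclideanSpace ℝ (Fin k))) : ℝ≥0∞ :=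
  (⨅ π ∈ couplings μ ν, ∫⁻ z, ‖z.1 - z.2‖ₑ ^ p ∂π) ^ (1 / p)

/-- The set `S_{d,k}` of real `d × k` matrices `E` with `Eᵀ E = I_k`. -/
def stiefel (d k : ℕ) : Set (Matrix (Fin d) (Fin k) ℝ) :=
  {E | E.transpose * E = 1}

/-- The linear map `E^⋆ : ℝ^d → ℝ^k`, `x ↦ Eᵀ x`. -/
def proj {d k : ℕ} (E : Matrix (Fin d) (Fin k) ℝ) (x : EuclideanSpace ℝ (Fin d)) :
    EuclideanSpace ℝ (Fin k) :=
  WithLp.toLp 2 (E.transpose.mulVec x.ofLp)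

theorem measurable_proj {d k : ℕ} (E : Matrix (Fin d) (Fin k) ℝ) : Measurable (proj E) :=
  (Matrix.toEuclideanLin E.transpose).continuous_of_finiteDimensional.measurable

/-- The projection robust Wasserstein distance of order `p` with projection dimension `k`. -/
def prw {d : ℕ} (p : ℝ) (k : ℕ) (μ ν : Measure (EuclideanSpace ℝ (Fin d))) : ℝ≥0∞ :=
  ⨆ E ∈ stiefel d k, wasserstein p (μ.map (proj E)) (ν.map (proj E))

/-- The empirical measure `(1/n) ∑ i, δ_{x i}` of a sample of size `n`. -/
def empirical {d n : ℕ} (x : Fin n → EuclideanSpace ℝ (Fin d)) :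
    Measure (EuclideanSpace ℝ (Fin d)) :=
  (n : ℝ≥0∞)⁻¹ • ∑ i, Measure.dirac (x i)

/-- `ν` satisfies the Poincaré inequality with constant `M`, tested on all continuously
differentiable `f` with `f` and `‖∇f‖` square integrable. -/
def PoincareWith {k : ℕ} (M : ℝ) (ν : Measure (EuclideanSpace ℝ (Fin k))) : Prop :=
  ∀ f : EuclideanSpace ℝ (Fin k) → ℝ, ContDiff ℝ 1 f →
    Integrable (fun x => f x ^ 2) ν → Integrable (fun x => ‖gradient f x‖ ^ 2) ν →
      variance f ν ≤ M * ∫ x, ‖gradient f x‖ ^ 2 ∂ν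

/-- `μ` satisfies the projection Poincaré inequality with constant `M` in projection
dimension `k`: every `k`-dimensional projection of `μ` satisfies the Poincaré inequality with
the same constant. -/
def ProjPoincareWith {d : ℕ} (M : ℝ) (k : ℕ) (μ : Measure (EuclideanSpace ℝ (Fin d))) : Prop :=
  ∀ E ∈ stiefel d k, PoincareWith M (μ.map (proj E))

open Classical in
/-- The exponent `ζ_{p,q,k}` of the logarithm. When `k = p` the quotient has the value `0`, so
that the condition `q = kp/(k-p)` fails, as it should. -/
def zeta (p q : ℝ) (k : ℕ) : ℝ :=
  if (k : ℝ) = q ∧ q = 2 * p then 2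
  else if ((k : ℝ) ≠ 2 * p ∧ q = k * p / (k - p)) ∨ (q > k ∧ (k : ℝ) = 2 * p) then 1
  else 0

/-- `n^{-[1/((2p) ∨ k) ∧ (1/p - 1/q)]} (log n)^{ζ_{p,q,k}/p}`. -/
def iprwRate (p q : ℝ) (k n : ℕ) : ℝ :=
  (n : ℝ) ^ (-(min (1 / max (2 * p) k) (1 / p - 1 / q))) * Real.log n ^ (zeta p q k / p)

/-- The rate in the main bound: `iprwRate` plus
`n^{-1/(2 ∨ p)} √(dk log n) + n^{-1/p} dk log n`. -/
def prwRate (p q : ℝ) (d k n : ℕ) : ℝ :=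
  iprwRate p q k n
    + (n : ℝ) ^ (-(1 / max 2 p)) * √(d * k * Real.log n)
    + (n : ℝ) ^ (-(1 / p)) * (d * k * Real.log n)

end ProjOT

end

open MeasureTheory ProbabilityTheory
open scoped ENNReal

noncomputable section

namespace ProjOT

/-! ### Covering numbers by volume comparison. -/

section Covering
open Metric Module

variable {V : Type*} [NormedAddCommGroup V] [NormedSpace ℝ V] [FiniteDimensional ℝ V]

/-! Fix a projection `E`. Its image of `μ` satisfies a Poincaré inequality, and two consequences of
that inequality carry the proof: exponential tails, which control the mean of the Wasserstein
distance for this `E`, and exponential moments of Lipschitz functions of the sample, which control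
the supremum over `E`.

Mean. Cut `ℝ^k` into dyadic annuli of radius about `2^l A`, and each annulus into nested partitions
at relative scales `2^(-j)` with at most `(3 * 2^j)^k` cells. Matching mass inside the finest cells,
then the remainder inside coarser ones, bounds `W_p^p` by a sum over cells of diameter to the power
`p` times the discrepancy between sample and law (`exists_coupling_tree`). A cell of mass `m` has
mean discrepancy at most `√(m/n)`; Cauchy–Schwarz over the cells of an annulus, and the tails over
the annuli, leave a geometric sum in `j` (`lintegral_wasserstein_rpow_le`), whose behaviour depends
on the sign of `k - 2p`. The result, `meanRate`, has no loss from finite moments: `q` enters only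
through the bound of the `p`-th moment, and `exists_meanRate_le` compares this rate with the weaker
one of the theorem. The constants do not depend on `k`, because the factor `3^k` is absorbed when
the finest scale is chosen, and because the trivial moment bound suffices when `n^(1/k) < 3`.

Fluctuations. As a function of the sample, `W_p` is `n^(-1/(2 ∨ p))`-Lipschitz for the Euclidean
norm and `n^(-1/p)`-Lipschitz in each single point. The Poincaré inequality implies a modified
logarithmic Sobolev inequality for exponentials of functions with small gradient
(`PoincareWith.mlsi`); it tensorizes (`ent_pi_le`), and the Herbst argument turns it into
`PoincareWith.exp_moment_le`. The first Lipschitz constant governs the subgaussian part, the second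
limits the admissible exponential parameter.

Supremum. The projections have a net at scale `1/n` with at most `n^(3dk)` points
(`exists_stiefel_net`), and `W_p` depends on the projection in a Lipschitz way. The maximal
inequality `lintegral_le_of_exp_moment_le` over the net, with an optimized parameter, adds the two
terms in `dk log n` to the mean. For `p = 1` the last of them is dominated by the second unless `dk
log n > n`, when the trivial bound is better. -/

/-- An `ε`-separated finite subset of a ball of radius `R` has at most `(1 + 2R/ε)^dim` points. -/
theorem card_le_of_separated_of_norm_le {R ε : ℝ} (hR : 0 ≤ R) (hε : 0 < ε) (s : Finset V)
    (hs : ∀ c ∈ s, ‖c‖ ≤ R) (h : ∀ c ∈ s, ∀ d ∈ s, c ≠ d → ε ≤ dist c d) :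
    (s.card : ℝ) ≤ (1 + 2 * R / ε) ^ finrank ℝ V := by
  borelize V
  let μ : Measure V := Measure.addHaar
  have hδ : 0 < ε / 2 := by positivity
  have hρ : 0 < R + ε / 2 := by positivity
  -- Disjoint balls of radius `ε/2` around the points fit into the ball of radius `R + ε/2`;
  -- comparing volumes gives the count.
  have D : Set.Pairwise (s : Set V) (Function.onFun Disjoint fun c => ball (c : V) (ε / 2)) := by
    rintro c hc d hd hcd
    apply ball_disjoint_ball
    have := h c hc d hd hcd
    linarith
  have A_subset : (⋃ c ∈ s, ball (c : V) (ε / 2)) ⊆ ball (0 : V) (R + ε / 2) := by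
    refine Set.iUnion₂_subset fun x hx => ?_
    apply ball_subset_ball'
    rw [dist_zero_right]
    linarith [hs x hx]
  have I : (s.card : ℝ≥0∞) * ENNReal.ofReal ((ε / 2) ^ finrank ℝ V) * μ (ball 0 1) ≤
      ENNReal.ofReal ((R + ε / 2) ^ finrank ℝ V) * μ (ball 0 1) := by
    calc
      (s.card : ℝ≥0∞) * ENNReal.ofReal ((ε / 2) ^ finrank ℝ V) * μ (ball 0 1)
          = μ (⋃ c ∈ s, ball (c : V) (ε / 2)) := by
        rw [measure_biUnion_finset D fun c _ => measurableSet_ball]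
        simp only [μ.addHaar_ball_of_pos _ hδ]
        simp only [Finset.sum_const, nsmul_eq_mul, mul_assoc]
      _ ≤ μ (ball (0 : V) (R + ε / 2)) := measure_mono A_subset
      _ = _ := by simp only [μ.addHaar_ball_of_pos _ hρ]
  have J := (ENNReal.mul_le_mul_iff_left (measure_ball_pos μ (0 : V) zero_lt_one).ne'
    measure_ball_lt_top.ne).1 I
  have K := ENNReal.toReal_le_of_le_ofReal (pow_nonneg hρ.le _) J
  rw [ENNReal.toReal_mul, ENNReal.toReal_natCast, ENNReal.toReal_ofReal (by positivity),
    ← le_div_iff₀ (by positivity), ← div_pow] at K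
  refine K.trans_eq ?_
  congr 1
  field_simp
  ring

/-- A subset of a ball of radius `R` has an `ε`-net, made of points of the set, of cardinality at
most `(1 + 2R/ε)^dim`. -/
theorem exists_finset_net {R ε : ℝ} (hR : 0 ≤ R) (hε : 0 < ε) (S : Set V)
    (hS : ∀ c ∈ S, ‖c‖ ≤ R) :
    ∃ s : Finset V, (∀ c ∈ s, c ∈ S) ∧ (s.card : ℝ) ≤ (1 + 2 * R / ε) ^ finrank ℝ V ∧
      ∀ x ∈ S, ∃ c ∈ s, dist x c ≤ ε := by
  classical
  -- A separated set of maximal cardinality is a net; the volume bound makes the maximum exist.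
  let P : ℕ → Prop := fun m => ∃ s : Finset V, s.card = m ∧ (∀ c ∈ s, c ∈ S) ∧
    ∀ c ∈ s, ∀ d ∈ s, c ≠ d → ε ≤ dist c d
  have hb : ∀ m, P m → m ≤ ⌊(1 + 2 * R / ε) ^ finrank ℝ V⌋₊ := by
    rintro m ⟨s, rfl, h1, h2⟩
    exact Nat.le_floor (card_le_of_separated_of_norm_le hR hε s (fun c hc => hS c (h1 c hc)) h2)
  have h0 : P 0 := ⟨∅, by simp⟩
  obtain ⟨s, hcard, h1, h2⟩ := Nat.findGreatest_spec (Nat.zero_le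
    ⌊(1 + 2 * R / ε) ^ finrank ℝ V⌋₊) h0
  refine ⟨s, h1, card_le_of_separated_of_norm_le hR hε s (fun c hc => hS c (h1 c hc)) h2, ?_⟩
  intro x hx
  by_contra! hcon
  have hxs : x ∉ s := fun hxs => by
    have := hcon x hxs
    simp only [dist_self] at this
    linarith
  have hP : P (s.card + 1) := by
    refine ⟨insert x s, Finset.card_insert_of_notMem hxs, ?_, ?_⟩
    · intro c hc
      rcases Finset.mem_insert.1 hc with rfl | hc
      exacts [hx, h1 c hc]
    · intro c hc d hd hcd
      rcases Finset.mem_insert.1 hc with hc | hc <;> rcases Finset.mem_insert.1 hd with hd | hd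
      · exact absurd (hc.trans hd.symm) hcd
      · rw [hc]; exact (hcon d hd).le
      · rw [hd, dist_comm]; exact (hcon c hc).le
      · exact h2 c hc d hd hcd
  have := Nat.le_findGreatest (hb _ hP) hP
  omega

end Covering

/-! ### Elementary properties of the Wasserstein distance. -/

section Wasserstein

variable {k : ℕ}

/-- Two couplings with a common marginal can be glued. -/
theorem exists_gluing {X Y Z : Type*} [MeasurableSpace X] [MeasurableSpace Y] [MeasurableSpace Z]
    [StandardBorelSpace X] [Nonempty X] [StandardBorelSpace Z] [Nonempty Z]
    (π₁ : Measure (X × Y)) (π₂ : Measure (Y × Z)) [IsFiniteMeasure π₁] [IsFiniteMeasure π₂]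
    (h : π₁.map Prod.snd = π₂.map Prod.fst) :
    ∃ ρ : Measure (Y × X × Z), ρ.map (fun w => (w.2.1, w.1)) = π₁ ∧
      ρ.map (fun w => (w.1, w.2.2)) = π₂ := by
  let π₁' : Measure (Y × X) := π₁.map Prod.swap
  have hfst : π₁'.fst = π₂.fst := by
    rw [Measure.fst, Measure.map_map measurable_fst measurable_swap, Measure.fst, ← h]
    rfl
  -- Given the common coordinate, the two others are drawn independently from their conditional
  -- laws.
  refine ⟨π₂.fst ⊗ₘ (π₁'.condKernel ×ₖ π₂.condKernel), ?_, ?_⟩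
  · have : (π₂.fst ⊗ₘ (π₁'.condKernel ×ₖ π₂.condKernel)).map (Prod.map id Prod.fst) = π₁' := by
      rw [← Measure.compProd_map measurable_fst, ← Kernel.fst_eq, Kernel.fst_prod, ← hfst]
      exact π₁'.disintegrate π₁'.condKernel
    have h2 := congrArg (Measure.map Prod.swap) this
    rw [Measure.map_map measurable_swap (by fun_prop)] at h2
    refine Eq.trans ?_ (h2.trans ?_)
    · rfl
    · simp only [π₁']
      rw [Measure.map_map measurable_swap measurable_swap]
      simp
  · have : (π₂.fst ⊗ₘ (π₁'.condKernel ×ₖ π₂.condKernel)).map (Prod.map id Prod.snd) = π₂ := by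
      rw [← Measure.compProd_map measurable_snd, ← Kernel.snd_eq, Kernel.snd_prod]
      exact π₂.disintegrate π₂.condKernel
    exact this

theorem wasserstein_le_of_mem_couplings {p : ℝ} (hp : 0 < p)
    {μ ν : Measure (EuclideanSpace ℝ (Fin k))} {π} (hπ : π ∈ couplings μ ν) :
    wasserstein p μ ν ≤ (∫⁻ z, ‖z.1 - z.2‖ₑ ^ p ∂π) ^ (1 / p) :=
  ENNReal.rpow_le_rpow (iInf₂_le π hπ) (by positivity)

theorem wasserstein_rpow_le_of_mem_couplings {p : ℝ} (hp : 0 < p)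
    {μ ν : Measure (EuclideanSpace ℝ (Fin k))} {π} (hπ : π ∈ couplings μ ν) :
    wasserstein p μ ν ^ p ≤ ∫⁻ z, ‖z.1 - z.2‖ₑ ^ p ∂π := by
  rw [wasserstein, ← ENNReal.rpow_mul, one_div, inv_mul_cancel₀ hp.ne', ENNReal.rpow_one]
  exact iInf₂_le π hπ

theorem exists_coupling_of_wasserstein_lt {p : ℝ} (hp : 0 < p)
    {μ ν : Measure (EuclideanSpace ℝ (Fin k))} {c : ℝ≥0∞} (h : wasserstein p μ ν < c) :
    ∃ π ∈ couplings μ ν, (∫⁻ z, ‖z.1 - z.2‖ₑ ^ p ∂π) ^ (1 / p) < c := by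
  rw [wasserstein, one_div, ENNReal.rpow_inv_lt_iff hp] at h
  obtain ⟨π, hπ, hlt⟩ := by simpa only [iInf_lt_iff, exists_prop] using h
  exact ⟨π, hπ, by rwa [one_div, ENNReal.rpow_inv_lt_iff hp]⟩

theorem wasserstein_map_map_le {p : ℝ} (hp : 0 < p) {Ω : Type*} [MeasurableSpace Ω]
    (P : Measure Ω) {Y Z : Ω → EuclideanSpace ℝ (Fin k)} (hY : Measurable Y) (hZ : Measurable Z) :
    wasserstein p (P.map Y) (P.map Z) ≤ (∫⁻ ω, ‖Y ω - Z ω‖ₑ ^ p ∂P) ^ (1 / p) := by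
  have hm : P.map (fun ω => (Y ω, Z ω)) ∈ couplings (P.map Y) (P.map Z) := by
    constructor
    · rw [Measure.map_map measurable_fst (hY.prodMk hZ)]; rfl
    · rw [Measure.map_map measurable_snd (hY.prodMk hZ)]; rfl
  refine (wasserstein_le_of_mem_couplings hp hm).trans_eq ?_
  rw [lintegral_map (by fun_prop) (hY.prodMk hZ)]

/-- Glue two couplings along `ν` and apply Minkowski's inequality in `L^p`. Almost optimal couplings
suffice, so no attainment of the infimum is needed. -/
theorem wasserstein_triangle {p : ℝ} (hp : 1 ≤ p) (μ ν σ : Measure (EuclideanSpace ℝ (Fin k)))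
    [IsFiniteMeasure ν] :
    wasserstein p μ σ ≤ wasserstein p μ ν + wasserstein p ν σ := by
  have hp0 : 0 < p := by linarith
  by_contra! hcon
  obtain ⟨a, b, ha, hb, hab⟩ : ∃ a b, wasserstein p μ ν < a ∧ wasserstein p ν σ < b ∧
      a + b < wasserstein p μ σ := by
    have := ENNReal.lt_iff_exists_add_pos_lt.1 hcon
    obtain ⟨r, hr, hlt⟩ := this
    have hfin := ENNReal.add_ne_top.1 hcon.ne_top
    refine ⟨wasserstein p μ ν + r / 2, wasserstein p ν σ + r / 2,
      ENNReal.lt_add_right hfin.1 (by simpa using hr.ne'),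
      ENNReal.lt_add_right hfin.2 (by simpa using hr.ne'), ?_⟩
    refine lt_of_eq_of_lt ?_ hlt
    rw [add_add_add_comm, ENNReal.add_halves]
  obtain ⟨π₁, hπ₁, hlt₁⟩ := exists_coupling_of_wasserstein_lt hp0 ha
  obtain ⟨π₂, hπ₂, hlt₂⟩ := exists_coupling_of_wasserstein_lt hp0 hb
  have : IsFiniteMeasure π₁ := by
    constructor
    rw [← Set.preimage_univ (f := Prod.snd), ← Measure.map_apply measurable_snd .univ, hπ₁.2]
    exact measure_lt_top _ _
  have : IsFiniteMeasure π₂ := by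
    constructor
    rw [← Set.preimage_univ (f := Prod.fst), ← Measure.map_apply measurable_fst .univ, hπ₂.1]
    exact measure_lt_top _ _
  obtain ⟨ρ, hρ₁, hρ₂⟩ := exists_gluing π₁ π₂ (hπ₁.2.trans hπ₂.1.symm)
  have e1 : ρ.map (fun w => w.2.1) = μ := by
    rw [← hπ₁.1, ← hρ₁, Measure.map_map measurable_fst (by fun_prop)]; rfl
  have e2 : ρ.map (fun w => w.2.2) = σ := by
    rw [← hπ₂.2, ← hρ₂, Measure.map_map measurable_snd (by fun_prop)]; rfl
  have key := wasserstein_map_map_le hp0 ρ (Y := fun w => w.2.1) (Z := fun w => w.2.2)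
    (by fun_prop) (by fun_prop)
  rw [e1, e2] at key
  rw [← hρ₁, lintegral_map (by fun_prop) (by fun_prop)] at hlt₁
  rw [← hρ₂, lintegral_map (by fun_prop) (by fun_prop)] at hlt₂
  refine (hab.trans_le (key.trans ?_)).not_ge (add_le_add hlt₁.le hlt₂.le)
  refine le_trans ?_ (ENNReal.lintegral_Lp_add_le (by fun_prop) (by fun_prop) hp)
  gcongr with w
  simp only [Pi.add_apply]
  refine le_trans (le_of_eq ?_) (enorm_add_le _ _)
  congr 1
  abel

theorem wasserstein_comm {p : ℝ} (hp : 0 < p) (μ ν : Measure (EuclideanSpace ℝ (Fin k))) :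
    wasserstein p μ ν = wasserstein p ν μ := by
  have key : ∀ μ ν : Measure (EuclideanSpace ℝ (Fin k)),
      wasserstein p μ ν ≤ wasserstein p ν μ := by
    intro μ ν
    refine le_of_forall_gt fun c hc => ?_
    obtain ⟨π, hπ, hlt⟩ := exists_coupling_of_wasserstein_lt hp hc
    have := wasserstein_map_map_le hp π (Y := Prod.snd) (Z := Prod.fst) (by fun_prop) (by fun_prop)
    rw [hπ.1, hπ.2] at this
    refine (this.trans_eq ?_).trans_lt hlt
    simp_rw [enorm_sub_rev]
  exact le_antisymm (key _ _) (key _ _)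

/-- The independent coupling gives this crude bound, which serves whenever the claimed rate is of
order one, and for finiteness. -/
theorem wasserstein_le_moment {p : ℝ} (hp : 1 ≤ p) (μ ν : Measure (EuclideanSpace ℝ (Fin k)))
    [IsProbabilityMeasure μ] [IsProbabilityMeasure ν] :
    wasserstein p μ ν ≤ moment p μ ^ (1 / p) + moment p ν ^ (1 / p) := by
  have hp0 : 0 < p := by linarith
  have key := wasserstein_map_map_le hp0 (μ.prod ν) (Y := Prod.fst) (Z := Prod.snd)
    (by fun_prop) (by fun_prop)
  have e1 : (μ.prod ν).map Prod.fst = μ := by simp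
  have e2 : (μ.prod ν).map Prod.snd = ν := by simp
  have m1 : moment p μ = ∫⁻ z, ‖z.1‖ₑ ^ p ∂(μ.prod ν) := by
    conv_lhs => rw [moment, ← e1]
    rw [lintegral_map (by fun_prop) (by fun_prop)]
  have m2 : moment p ν = ∫⁻ z, ‖z.2‖ₑ ^ p ∂(μ.prod ν) := by
    conv_lhs => rw [moment, ← e2]
    rw [lintegral_map (by fun_prop) (by fun_prop)]
  rw [e1, e2] at key
  rw [m1, m2]
  refine key.trans (le_trans ?_ (ENNReal.lintegral_Lp_add_le (by fun_prop) (by fun_prop) hp))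
  gcongr with w
  simp only [Pi.add_apply]
  exact enorm_sub_le

end Wasserstein

/-! ### Empirical measures. -/

section Empirical

variable {d n : ℕ}

theorem lintegral_empirical (x : Fin n → EuclideanSpace ℝ (Fin d))
    (f : EuclideanSpace ℝ (Fin d) → ℝ≥0∞) :
    ∫⁻ y, f y ∂(empirical x) = (n : ℝ≥0∞)⁻¹ * ∑ i, f (x i) := by
  rw [empirical, lintegral_smul_measure, lintegral_finsetSum_measure]
  simp

theorem isProbabilityMeasure_empirical (hn : 1 ≤ n) (x : Fin n → EuclideanSpace ℝ (Fin d)) :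
    IsProbabilityMeasure (empirical x) := by
  constructor
  simp only [empirical, Measure.smul_apply, Measure.coe_finsetSum, Finset.sum_apply,
    measure_univ, Finset.sum_const, Finset.card_univ, Fintype.card_fin, nsmul_eq_mul, mul_one,
    smul_eq_mul]
  exact ENNReal.inv_mul_cancel (by simp; omega) (by simp)

theorem empirical_map {k : ℕ} (x : Fin n → EuclideanSpace ℝ (Fin d))
    {f : EuclideanSpace ℝ (Fin d) → EuclideanSpace ℝ (Fin k)} (hf : Measurable f) :
    (empirical x).map f = empirical (fun i => f (x i)) := by
  rw [empirical, Measure.map_smul, Measure.map_finset_sum hf.aemeasurable, empirical]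
  simp [Measure.map_dirac' hf]

/-- The index-wise coupling of two empirical measures. -/
theorem wasserstein_empirical_le {p : ℝ} (hp : 0 < p) (x y : Fin n → EuclideanSpace ℝ (Fin d)) :
    wasserstein p (empirical x) (empirical y) ≤
      ((n : ℝ≥0∞)⁻¹ * ∑ i, ‖x i - y i‖ₑ ^ p) ^ (1 / p) := by
  -- Both empirical measures are images of the uniform law on the indices, which couples them.
  let P : Measure (Fin n) := (n : ℝ≥0∞)⁻¹ • ∑ i, Measure.dirac i
  have hmap : ∀ z : Fin n → EuclideanSpace ℝ (Fin d), P.map z = empirical z := by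
    intro z
    have hz : Measurable z := measurable_of_finite z
    rw [Measure.map_smul, Measure.map_finset_sum hz.aemeasurable, empirical]
    simp [Measure.map_dirac' hz]
  have := wasserstein_map_map_le hp P (measurable_of_finite x) (measurable_of_finite y)
  rw [hmap, hmap] at this
  refine this.trans_eq ?_
  congr 1
  rw [lintegral_smul_measure, lintegral_finsetSum_measure]
  simp

end Empirical

/-! ### Transport along nested partitions. -/

section Tree

variable {X ι : Type*} [MeasurableSpace X] [MeasurableSpace ι] [Countable ι]
  [MeasurableSingletonClass ι]

theorem sum_restrict_fiber (a : Measure X) {T : X → ι} (hT : Measurable T) :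
    Measure.sum (fun i => a.restrict (T ⁻¹' {i})) = a := by
  rw [← Measure.restrict_iUnion]
  · rw [← Set.preimage_iUnion, Set.iUnion_of_singleton, Set.preimage_univ, Measure.restrict_univ]
  · intro i j hij
    exact Disjoint.preimage _ (by simpa using hij)
  · exact fun i => hT (measurableSet_singleton i)

theorem lintegral_comp_countable (a : Measure X) {T : X → ι} (hT : Measurable T) (G : ι → ℝ≥0∞) :
    ∫⁻ x, G (T x) ∂a = ∑' i, G i * a (T ⁻¹' {i}) := by
  rw [← lintegral_map (measurable_of_countable G) hT, lintegral_countable']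
  simp_rw [Measure.map_apply hT (measurableSet_singleton _)]

/-- Within the cells of a countable partition, as much mass as possible of two finite measures can
be coupled. -/
theorem exists_matching (a b : Measure X) [IsFiniteMeasure a] [IsFiniteMeasure b] {T : X → ι}
    (hT : Measurable T) :
    ∃ (γ : Measure (X × X)) (a' b' : Measure X), γ.map Prod.fst + a' = a ∧
      γ.map Prod.snd + b' = b ∧ (∀ᵐ z ∂γ, T z.1 = T z.2) ∧
      (∀ i, a' (T ⁻¹' {i}) = a (T ⁻¹' {i}) - b (T ⁻¹' {i})) ∧
      ∀ i, b' (T ⁻¹' {i}) = b (T ⁻¹' {i}) - a (T ⁻¹' {i}) := by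
  let A : ι → ℝ≥0∞ := fun i => a (T ⁻¹' {i})
  let B : ι → ℝ≥0∞ := fun i => b (T ⁻¹' {i})
  have hS : ∀ i, MeasurableSet (T ⁻¹' {i}) := fun i => hT (measurableSet_singleton i)
  have hA : ∀ i, A i ≠ ∞ := fun i => measure_ne_top _ _
  have hB : ∀ i, B i ≠ ∞ := fun i => measure_ne_top _ _
  -- For a cell with masses `s` and `t`, the matched part takes the fraction `min s t / s` of the
  -- first measure and the remainder the fraction `(s - t) / s`; with truncated subtraction they add
  -- up to one.
  have coef : ∀ s t : ℝ≥0∞, s ≠ ∞ → t ≠ ∞ → s ≠ 0 →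
      min s t / (s * t) * t + (s - t) / s = 1 := by
    intro s t hs ht hs0
    have h1 : min s t / (s * t) * t = min s t / s := by
      rcases eq_or_ne t 0 with rfl | ht0
      · simp
      · rw [div_eq_mul_inv, ENNReal.mul_inv (Or.inl hs0) (Or.inl hs), mul_assoc, mul_assoc,
          ENNReal.inv_mul_cancel ht0 ht, mul_one, div_eq_mul_inv]
    rw [h1, ← ENNReal.add_div, ENNReal.div_eq_one_iff hs0 hs]
    rcases le_total s t with h | h
    · rw [min_eq_left h, tsub_eq_zero_of_le h, add_zero]
    · rw [min_eq_right h, add_tsub_cancel_of_le h]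
  have resid : ∀ s t : ℝ≥0∞, s ≠ ∞ → (s - t) / s * s = s - t := by
    intro s t hs
    rcases eq_or_ne s 0 with rfl | hs0
    · simp
    · exact ENNReal.div_mul_cancel hs0 hs
  have inter : ∀ (m : Measure X) (w : ι → ℝ≥0∞) (i : ι),
      (Measure.sum fun j => w j • m.restrict (T ⁻¹' {j})) (T ⁻¹' {i}) = w i * m (T ⁻¹' {i}) := by
    intro m w i
    rw [Measure.sum_apply _ (hS i), tsum_eq_single i]
    · simp
    · intro j hj
      have : T ⁻¹' {i} ∩ T ⁻¹' {j} = ∅ := by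
        rw [← Set.preimage_inter, Set.singleton_inter_eq_empty.2 (by simpa using hj.symm),
          Set.preimage_empty]
      simp [Measure.restrict_apply (hS i), this]
  -- On each cell, the product of the restrictions scaled to mass `min (A i) (B i)`; where a mass is
  -- zero the coefficient is `0 / 0 = 0`.
  let γ : Measure (X × X) := Measure.sum fun i => (min (A i) (B i) / (A i * B i)) •
    (a.restrict (T ⁻¹' {i})).prod (b.restrict (T ⁻¹' {i}))
  refine ⟨γ, Measure.sum fun i => ((A i - B i) / A i) • a.restrict (T ⁻¹' {i}),
    Measure.sum fun i => ((B i - A i) / B i) • b.restrict (T ⁻¹' {i}), ?_, ?_, ?_, ?_, ?_⟩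
  · rw [Measure.map_sum measurable_fst.aemeasurable, Measure.sum_add_sum]
    conv_rhs => rw [← sum_restrict_fiber a hT]
    congr 1
    ext1 i
    rw [Measure.map_smul, Measure.map_fst_prod, Measure.restrict_apply_univ, smul_smul, ← add_smul]
    rcases eq_or_ne (A i) 0 with h0 | h0
    · rw [Measure.restrict_eq_zero.2 h0, smul_zero]
    · rw [coef _ _ (hA i) (hB i) h0, one_smul]
  · rw [Measure.map_sum measurable_snd.aemeasurable, Measure.sum_add_sum]
    conv_rhs => rw [← sum_restrict_fiber b hT]
    congr 1
    ext1 i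
    rw [Measure.map_smul, Measure.map_snd_prod, Measure.restrict_apply_univ, smul_smul, ← add_smul]
    rcases eq_or_ne (B i) 0 with h0 | h0
    · rw [Measure.restrict_eq_zero.2 h0, smul_zero]
    · rw [min_comm, mul_comm (A i), coef _ _ (hB i) (hA i) h0, one_smul]
  · rw [Measure.ae_sum_iff]
    intro i
    refine Measure.ae_smul_measure ?_ _
    rw [Measure.prod_restrict]
    filter_upwards [ae_restrict_mem ((hS i).prod (hS i))] with z hz
    rw [hz.1, hz.2]
  · intro i
    rw [inter, resid _ _ (hA i)]
  · intro i
    rw [inter, resid _ _ (hB i)]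

/-- This couples the unmatched remainders, of equal but arbitrary mass. At mass zero the factor is
`∞`, which is harmless because both measures vanish. -/
theorem map_smul_prod_marginals (a b : Measure X) [IsFiniteMeasure a] [IsFiniteMeasure b]
    (hab : a Set.univ = b Set.univ) :
    ((a Set.univ)⁻¹ • a.prod b).map Prod.fst = a ∧
      ((a Set.univ)⁻¹ • a.prod b).map Prod.snd = b := by
  rcases eq_or_ne (a Set.univ) 0 with h0 | h0
  · have ha := Measure.measure_univ_eq_zero.1 h0
    have hb := Measure.measure_univ_eq_zero.1 (hab ▸ h0)
    simp [ha, hb]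
  · have h1 : (a Set.univ)⁻¹ * a Set.univ = 1 := ENNReal.inv_mul_cancel h0 (measure_ne_top _ _)
    rw [Measure.map_smul, Measure.map_smul, Measure.map_fst_prod, Measure.map_snd_prod, smul_smul,
      smul_smul, ← hab, h1, one_smul, one_smul]
    exact ⟨rfl, rfl⟩

/-- Mass matched within a cell costs at most `D`; the remainders, of mass equal to the positive
parts of the discrepancies, are coupled independently and cost at most `F` at each end. This is the
coarsest step of the transport. -/
theorem exists_coupling_partition (a b : Measure X) [IsFiniteMeasure a] [IsFiniteMeasure b]
    (hab : a Set.univ = b Set.univ) {T : X → ι} (hT : Measurable T) {c : X × X → ℝ≥0∞}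
    {D F : ι → ℝ≥0∞} (hD : ∀ x y, T x = T y → c (x, y) ≤ D (T x))
    (hF : ∀ x y, c (x, y) ≤ F (T x) + F (T y)) :
    ∃ γ : Measure (X × X), γ.map Prod.fst = a ∧ γ.map Prod.snd = b ∧
      ∫⁻ z, c z ∂γ ≤ ∫⁻ x, D (T x) ∂a + ∑' i, F i * ((a (T ⁻¹' {i}) - b (T ⁻¹' {i})) +
        (b (T ⁻¹' {i}) - a (T ⁻¹' {i}))) := by
  obtain ⟨γ, a', b', ha, hb, hγ, ha', hb'⟩ := exists_matching a b hT
  have hDm : Measurable fun x => D (T x) := (measurable_of_countable D).comp hT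
  have hFm : Measurable fun x => F (T x) := (measurable_of_countable F).comp hT
  have : IsFiniteMeasure a' := isFiniteMeasure_of_le a (ha ▸ Measure.le_add_left le_rfl)
  have : IsFiniteMeasure b' := isFiniteMeasure_of_le b (hb ▸ Measure.le_add_left le_rfl)
  have hγfin : γ Set.univ ≠ ∞ := by
    have : γ.map Prod.fst Set.univ ≤ a Set.univ := by
      rw [← ha]; simp
    rw [Measure.map_apply measurable_fst .univ] at this
    exact (this.trans_lt (measure_lt_top _ _)).ne
  have hab' : a' Set.univ = b' Set.univ := by
    have h1 : γ Set.univ + a' Set.univ = a Set.univ := by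
      rw [← ha, Measure.add_apply, Measure.map_apply measurable_fst .univ, Set.preimage_univ]
    have h2 : γ Set.univ + b' Set.univ = b Set.univ := by
      rw [← hb, Measure.add_apply, Measure.map_apply measurable_snd .univ, Set.preimage_univ]
    rw [← hab, ← h1] at h2
    exact ((ENNReal.add_right_inj hγfin).1 h2).symm
  obtain ⟨hfst, hsnd⟩ := map_smul_prod_marginals a' b' hab'
  set ρ := (a' Set.univ)⁻¹ • a'.prod b' with hρ
  refine ⟨γ + ρ, ?_, ?_, ?_⟩
  · rw [Measure.map_add _ _ measurable_fst, hfst, ha]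
  · rw [Measure.map_add _ _ measurable_snd, hsnd, hb]
  · rw [lintegral_add_measure]
    gcongr
    · calc ∫⁻ z, c z ∂γ ≤ ∫⁻ z, D (T z.1) ∂γ := by
            refine lintegral_mono_ae ?_
            filter_upwards [hγ] with z hz using hD z.1 z.2 hz
        _ = ∫⁻ x, D (T x) ∂(γ.map Prod.fst) := by rw [lintegral_map hDm measurable_fst]
        _ ≤ ∫⁻ x, D (T x) ∂a :=
            lintegral_mono' (ha ▸ Measure.le_add_right le_rfl) le_rfl
    · calc ∫⁻ z, c z ∂ρ ≤ ∫⁻ z, (F (T z.1) + F (T z.2)) ∂ρ :=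
            lintegral_mono fun z => hF z.1 z.2
        _ = ∫⁻ x, F (T x) ∂(ρ.map Prod.fst) + ∫⁻ x, F (T x) ∂(ρ.map Prod.snd) := by
            rw [lintegral_add_left (f := fun z : X × X => F (T z.1)) (hFm.comp measurable_fst),
              lintegral_map hFm measurable_fst,
              lintegral_map hFm measurable_snd]
        _ = _ := by
            rw [hfst, hsnd, lintegral_comp_countable _ hT, lintegral_comp_countable _ hT,
              ← ENNReal.tsum_add]
            simp_rw [ha', hb', mul_add]

/-- Transport along a sequence of coarser and coarser partitions: the cost of transporting `a` to
`b` is controlled by the discrepancies of `a` and `b` on the cells. -/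
theorem exists_coupling_tree {c : X × X → ℝ≥0∞} {F : ι → ℝ≥0∞} (m : ℕ) :
    ∀ (a b : Measure X), IsFiniteMeasure a → IsFiniteMeasure b → a Set.univ = b Set.univ →
    ∀ (U : ℕ → X → ι) (D G : ℕ → ι → ℝ≥0∞), (∀ i, Measurable (U i)) →
    (∀ i x y, U i x = U i y → U (i + 1) x = U (i + 1) y) →
    (∀ i x y, U i x = U i y → c (x, y) ≤ D i (U i x)) →
    (∀ i x y, c (x, y) ≤ F (U i x) + F (U i y)) →
    (∀ i x, D (i + 1) (U (i + 1) x) ≤ G i (U i x)) →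
    ∃ γ : Measure (X × X), γ.map Prod.fst = a ∧ γ.map Prod.snd = b ∧
      ∫⁻ z, c z ∂γ ≤ ∫⁻ x, D 0 (U 0 x) ∂a +
        ∑ i ∈ Finset.range m, ∑' j, G i j * (a (U i ⁻¹' {j}) - b (U i ⁻¹' {j})) +
        ∑' j, F j * ((a (U m ⁻¹' {j}) - b (U m ⁻¹' {j})) +
          (b (U m ⁻¹' {j}) - a (U m ⁻¹' {j}))) := by
  induction m with
  | zero =>
    intro a b _ _ hab U D G hU hnest hD hF hG
    obtain ⟨γ, h1, h2, h3⟩ := exists_coupling_partition a b hab (hU 0) (hD 0) (hF 0)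
    exact ⟨γ, h1, h2, by simpa using h3⟩
  | succ m ih =>
    intro a b _ _ hab U D G hU hnest hD hF hG
    obtain ⟨γ, a', b', ha, hb, hγ, ha', hb'⟩ := exists_matching a b (hU 0)
    have : IsFiniteMeasure a' := isFiniteMeasure_of_le a (ha ▸ Measure.le_add_left le_rfl)
    have : IsFiniteMeasure b' := isFiniteMeasure_of_le b (hb ▸ Measure.le_add_left le_rfl)
    have hγfin : ∀ s, γ s ≠ ∞ := by
      have : γ.map Prod.fst Set.univ ≤ a Set.univ := by
        rw [← ha]; simp
      rw [Measure.map_apply measurable_fst .univ] at this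
      exact fun s => ((measure_mono (Set.subset_univ s)).trans_lt
        (this.trans_lt (measure_lt_top _ _))).ne
    have hDm : ∀ i, Measurable fun x => D i (U i x) :=
      fun i => (measurable_of_countable (D i)).comp (hU i)
    have hnest' : ∀ i x y, U 0 x = U 0 y → U i x = U i y := by
      intro i x y h
      induction i with
      | zero => exact h
      | succ i ihi => exact hnest i x y ihi
    -- The matching joins points of one finest cell, hence of one cell at every level, so it removes
    -- the same mass `g` from both measures on each cell.
    have split : ∀ i j, ∃ g : ℝ≥0∞, g ≠ ∞ ∧ g + a' (U i ⁻¹' {j}) = a (U i ⁻¹' {j}) ∧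
        g + b' (U i ⁻¹' {j}) = b (U i ⁻¹' {j}) := by
      intro i j
      have hm : MeasurableSet (U i ⁻¹' {j}) := hU i (measurableSet_singleton j)
      refine ⟨γ (Prod.fst ⁻¹' (U i ⁻¹' {j})), hγfin _, ?_, ?_⟩
      · rw [← Measure.map_apply measurable_fst hm, ← Measure.add_apply, ha]
      · have : γ (Prod.fst ⁻¹' (U i ⁻¹' {j})) = γ (Prod.snd ⁻¹' (U i ⁻¹' {j})) := by
          refine measure_congr ?_
          filter_upwards [hγ] with z hz
          have := hnest' i z.1 z.2 hz
          refine propext ?_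
          change U i z.1 ∈ ({j} : Set ι) ↔ U i z.2 ∈ ({j} : Set ι)
          rw [this]
        rw [this, ← Measure.map_apply measurable_snd hm, ← Measure.add_apply, hb]
    -- Hence the coarser discrepancies of the remainders are those of the original measures, and the
    -- induction does not accumulate errors.
    have diff : ∀ i j, a' (U i ⁻¹' {j}) - b' (U i ⁻¹' {j}) =
        a (U i ⁻¹' {j}) - b (U i ⁻¹' {j}) ∧ b' (U i ⁻¹' {j}) - a' (U i ⁻¹' {j}) =
        b (U i ⁻¹' {j}) - a (U i ⁻¹' {j}) := by
      intro i j
      obtain ⟨g, hg, h1, h2⟩ := split i j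
      rw [← h1, ← h2, ENNReal.add_sub_add_eq_sub_left hg, ENNReal.add_sub_add_eq_sub_left hg]
      exact ⟨rfl, rfl⟩
    have hab' : a' Set.univ = b' Set.univ := by
      have h1 : γ Set.univ + a' Set.univ = a Set.univ := by
        rw [← ha, Measure.add_apply, Measure.map_apply measurable_fst .univ, Set.preimage_univ]
      have h2 : γ Set.univ + b' Set.univ = b Set.univ := by
        rw [← hb, Measure.add_apply, Measure.map_apply measurable_snd .univ, Set.preimage_univ]
      rw [← hab, ← h1] at h2
      exact ((ENNReal.add_right_inj (hγfin _)).1 h2).symm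
    obtain ⟨ρ, hρ1, hρ2, hρ3⟩ := ih a' b' inferInstance inferInstance hab' (fun i => U (i + 1))
      (fun i => D (i + 1)) (fun i => G (i + 1)) (fun i => hU _) (fun i => hnest _) (fun i => hD _)
      (fun i => hF _) (fun i => hG _)
    refine ⟨γ + ρ, ?_, ?_, ?_⟩
    · rw [Measure.map_add _ _ measurable_fst, hρ1, ha]
    · rw [Measure.map_add _ _ measurable_snd, hρ2, hb]
    · have c1 : ∫⁻ z, c z ∂γ ≤ ∫⁻ x, D 0 (U 0 x) ∂a := by
        calc ∫⁻ z, c z ∂γ ≤ ∫⁻ z, D 0 (U 0 z.1) ∂γ := by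
              refine lintegral_mono_ae ?_
              filter_upwards [hγ] with z hz using hD 0 z.1 z.2 hz
          _ = ∫⁻ x, D 0 (U 0 x) ∂(γ.map Prod.fst) := by rw [lintegral_map (hDm 0) measurable_fst]
          _ ≤ ∫⁻ x, D 0 (U 0 x) ∂a :=
              lintegral_mono' (ha ▸ Measure.le_add_right le_rfl) le_rfl
      -- The remainder has mass `a - b` (truncated) on each finest cell and is moved next within a
      -- cell of level one, at a cost that `G 0` bounds in terms of the finest cell.
      have c2 : ∫⁻ x, D (0 + 1) (U (0 + 1) x) ∂a' ≤
          ∑' j, G 0 j * (a (U 0 ⁻¹' {j}) - b (U 0 ⁻¹' {j})) := by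
        refine (lintegral_mono (hG 0)).trans_eq ?_
        rw [lintegral_comp_countable _ (hU 0)]
        simp_rw [ha']
      simp_rw [fun i j => (diff i j).1, fun i j => (diff i j).2] at hρ3
      rw [lintegral_add_measure, Finset.sum_range_succ']
      refine (add_le_add c1 hρ3).trans ?_
      rw [add_assoc, add_assoc]
      refine add_le_add le_rfl ?_
      rw [add_comm (∑ i ∈ Finset.range m, _) (∑' j, G 0 j * _), add_assoc]
      exact add_le_add c2 le_rfl

end Tree

/-! ### The modified logarithmic Sobolev inequality from the Poincaré inequality. -/

section Entropy

/-- The entropy functional `Ent_P(F) = E[F log F] - E[F] log E[F]`. -/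
def ent {Ω : Type*} [MeasurableSpace Ω] (P : Measure Ω) (F : Ω → ℝ) : ℝ :=
  ∫ x, F x * Real.log (F x) ∂P - (∫ x, F x ∂P) * Real.log (∫ x, F x ∂P)

/-- The constant of the modified logarithmic Sobolev inequality below. -/
def mlsiConst : ℝ := 9 / 2 * (1 + Real.exp (9 / 4))

theorem mlsiConst_pos : 0 < mlsiConst := by unfold mlsiConst; positivity

/-- This reduces the entropy of `exp g` to the two moments `∫ g²` and `∫ g² exp g`; it follows from
`1 + t ≤ exp t`, separately for each sign of `t`. -/
theorem mul_exp_sub_exp_add_one_le (t : ℝ) :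
    t * Real.exp t - Real.exp t + 1 ≤ t ^ 2 * (1 + Real.exp t) := by
  have h := Real.add_one_le_exp t
  have hpos := Real.exp_pos t
  rcases le_total 0 t with ht | ht
  · nlinarith [mul_le_mul_of_nonneg_right h (by nlinarith : (0:ℝ) ≤ 1 - t + t ^ 2),
      pow_nonneg ht 3, sq_nonneg t]
  · nlinarith [mul_le_mul_of_nonneg_right h (by linarith : (0:ℝ) ≤ 1 - t), sq_nonneg t]

theorem integrable_of_continuous_of_le {X : Type*} [TopologicalSpace X] [MeasurableSpace X]
    [OpensMeasurableSpace X] {P : Measure X} [IsFiniteMeasure P] {f : X → ℝ} (hf : Continuous f)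
    {C : ℝ} (hC : ∀ x, |f x| ≤ C) : Integrable f P :=
  Integrable.of_bound hf.measurable.aestronglyMeasurable C (Filter.Eventually.of_forall hC)

/-- Continuous functions of a bounded continuous function are integrable. -/
theorem integrable_comp_of_le {X : Type*} [TopologicalSpace X] [MeasurableSpace X]
    [OpensMeasurableSpace X] {P : Measure X} [IsFiniteMeasure P] {g : X → ℝ} (hg : Continuous g)
    {B : ℝ} (hB : ∀ x, |g x| ≤ B) {φ : ℝ → ℝ} (hφ : Continuous φ) :
    Integrable (fun x => φ (g x)) P := by
  obtain ⟨C, hC⟩ := (isCompact_Icc (a := -B) (b := B)).exists_bound_of_continuousOn hφ.continuousOn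
  exact integrable_of_continuous_of_le (hφ.comp hg) fun x => hC _ (abs_le.1 (hB x))

variable {k : ℕ} {ν : Measure (EuclideanSpace ℝ (Fin k))} [IsProbabilityMeasure ν] {M : ℝ}
  {g : EuclideanSpace ℝ (Fin k) → ℝ}

theorem norm_gradient (f : EuclideanSpace ℝ (Fin k) → ℝ) (x : EuclideanSpace ℝ (Fin k)) :
    ‖gradient f x‖ = ‖fderiv ℝ f x‖ := by
  simp [gradient]

/-- The Poincaré inequality for a function of a bounded function with bounded gradient. -/
theorem PoincareWith.comp (hP : PoincareWith M ν) (hg : ContDiff ℝ 1 g) {B c : ℝ}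
    (hB : ∀ x, |g x| ≤ B) (hc : ∀ x, ‖fderiv ℝ g x‖ ≤ c) {φ ψ : ℝ → ℝ}
    (hφ : ∀ t, HasDerivAt φ (ψ t) t) (hψ : Continuous ψ) :
    ∫ x, φ (g x) ^ 2 ∂ν - (∫ x, φ (g x) ∂ν) ^ 2 ≤ M * ∫ x, ψ (g x) ^ 2 * ‖fderiv ℝ g x‖ ^ 2 ∂ν := by
  have hφc : Continuous φ := continuous_iff_continuousAt.2 fun t => (hφ t).continuousAt
  have hder : deriv φ = ψ := funext fun t => (hφ t).deriv
  have hφ1 : ContDiff ℝ 1 φ := by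
    rw [contDiff_one_iff_deriv, hder]
    exact ⟨fun t => (hφ t).differentiableAt, hψ⟩
  have hgrad : ∀ x, ‖gradient (fun x => φ (g x)) x‖ ^ 2 = ψ (g x) ^ 2 * ‖fderiv ℝ g x‖ ^ 2 := by
    intro x
    have := ((hφ (g x)).comp_hasFDerivAt x (hg.differentiable one_ne_zero x).hasFDerivAt).fderiv
    rw [norm_gradient]
    change ‖fderiv ℝ (φ ∘ g) x‖ ^ 2 = _
    rw [this, norm_smul, mul_pow, Real.norm_eq_abs, sq_abs]
  obtain ⟨C, hC⟩ := (isCompact_Icc (a := -B) (b := B)).exists_bound_of_continuousOn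
    hψ.continuousOn
  have hint : Integrable (fun x => ψ (g x) ^ 2 * ‖fderiv ℝ g x‖ ^ 2) ν := by
    refine integrable_of_continuous_of_le (C := C ^ 2 * c ^ 2)
      (((hψ.comp hg.continuous).pow 2).mul ((hg.continuous_fderiv one_ne_zero).norm.pow 2)) ?_
    intro x
    rw [abs_of_nonneg (by positivity)]
    have h1 := hC (g x) (abs_le.1 (hB x))
    rw [Real.norm_eq_abs] at h1
    have := sq_abs (ψ (g x))
    gcongr ?_ * ?_
    · rw [← this]; gcongr
    · gcongr; exact hc x
  have key := hP (fun x => φ (g x)) (hφ1.comp hg)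
    (integrable_comp_of_le hg.continuous hB (hφc.pow 2)) (by simp_rw [hgrad]; exact hint)
  rw [variance_eq_sub (X := fun x => φ (g x)) ((memLp_two_iff_integrable_sq
    (hφc.comp hg.continuous).measurable.aestronglyMeasurable).2
    (integrable_comp_of_le hg.continuous hB (hφc.pow 2)))] at key
  simp_rw [hgrad] at key
  simpa using key

/-- The modified logarithmic Sobolev inequality of Bobkov and Ledoux, for a centred function. -/
theorem PoincareWith.mlsi_of_integral_eq_zero (hP : PoincareWith M ν) (hM : 0 ≤ M)
    (hg : ContDiff ℝ 1 g) {B c : ℝ} (hB : ∀ x, |g x| ≤ B) (hc : ∀ x, ‖fderiv ℝ g x‖ ≤ c)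
    (hMc : M * c ^ 2 ≤ 1) (h0 : ∫ x, g x ∂ν = 0) :
    ∫ x, g x * Real.exp (g x) ∂ν - ∫ x, Real.exp (g x) ∂ν + 1 ≤
      mlsiConst * M * ∫ x, ‖fderiv ℝ g x‖ ^ 2 * Real.exp (g x) ∂ν := by
  have hgc := hg.continuous
  have hI : ∀ {φ : ℝ → ℝ}, Continuous φ → Integrable (fun x => φ (g x)) ν :=
    fun hφ => integrable_comp_of_le hgc hB hφ
  have hΓc : Continuous fun x => ‖fderiv ℝ g x‖ ^ 2 :=
    (hg.continuous_fderiv one_ne_zero).norm.pow 2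
  have hΓ0 : ∀ x, 0 ≤ ‖fderiv ℝ g x‖ ^ 2 := fun x => by positivity
  have hΓ : ∀ x, ‖fderiv ℝ g x‖ ^ 2 ≤ c ^ 2 := fun x => by gcongr; exact hc x
  have hIΓ : ∀ {φ : ℝ → ℝ}, Continuous φ →
      Integrable (fun x => φ (g x) * ‖fderiv ℝ g x‖ ^ 2) ν := by
    intro φ hφ
    refine (hI hφ).mul_bdd (c := c ^ 2) hΓc.measurable.aestronglyMeasurable
      (Filter.Eventually.of_forall fun x => ?_)
    rw [Real.norm_eq_abs, abs_of_nonneg (hΓ0 x)]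
    exact hΓ x
  set V := ∫ x, g x ^ 2 ∂ν with hV
  set S := ∫ x, ‖fderiv ℝ g x‖ ^ 2 ∂ν with hS
  set Pe := ∫ x, Real.exp (g x) * ‖fderiv ℝ g x‖ ^ 2 ∂ν with hPe
  set Q := ∫ x, g x ^ 2 * Real.exp (g x) ∂ν with hQ
  have e1 : ∀ t : ℝ, Real.exp (t / 2) ^ 2 = Real.exp t := fun t => by
    rw [← Real.exp_nat_mul]; congr 1; push_cast; ring
  have V0 : 0 ≤ V := integral_nonneg fun x => sq_nonneg _
  have Q0 : 0 ≤ Q := integral_nonneg fun x => by positivity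
  have Pe0 : 0 ≤ Pe := integral_nonneg fun x => by positivity
  have hSle : S ≤ c ^ 2 := by
    have := integral_mono (μ := ν) (by simpa using hIΓ (φ := fun _ => 1) (by fun_prop))
      (integrable_const (c ^ 2)) hΓ
    simpa using this
  have ha : V ≤ M * S := by
    have := hP.comp hg hB hc (φ := fun t => t) (ψ := fun _ => 1) (fun t => hasDerivAt_id t)
      continuous_const
    simpa [h0] using this
  have hV1 : V ≤ 1 := by nlinarith
  have hb : ∫ x, Real.exp (g x) ∂ν - (∫ x, Real.exp (g x / 2) ∂ν) ^ 2 ≤ M / 4 * Pe := by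
    have := hP.comp hg hB hc (φ := fun t => Real.exp (t / 2))
      (ψ := fun t => Real.exp (t / 2) * (1 / 2))
      (fun t => ((hasDerivAt_id t).div_const 2).exp) (by fun_prop)
    simp_rw [mul_pow, e1] at this
    refine this.trans_eq ?_
    rw [hPe, div_mul_eq_mul_div, mul_div_assoc, ← integral_div]
    congr 1
    refine integral_congr_ae (Filter.Eventually.of_forall fun x => ?_)
    ring
  -- Poincaré for `g * exp (g / 2)`. On the right `(1 + g/2)² ≤ 2 + g²/2`, and the small gradient
  -- leaves at most half of `Q`, since `M * c ^ 2 ≤ 1`.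
  have hQc : Q - (∫ x, g x * Real.exp (g x / 2) ∂ν) ^ 2 ≤ 2 * M * Pe + M / 2 * (c ^ 2 * Q) := by
    have := hP.comp hg hB hc (φ := fun t => t * Real.exp (t / 2))
      (ψ := fun t => (1 + t / 2) * Real.exp (t / 2))
      (fun t => ((hasDerivAt_id t).mul ((hasDerivAt_id t).div_const 2).exp).congr_deriv
        (by simp only [id]; ring)) (by fun_prop)
    simp_rw [mul_pow, e1] at this
    refine this.trans ?_
    have h2 : ∫ x, (1 + g x / 2) ^ 2 * Real.exp (g x) * ‖fderiv ℝ g x‖ ^ 2 ∂ν ≤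
        ∫ x, (2 * (Real.exp (g x) * ‖fderiv ℝ g x‖ ^ 2) +
          c ^ 2 / 2 * (g x ^ 2 * Real.exp (g x))) ∂ν := by
      refine integral_mono (hIΓ (φ := fun t => (1 + t / 2) ^ 2 * Real.exp t) (by fun_prop))
        (((hIΓ Real.continuous_exp).const_mul 2).add
          ((hI (φ := fun t => t ^ 2 * Real.exp t) (by fun_prop)).const_mul _)) fun x => ?_
      have e := Real.exp_pos (g x)
      have h3 : (1 + g x / 2) ^ 2 ≤ 2 + g x ^ 2 / 2 := by nlinarith [sq_nonneg (1 - g x / 2)]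
      have h4 : 0 ≤ Real.exp (g x) * ‖fderiv ℝ g x‖ ^ 2 := by positivity
      have h5 := mul_le_mul_of_nonneg_left (hΓ x)
        (by positivity : 0 ≤ g x ^ 2 / 2 * Real.exp (g x))
      have h6 := mul_le_mul_of_nonneg_right h3 h4
      calc _ = (1 + g x / 2) ^ 2 * (Real.exp (g x) * ‖fderiv ℝ g x‖ ^ 2) := by ring
        _ ≤ _ := h6
        _ = 2 * (Real.exp (g x) * ‖fderiv ℝ g x‖ ^ 2) +
            g x ^ 2 / 2 * Real.exp (g x) * ‖fderiv ℝ g x‖ ^ 2 := by ring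
        _ ≤ _ := by linarith
    rw [integral_add ((hIΓ Real.continuous_exp).const_mul 2)
      ((hI (φ := fun t => t ^ 2 * Real.exp t) (by fun_prop)).const_mul _),
      integral_const_mul, integral_const_mul] at h2
    calc _ ≤ M * (2 * Pe + c ^ 2 / 2 * Q) := by gcongr
      _ = _ := by ring
  -- As `g` is centred, the left side is the squared covariance of `g` and `exp (g / 2)`. This is
  -- Cauchy–Schwarz, through the discriminant of a nonnegative quadratic in `s`.
  have hd : (∫ x, g x * Real.exp (g x / 2) ∂ν) ^ 2 ≤
      V * (∫ x, Real.exp (g x) ∂ν - (∫ x, Real.exp (g x / 2) ∂ν) ^ 2) := by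
    set m := ∫ x, Real.exp (g x / 2) ∂ν with hm
    set b := ∫ x, g x * Real.exp (g x / 2) ∂ν with hb'
    have hq : ∀ s : ℝ, 0 ≤ V * (s * s) + (2 * b) * s + (∫ x, Real.exp (g x) ∂ν - m ^ 2) := by
      intro s
      have h1 : 0 ≤ ∫ x, (s * g x + (Real.exp (g x / 2) - m)) ^ 2 ∂ν :=
        integral_nonneg fun x => sq_nonneg _
      have h2 : ∀ x, (s * g x + (Real.exp (g x / 2) - m)) ^ 2 =
          s * s * g x ^ 2 + (2 * s * (g x * Real.exp (g x / 2)) + (-(2 * s * m) * g x +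
            (Real.exp (g x) + (-(2 * m) * Real.exp (g x / 2) + m ^ 2)))) := by
        intro x
        rw [← e1 (g x)]
        ring
      have i1 := hI (φ := fun t => t ^ 2) (by fun_prop)
      have i2 := hI (φ := fun t => t * Real.exp (t / 2)) (by fun_prop)
      have i3 := hI (φ := fun t => t) (by fun_prop)
      have i4 := hI (φ := fun t => Real.exp t) (by fun_prop)
      have i5 := hI (φ := fun t => Real.exp (t / 2)) (by fun_prop)
      have i6 := integrable_const (μ := ν) (m ^ 2)
      simp_rw [h2] at h1
      have j5 : Integrable (fun x => -(2 * m) * Real.exp (g x / 2) + m ^ 2) ν :=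
        (i5.const_mul _).add i6
      have j4 : Integrable (fun x => Real.exp (g x) +
        (-(2 * m) * Real.exp (g x / 2) + m ^ 2)) ν := i4.add j5
      have j3 : Integrable (fun x => -(2 * s * m) * g x + (Real.exp (g x) +
        (-(2 * m) * Real.exp (g x / 2) + m ^ 2))) ν := (i3.const_mul _).add j4
      have j2 : Integrable (fun x => 2 * s * (g x * Real.exp (g x / 2)) + (-(2 * s * m) * g x +
        (Real.exp (g x) + (-(2 * m) * Real.exp (g x / 2) + m ^ 2)))) ν := (i2.const_mul _).add j3
      rw [integral_add (i1.const_mul _) j2, integral_add (i2.const_mul _) j3,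
        integral_add (i3.const_mul _) j4, integral_add i4 j5,
        integral_add (i5.const_mul _) i6, integral_const_mul, integral_const_mul,
        integral_const_mul, integral_const_mul, h0, integral_const, ← hV, ← hm, ← hb'] at h1
      simp only [probReal_univ, smul_eq_mul] at h1
      linarith
    have := discrim_le_zero hq
    rw [discrim] at this
    linarith
  -- Since `V ≤ 1`, one gets `Q ≤ (1/4 + 2) M Pe + Q/2`, whence the constant `9/2`.
  have hQP : Q ≤ 9 / 2 * M * Pe := by
    have h1 : V * (∫ x, Real.exp (g x) ∂ν - (∫ x, Real.exp (g x / 2) ∂ν) ^ 2) ≤ M / 4 * Pe := by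
      calc _ ≤ V * (M / 4 * Pe) := by gcongr
        _ ≤ 1 * (M / 4 * Pe) := by gcongr
        _ = _ := one_mul _
    nlinarith
  -- Poincaré for `g²`, with `M * c ^ 2 ≤ 1` and `V² ≤ V`: the fourth moment is at most `(4 + 1) V`.
  have hfour : ∫ x, g x ^ 4 ∂ν ≤ 5 * V := by
    have := hP.comp hg hB hc (φ := fun t => t ^ 2) (ψ := fun t => 2 * t)
      (fun t => by simpa using hasDerivAt_pow 2 t) (by fun_prop)
    have h2 : ∫ x, (2 * g x) ^ 2 * ‖fderiv ℝ g x‖ ^ 2 ∂ν ≤ ∫ x, 4 * c ^ 2 * g x ^ 2 ∂ν := by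
      refine integral_mono (hIΓ (φ := fun t => (2 * t) ^ 2) (by fun_prop))
        ((hI (φ := fun t => t ^ 2) (by fun_prop)).const_mul _) fun x => ?_
      have := mul_le_mul_of_nonneg_left (hΓ x) (sq_nonneg (2 * g x))
      simp only
      linarith
    rw [integral_const_mul, ← hV] at h2
    simp_rw [← pow_mul, ← hV] at this
    have h3 := mul_le_mul_of_nonneg_left h2 hM
    have h4 : V ^ 2 ≤ V := by nlinarith
    norm_num at this
    nlinarith
  -- From `exp (g + 9/4) ≥ g + 13/4` one has `exp (9/4) g² exp g ≥ (9/4) g² - (1/4) g⁴`, the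
  -- difference being at least `g² (1 + g/2)²`. By `hfour` the right side integrates to at least
  -- `(9/4 - 5/4) V = V`, which is where `9/4` comes from.
  have hVQ : V ≤ Real.exp (9 / 4) * Q := by
    have i1 := hI (φ := fun t => t ^ 2) (by fun_prop)
    have i2 := hI (φ := fun t => t ^ 4) (by fun_prop)
    have h1 : ∫ x, (9 / 4 * g x ^ 2 - 1 / 4 * g x ^ 4) ∂ν ≤
        ∫ x, Real.exp (9 / 4) * (g x ^ 2 * Real.exp (g x)) ∂ν := by
      refine integral_mono ((i1.const_mul _).sub (i2.const_mul _))
        ((hI (φ := fun t => t ^ 2 * Real.exp t) (by fun_prop)).const_mul _) fun x => ?_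
      have h2 := Real.add_one_le_exp (g x + 9 / 4)
      have h3 := mul_le_mul_of_nonneg_left h2 (sq_nonneg (g x))
      rw [Real.exp_add] at h3
      have h4 : 0 ≤ g x ^ 2 * (1 + g x / 2) ^ 2 := by positivity
      simp only
      nlinarith
    rw [integral_sub (i1.const_mul _) (i2.const_mul _), integral_const_mul, integral_const_mul,
      integral_const_mul] at h1
    linarith
  have hfin : ∫ x, (g x * Real.exp (g x) - Real.exp (g x) + 1) ∂ν ≤
      ∫ x, (g x ^ 2 + g x ^ 2 * Real.exp (g x)) ∂ν := by
    refine integral_mono (hI (φ := fun t => t * Real.exp t - Real.exp t + 1) (by fun_prop))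
      (hI (φ := fun t => t ^ 2 + t ^ 2 * Real.exp t) (by fun_prop)) fun x => ?_
    have := mul_exp_sub_exp_add_one_le (g x)
    simp only
    linarith
  rw [integral_add (hI (φ := fun t => t * Real.exp t - Real.exp t) (by fun_prop))
    (integrable_const _), integral_sub (hI (φ := fun t => t * Real.exp t) (by fun_prop))
    (hI Real.continuous_exp), integral_add (hI (φ := fun t => t ^ 2) (by fun_prop))
    (hI (φ := fun t => t ^ 2 * Real.exp t) (by fun_prop))] at hfin
  simp only [integral_const, probReal_univ, smul_eq_mul, mul_one] at hfin
  have hPe' : ∫ x, ‖fderiv ℝ g x‖ ^ 2 * Real.exp (g x) ∂ν = Pe := by simp_rw [mul_comm, hPe]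
  rw [hPe', mlsiConst]
  have h9 := mul_le_mul_of_nonneg_left hQP (by positivity : 0 ≤ 1 + Real.exp (9 / 4))
  linarith

/-- The modified logarithmic Sobolev inequality of Bobkov and Ledoux. -/
theorem PoincareWith.mlsi (hP : PoincareWith M ν) (hM : 0 ≤ M) (hg : ContDiff ℝ 1 g) {B c : ℝ}
    (hB : ∀ x, |g x| ≤ B) (hc : ∀ x, ‖fderiv ℝ g x‖ ≤ c) (hMc : M * c ^ 2 ≤ 1) :
    ent ν (fun x => Real.exp (g x)) ≤
      mlsiConst * M * ∫ x, ‖fderiv ℝ g x‖ ^ 2 * Real.exp (g x) ∂ν := by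
  set m := ∫ x, g x ∂ν with hm
  have hI : ∀ {φ : ℝ → ℝ}, Continuous φ → Integrable (fun x => φ (g x)) ν :=
    fun hφ => integrable_comp_of_le hg.continuous hB hφ
  have h := hP.mlsi_of_integral_eq_zero hM (g := fun x => g x - m) (hg.sub contDiff_const)
    (B := B + |m|) (c := c) (fun x => (abs_sub _ _).trans (by gcongr; exact hB x))
    (fun x => by rw [fderiv_sub_const]; exact hc x) hMc
    (by rw [integral_sub (hI (φ := fun t => t) continuous_id) (integrable_const _)]; simp [← hm])
  simp_rw [fderiv_sub_const, Real.exp_sub] at h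
  set Z := ∫ x, Real.exp (g x) ∂ν with hZ
  have hZ0 : 0 < Z := integral_exp_pos (hI Real.continuous_exp)
  have e0 := Real.exp_pos m
  have h1 : ∫ x, (g x - m) * (Real.exp (g x) / Real.exp m) ∂ν =
      (∫ x, g x * Real.exp (g x) ∂ν - m * Z) / Real.exp m := by
    rw [hZ, ← integral_const_mul, ← integral_sub
      (hI (φ := fun t => t * Real.exp t) (by fun_prop)) ((hI Real.continuous_exp).const_mul _),
      ← integral_div]
    refine integral_congr_ae (Filter.Eventually.of_forall fun x => ?_)
    ring
  have h2 : ∫ x, ‖fderiv ℝ g x‖ ^ 2 * (Real.exp (g x) / Real.exp m) ∂ν =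
      (∫ x, ‖fderiv ℝ g x‖ ^ 2 * Real.exp (g x) ∂ν) / Real.exp m := by
    rw [← integral_div]
    refine integral_congr_ae (Filter.Eventually.of_forall fun x => ?_)
    ring
  rw [h1, h2, integral_div, ← hZ] at h
  -- The variational formula of the entropy, with the test constant `exp m` in place of the mean
  -- `Z`, reduces the claim to the centred case.
  have h3 : Z * m - Real.log Z * Z ≤ Real.exp m - Z := by
    have := Real.log_le_sub_one_of_pos (div_pos e0 hZ0)
    rw [Real.log_div e0.ne' hZ0.ne', Real.log_exp] at this
    have := mul_le_mul_of_nonneg_right this hZ0.le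
    rw [sub_mul (Real.exp m / Z), div_mul_cancel₀ _ hZ0.ne'] at this
    linarith
  have h4 := mul_le_mul_of_nonneg_right h e0.le
  have h5 : ((∫ x, g x * Real.exp (g x) ∂ν - m * Z) / Real.exp m - Z / Real.exp m + 1) *
      Real.exp m = ∫ x, g x * Real.exp (g x) ∂ν - m * Z - Z + Real.exp m := by
    field_simp
  rw [h5, mul_div_assoc', div_mul_cancel₀ _ e0.ne'] at h4
  simp only [ent, Real.log_exp, ← hZ]
  simp_rw [mul_comm (Real.exp _) (g _)]
  linarith

end Entropy

/-! ### Subadditivity of the entropy over independent variables. -/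

section Tensorization

/-- The inequality `log x ≤ x - 1` at `x = h g / (a z)`: the pointwise form of the nonnegativity of
the relative entropy of `F` with respect to the product of its marginals. -/
theorem mul_log_add_log_sub_ge {a z h g : ℝ} (ha : 0 < a) (hz : 0 < z) (hh : 0 < h) (hg : 0 < g) :
    a - h * g / z ≤ a * (Real.log a + Real.log z - Real.log h - Real.log g) := by
  have hpos : 0 < h * g / (a * z) := by positivity
  have := Real.log_le_sub_one_of_pos hpos
  rw [Real.log_div (by positivity) (by positivity), Real.log_mul hh.ne' hg.ne',
    Real.log_mul ha.ne' hz.ne'] at this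
  have h2 := mul_le_mul_of_nonneg_left this ha.le
  have h3 : a * (h * g / (a * z) - 1) = h * g / z - a := by field_simp
  rw [h3] at h2
  linarith

theorem integrable_of_measurable_of_le {X : Type*} [MeasurableSpace X] {P : Measure X}
    [IsFiniteMeasure P] {f : X → ℝ} (hf : Measurable f) {C : ℝ} (hC : ∀ x, |f x| ≤ C) :
    Integrable f P :=
  Integrable.of_bound hf.aestronglyMeasurable C (Filter.Eventually.of_forall hC)

variable {X Y : Type*} [MeasurableSpace X] [MeasurableSpace Y]

theorem abs_log_le_of_mem {δ B t : ℝ} (hδ : 0 < δ) (h1 : δ ≤ t) (h2 : t ≤ B) :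
    |Real.log t| ≤ |Real.log δ| + |Real.log B| := by
  have e1 := Real.log_le_log hδ h1
  have e2 := Real.log_le_log (hδ.trans_le h1) h2
  rw [abs_le]
  have := neg_abs_le (Real.log δ)
  have := le_abs_self (Real.log B)
  have := abs_nonneg (Real.log B)
  have := abs_nonneg (Real.log δ)
  constructor <;> linarith

theorem integral_mem_of_forall_mem {P : Measure X} [IsProbabilityMeasure P] {F : X → ℝ}
    (hF : Measurable F) {δ B : ℝ} (hδ : 0 < δ) (h1 : ∀ z, δ ≤ F z) (h2 : ∀ z, F z ≤ B) :
    δ ≤ ∫ z, F z ∂P ∧ ∫ z, F z ∂P ≤ B := by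
  have hi : Integrable F P := integrable_of_measurable_of_le hF (C := B) fun z => by
    rw [abs_of_pos (hδ.trans_le (h1 z))]; exact h2 z
  constructor
  · simpa using integral_mono (integrable_const δ) hi h1
  · simpa using integral_mono hi (integrable_const B) h2

theorem integrable_mul_log {P : Measure X} [IsFiniteMeasure P] {u v : X → ℝ} (hu : Measurable u)
    (hv : Measurable v) {δ B : ℝ} (hδ : 0 < δ) (u1 : ∀ z, δ ≤ u z) (u2 : ∀ z, u z ≤ B)
    (v1 : ∀ z, δ ≤ v z) (v2 : ∀ z, v z ≤ B) : Integrable (fun z => u z * Real.log (v z)) P := by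
  refine integrable_of_measurable_of_le (by fun_prop)
    (C := B * (|Real.log δ| + |Real.log B|)) fun z => ?_
  have hB : 0 ≤ B := hδ.le.trans ((u1 z).trans (u2 z))
  rw [abs_mul, abs_of_pos (hδ.trans_le (u1 z))]
  exact mul_le_mul (u2 z) (abs_log_le_of_mem hδ (v1 z) (v2 z)) (abs_nonneg _) hB

/-- Tensorization of entropy for a product of two probability measures. -/
theorem ent_prod_le (P : Measure X) (Q : Measure Y) [IsProbabilityMeasure P]
    [IsProbabilityMeasure Q] {F Γ₁ Γ₂ : X × Y → ℝ} (hF : Measurable F) {δ B : ℝ} (hδ : 0 < δ)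
    (h1 : ∀ z, δ ≤ F z) (h2 : ∀ z, F z ≤ B) (hΓ₁ : Integrable Γ₁ (P.prod Q))
    (hΓ₂ : Integrable Γ₂ (P.prod Q))
    (he₁ : ∀ y, ent P (fun x => F (x, y)) ≤ ∫ x, Γ₁ (x, y) ∂P)
    (he₂ : ∀ x, ent Q (fun y => F (x, y)) ≤ ∫ y, Γ₂ (x, y) ∂Q) :
    ent (P.prod Q) F ≤ ∫ z, Γ₁ z ∂(P.prod Q) + ∫ z, Γ₂ z ∂(P.prod Q) := by
  let G : Y → ℝ := fun y => ∫ x, F (x, y) ∂P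
  let H : X → ℝ := fun x => ∫ y, F (x, y) ∂Q
  set Z := ∫ z, F z ∂(P.prod Q) with hZ
  have hGm : Measurable G := (hF.stronglyMeasurable.integral_prod_left' (μ := P)).measurable
  have hHm : Measurable H := (hF.stronglyMeasurable.integral_prod_right' (ν := Q)).measurable
  have hG : ∀ y, δ ≤ G y ∧ G y ≤ B := fun y => integral_mem_of_forall_mem
    (by fun_prop) hδ (fun x => h1 (x, y)) (fun x => h2 (x, y))
  have hH : ∀ x, δ ≤ H x ∧ H x ≤ B := fun x => integral_mem_of_forall_mem
    (by fun_prop) hδ (fun y => h1 (x, y)) (fun y => h2 (x, y))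
  have hZb : δ ≤ Z ∧ Z ≤ B := integral_mem_of_forall_mem hF hδ h1 h2
  have hFi : Integrable F (P.prod Q) := integrable_of_measurable_of_le hF (C := B) fun z => by
    rw [abs_of_pos (hδ.trans_le (h1 z))]; exact h2 z
  have hZ0 : 0 < Z := hδ.trans_le hZb.1
  have iFF := integrable_mul_log (P := P.prod Q) hF hF hδ h1 h2 h1 h2
  have iFG := integrable_mul_log (P := P.prod Q) (v := fun z => G z.2) hF
    (hGm.comp measurable_snd) hδ h1 h2 (fun z => (hG z.2).1) (fun z => (hG z.2).2)
  have iFH := integrable_mul_log (P := P.prod Q) (v := fun z => H z.1) hF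
    (hHm.comp measurable_fst) hδ h1 h2 (fun z => (hH z.1).1) (fun z => (hH z.1).2)
  have iGG := integrable_mul_log (P := Q) hGm hGm hδ (fun y => (hG y).1) (fun y => (hG y).2)
    (fun y => (hG y).1) (fun y => (hG y).2)
  have iHH := integrable_mul_log (P := P) hHm hHm hδ (fun y => (hH y).1) (fun y => (hH y).2)
    (fun y => (hH y).1) (fun y => (hH y).2)
  have iG : Integrable G Q := hFi.integral_prod_right
  have iH : Integrable H P := hFi.integral_prod_left
  have eZG : ∫ y, G y ∂Q = Z := (integral_prod_symm _ hFi).symm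
  have eZH : ∫ x, H x ∂P = Z := (integral_prod _ hFi).symm
  have eG : ∫ z, F z * Real.log (G z.2) ∂(P.prod Q) = ∫ y, G y * Real.log (G y) ∂Q := by
    rw [integral_prod_symm _ iFG]
    refine integral_congr_ae (Filter.Eventually.of_forall fun y => ?_)
    exact integral_mul_const (Real.log (G y)) fun x => F (x, y)
  have eH : ∫ z, F z * Real.log (H z.1) ∂(P.prod Q) = ∫ x, H x * Real.log (H x) ∂P := by
    rw [integral_prod _ iFH]
    refine integral_congr_ae (Filter.Eventually.of_forall fun y => ?_)
    exact integral_mul_const (Real.log (H y)) fun z => F (y, z)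
  have b1 : ∫ z, F z * Real.log (F z) ∂(P.prod Q) - ∫ y, G y * Real.log (G y) ∂Q ≤
      ∫ z, Γ₁ z ∂(P.prod Q) := by
    rw [integral_prod_symm _ iFF, integral_prod_symm _ hΓ₁,
      ← integral_sub iFF.integral_prod_right iGG]
    exact integral_mono (iFF.integral_prod_right.sub iGG) hΓ₁.integral_prod_right he₁
  have b2 : ∫ z, F z * Real.log (F z) ∂(P.prod Q) - ∫ x, H x * Real.log (H x) ∂P ≤
      ∫ z, Γ₂ z ∂(P.prod Q) := by
    rw [integral_prod _ iFF, integral_prod _ hΓ₂, ← integral_sub iFF.integral_prod_left iHH]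
    exact integral_mono (iFF.integral_prod_left.sub iHH) hΓ₂.integral_prod_left he₂
  have iHG : Integrable (fun z : X × Y => H z.1 * G z.2 / Z) (P.prod Q) :=
    (iH.mul_prod iG).div_const _
  -- The left side is zero, because `H ⊗ G / Z` has the same integral `Z` as `F`; the right side is
  -- the sum of the mean partial entropies minus the total entropy.
  have key : ∫ z, (F z - H z.1 * G z.2 / Z) ∂(P.prod Q) ≤
      ∫ z, (F z * Real.log (F z) + F z * Real.log Z - F z * Real.log (H z.1) -
        F z * Real.log (G z.2)) ∂(P.prod Q) := by
    refine integral_mono (hFi.sub iHG) (((iFF.add (hFi.mul_const _)).sub iFH).sub iFG) fun z => ?_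
    have := mul_log_add_log_sub_ge (hδ.trans_le (h1 z)) hZ0 (hδ.trans_le (hH z.1).1)
      (hδ.trans_le (hG z.2).1)
    simp only
    linarith
  have j1 : Integrable (fun z => F z * Real.log (F z) + F z * Real.log Z) (P.prod Q) :=
    iFF.add (hFi.mul_const _)
  have j2 : Integrable (fun z => F z * Real.log (F z) + F z * Real.log Z -
    F z * Real.log (H z.1)) (P.prod Q) := j1.sub iFH
  rw [integral_sub j2 iFG, integral_sub j1 iFH, integral_add iFF (hFi.mul_const _),
    integral_sub hFi iHG, integral_div, integral_prod_mul, eZG, eZH, ← hZ, integral_mul_const,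
    ← hZ, mul_div_assoc, div_self hZ0.ne', mul_one, sub_self, eG, eH] at key
  rw [ent, ← hZ]
  linarith

/-- Tensorization of entropy for a power of a probability measure. -/
theorem ent_pi_le (P : Measure X) [IsProbabilityMeasure P] {δ B C : ℝ} (hδ : 0 < δ) (n : ℕ) :
    ∀ (F : (Fin n → X) → ℝ) (Γ : Fin n → (Fin n → X) → ℝ), Measurable F → (∀ z, δ ≤ F z) →
      (∀ z, F z ≤ B) → (∀ i, Measurable (Γ i)) → (∀ i z, |Γ i z| ≤ C) →
      (∀ i x, ent P (fun z => F (Function.update x i z)) ≤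
        ∫ z, Γ i (Function.update x i z) ∂P) →
      ent (Measure.pi fun _ : Fin n => P) F ≤ ∑ i, ∫ x, Γ i x ∂(Measure.pi fun _ : Fin n => P) := by
  induction n with
  | zero =>
    intro F Γ hF h1 h2 hΓ hC he
    simp [ent, integral_unique]
  | succ n ih =>
    intro F Γ hF h1 h2 hΓ hC he
    let R : Measure (Fin n → X) := Measure.pi fun _ => P
    let e : X × (Fin n → X) → (Fin (n + 1) → X) :=
      (MeasurableEquiv.piFinSuccAbove (fun _ => X) 0).symm
    have hecons : ∀ a y, e (a, y) = Fin.cons a y := fun a y => by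
      simp [e, Fin.insertNthEquiv]
    have hep : MeasurePreserving e (P.prod R) (Measure.pi fun _ : Fin (n + 1) => P) :=
      (measurePreserving_piFinSuccAbove (fun _ : Fin (n + 1) => P) 0).symm
    have hemb : MeasurableEmbedding e := MeasurableEquiv.measurableEmbedding _
    have hem : Measurable e := hep.measurable
    have tr : ∀ f : (Fin (n + 1) → X) → ℝ,
        ∫ x, f x ∂(Measure.pi fun _ : Fin (n + 1) => P) = ∫ z, f (e z) ∂(P.prod R) :=
      fun f => (hep.integral_comp hemb f).symm
    have hent : ent (Measure.pi fun _ : Fin (n + 1) => P) F =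
        ent (P.prod R) (fun z => F (e z)) := by
      rw [ent, ent, tr, tr]
    have hi : ∀ i, Integrable (fun z => Γ i (e z)) (P.prod R) := fun i =>
      integrable_of_measurable_of_le ((hΓ i).comp hem) fun z => hC i _
    rw [hent, Fin.sum_univ_succ, tr]
    simp_rw [tr]
    rw [← integral_finsetSum _ fun i _ => hi i.succ]
    refine ent_prod_le P R (hF.comp hem) hδ (fun z => h1 _) (fun z => h2 _) (hi 0)
      (integrable_finsetSum _ fun i _ => hi i.succ) ?_ ?_
    · intro y
      -- The point `a` only fills the coordinate that `Function.update` overwrites.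
      rcases isEmpty_or_nonempty X with hX | ⟨⟨a⟩⟩
      · simp [ent, integral_of_isEmpty]
      · simpa [hecons, Fin.update_cons_zero] using he 0 (Fin.cons a y)
    · intro a
      have hea : Measurable fun y => e (a, y) := hem.comp (by fun_prop)
      rw [integral_finsetSum _ fun i _ =>
        integrable_of_measurable_of_le ((hΓ i.succ).comp hea) fun z => hC _ _]
      refine ih (fun y => F (e (a, y))) (fun i y => Γ i.succ (e (a, y))) (hF.comp hea)
        (fun z => h1 _) (fun z => h2 _) (fun i => (hΓ _).comp hea) (fun i z => hC _ _) ?_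
      intro i y
      simpa [hecons, Fin.cons_update] using he i.succ (Fin.cons a y)

end Tensorization

/-! ### From entropy bounds to exponential moments. -/

section Herbst

/-- The Herbst argument. -/
theorem cgf_le_of_ent_le {X : Type*} [MeasurableSpace X] {P : Measure X} [IsProbabilityMeasure P]
    {f : X → ℝ} (hf : Measurable f) {B : ℝ} (hB : ∀ x, |f x| ≤ B) {a l : ℝ} (hl : 0 < l)
    (h : ∀ t, 0 < t → t ≤ l → ent P (fun x => Real.exp (t * f x)) ≤
      a * t ^ 2 * ∫ x, Real.exp (t * f x) ∂P) :
    cgf f P l ≤ l * ∫ x, f x ∂P + a * l ^ 2 := by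
  have hint : ∀ t, Integrable (fun x => Real.exp (t * f x)) P := by
    intro t
    refine integrable_of_measurable_of_le (by fun_prop) (C := Real.exp (|t| * B)) fun x => ?_
    rw [abs_of_pos (Real.exp_pos _)]
    refine Real.exp_le_exp.2 ((le_abs_self _).trans ?_)
    rw [abs_mul]
    exact mul_le_mul_of_nonneg_left (hB x) (abs_nonneg t)
  have hset : interior (integrableExpSet f P) = Set.univ := by
    have : integrableExpSet f P = Set.univ := Set.eq_univ_of_forall hint
    rw [this, interior_univ]
  have hmem : ∀ t, t ∈ interior (integrableExpSet f P) := fun t => by rw [hset]; trivial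
  have hder : ∀ t, HasDerivAt (cgf f P) (deriv (cgf f P) t) t := fun t =>
    (analyticAt_cgf (hmem t)).differentiableAt.hasDerivAt
  -- The derivative of `cgf / t` is the entropy of `exp (t f)` divided by `t² mgf`, hence at most
  -- `a`; so `φ` decreases from its limit at `0`, the mean of `f`.
  let φ : ℝ → ℝ := fun t => cgf f P t / t - a * t
  have hφ : ∀ t, t ≠ 0 → HasDerivAt φ
      ((deriv (cgf f P) t * t - cgf f P t * 1) / t ^ 2 - a * 1) t := fun t ht =>
    ((hder t).div (hasDerivAt_id t) ht).sub ((hasDerivAt_id t).const_mul a)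
  have hanti : AntitoneOn φ (Set.Ioc 0 l) := by
    refine antitoneOn_of_deriv_nonpos (convex_Ioc 0 l) ?_ ?_ ?_
    · intro t ht
      exact (hφ t ht.1.ne').continuousAt.continuousWithinAt
    · intro t ht
      rw [interior_Ioc] at ht
      exact (hφ t ht.1.ne').differentiableAt.differentiableWithinAt
    · intro t ht
      rw [interior_Ioc] at ht
      rw [(hφ t ht.1.ne').deriv, deriv_cgf (hmem t)]
      have hZ : 0 < mgf f P t := mgf_pos (hint t)
      have h3 := h t ht.1 ht.2.le
      rw [ent] at h3
      simp only [Real.log_exp] at h3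
      have e1 : ∫ x, Real.exp (t * f x) * (t * f x) ∂P =
          t * ∫ x, f x * Real.exp (t * f x) ∂P := by
        rw [← integral_const_mul]
        refine integral_congr_ae (Filter.Eventually.of_forall fun x => ?_)
        ring
      have e2 : ∫ x, Real.exp (t * f x) ∂P = mgf f P t := rfl
      rw [e1, e2] at h3
      have e3 : Real.log (mgf f P t) = cgf f P t := rfl
      rw [e3] at h3
      have ht0 := ht.1
      have h4 : (∫ x, f x * Real.exp (t * f x) ∂P) / mgf f P t * t - cgf f P t * 1 ≤
          a * t ^ 2 := by
        rw [div_mul_eq_mul_div, sub_le_iff_le_add, div_le_iff₀ hZ]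
        linarith
      rw [mul_one a, sub_nonpos, div_le_iff₀ (by positivity)]
      exact h4
  have hslope : Filter.Tendsto (fun t => cgf f P t / t) (nhdsWithin 0 (Set.Ioi 0))
      (nhds (∫ x, f x ∂P)) := by
    have h0 := hder 0
    rw [deriv_cgf_zero (hmem 0), probReal_univ, div_one, hasDerivAt_iff_tendsto_slope] at h0
    refine (h0.mono_left (nhdsWithin_mono _ fun t ht => ?_)).congr' ?_
    · exact ne_of_gt ht
    · filter_upwards with t
      simp [slope_def_field]
  have hlim : Filter.Tendsto φ (nhdsWithin 0 (Set.Ioi 0)) (nhds (∫ x, f x ∂P - a * 0)) :=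
    hslope.sub ((Filter.tendsto_id.mono_left nhdsWithin_le_nhds).const_mul a)
  have hle : φ l ≤ ∫ x, f x ∂P - a * 0 := by
    refine ge_of_tendsto hlim ?_
    filter_upwards [Ioc_mem_nhdsGT hl] with t ht
    exact hanti ht ⟨hl, le_rfl⟩ ht.2
  simp only [φ] at hle
  rw [sub_le_iff_le_add, div_le_iff₀ hl] at hle
  calc _ ≤ _ := hle
    _ = _ := by ring

end Herbst

/-! ### Exponential moments of smooth functions of independent variables. -/

section Concentration

/-- Only increments along one line are used, so that Lipschitz bounds in another norm than that of
the space apply: the product type carries the sup norm, the estimates below are Euclidean. -/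
theorem abs_fderiv_le_of_lip {V : Type*} [NormedAddCommGroup V] [NormedSpace ℝ V] {f : V → ℝ}
    {x h : V} {C : ℝ} (hf : DifferentiableAt ℝ f x) (hC : 0 ≤ C)
    (hlip : ∀ s : ℝ, |f (x + s • h) - f x| ≤ C * |s|) : |fderiv ℝ f x h| ≤ C := by
  have h1 : HasDerivAt (fun s : ℝ => f (x + s • h)) (fderiv ℝ f x h) 0 := by
    have h2 : HasDerivAt (fun s : ℝ => x + s • h) h 0 := by
      simpa using ((hasDerivAt_id (0 : ℝ)).smul_const h).const_add x
    have h3 : HasFDerivAt f (fderiv ℝ f x) (x + (0 : ℝ) • h) := by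
      simpa using hf.hasFDerivAt
    exact h3.comp_hasDerivAt 0 h2
  refine h1.le_of_lip' hC (Filter.Eventually.of_forall fun s => ?_)
  simpa using hlip s

variable {n k : ℕ}

/-- The derivative in the `i`-th variable. -/
def partialFDeriv (f : (Fin n → EuclideanSpace ℝ (Fin k)) → ℝ) (i : Fin n)
    (x : Fin n → EuclideanSpace ℝ (Fin k)) :
    EuclideanSpace ℝ (Fin k) →L[ℝ] ℝ :=
  (fderiv ℝ f x).comp (ContinuousLinearMap.single ℝ (fun _ => EuclideanSpace ℝ (Fin k)) i)

theorem partialFDeriv_apply (f : (Fin n → EuclideanSpace ℝ (Fin k)) → ℝ) (i : Fin n)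
    (x : Fin n → EuclideanSpace ℝ (Fin k)) (v : EuclideanSpace ℝ (Fin k)) :
    partialFDeriv f i x v = fderiv ℝ f x (Pi.single i v) := rfl

theorem fderiv_update {f : (Fin n → EuclideanSpace ℝ (Fin k)) → ℝ}
    (hf : Differentiable ℝ f) (i : Fin n)
    (x : Fin n → EuclideanSpace ℝ (Fin k))
    (z : EuclideanSpace ℝ (Fin k)) : fderiv ℝ (fun z => f (Function.update x i z)) z =
      partialFDeriv f i (Function.update x i z) := by
  have h1 := (hf (Function.update x i z)).hasFDerivAt.comp z (hasFDerivAt_update (𝕜 := ℝ) x z)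
  rw [Function.comp_def] at h1
  rw [h1.fderiv]
  ext v
  rw [partialFDeriv_apply]
  simp only [ContinuousLinearMap.comp_apply]
  congr 1
  ext j : 1
  by_cases h : j = i
  · subst h; simp
  · simp [h]

theorem norm_partialFDeriv_le {f : (Fin n → EuclideanSpace ℝ (Fin k)) → ℝ}
    (hf : Differentiable ℝ f) {b : ℝ} (hb : 0 ≤ b)
    (H : ∀ x i z, |f (Function.update x i z) - f x| ≤ b * ‖z - x i‖)
    (i : Fin n) (x : Fin n → EuclideanSpace ℝ (Fin k)) :
    ‖partialFDeriv f i x‖ ≤ b := by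
  refine ContinuousLinearMap.opNorm_le_bound _ hb fun v => ?_
  rw [partialFDeriv_apply]
  refine abs_fderiv_le_of_lip (hf x) (by positivity) fun s => ?_
  have h1 : x + s • (Pi.single i v : Fin n → EuclideanSpace ℝ (Fin k)) =
      Function.update x i (x i + s • v) := by
    ext j : 1
    by_cases h : j = i
    · subst h; simp
    · simp [h]
  rw [h1]
  refine (H _ _ _).trans_eq ?_
  rw [add_sub_cancel_left, norm_smul, Real.norm_eq_abs]
  ring

/-- Testing the derivative on the vector of Riesz representatives of the partial derivatives gives
`T ≤ a * √T` for the sum `T`. -/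
theorem sum_norm_partialFDeriv_sq_le {f : (Fin n → EuclideanSpace ℝ (Fin k)) → ℝ}
    (hf : Differentiable ℝ f) {a : ℝ}
    (ha : 0 ≤ a) (H : ∀ x y, |f x - f y| ≤ a * √(∑ i, ‖x i - y i‖ ^ 2))
    (x : Fin n → EuclideanSpace ℝ (Fin k)) :
    ∑ i, ‖partialFDeriv f i x‖ ^ 2 ≤ a ^ 2 := by
  let v : Fin n → EuclideanSpace ℝ (Fin k) := fun i =>
    (InnerProductSpace.toDual ℝ (EuclideanSpace ℝ (Fin k))).symm (partialFDeriv f i x)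
  have hv : ∀ i, ‖v i‖ = ‖partialFDeriv f i x‖ := fun i => LinearIsometryEquiv.norm_map _ _
  have h1 : fderiv ℝ f x v = ∑ i, ‖partialFDeriv f i x‖ ^ 2 := by
    have : v = ∑ i, Pi.single i (v i) := (Finset.univ_sum_single v).symm
    conv_lhs => rw [this, map_sum]
    refine Finset.sum_congr rfl fun i _ => ?_
    rw [← partialFDeriv_apply, ← hv, ← real_inner_self_eq_norm_sq]
    exact (InnerProductSpace.toDual_symm_apply (𝕜 := ℝ) (x := v i) (y := partialFDeriv f i x)).symm
  have h2 : |fderiv ℝ f x v| ≤ a * √(∑ i, ‖v i‖ ^ 2) := by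
    refine abs_fderiv_le_of_lip (hf x) (by positivity) fun s => ?_
    refine (H _ _).trans_eq ?_
    rw [mul_assoc, ← Real.sqrt_sq_eq_abs, ← Real.sqrt_mul (by positivity), Finset.sum_mul]
    congr 3
    ext i
    simp only [Pi.add_apply, Pi.smul_apply, add_sub_cancel_left, norm_smul, mul_pow,
      Real.norm_eq_abs, sq_abs]
    ring
  set T := ∑ i, ‖partialFDeriv f i x‖ ^ 2 with hT
  simp_rw [hv, ← hT] at h2
  have hT0 : 0 ≤ T := by positivity
  rw [h1, abs_of_nonneg hT0] at h2
  rcases hT0.eq_or_lt with h0 | h0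
  · rw [← h0]; positivity
  · have h3 : √T ≤ a := by
      have hs := Real.sqrt_pos.2 h0
      have : √T * √T ≤ a * √T := by rwa [Real.mul_self_sqrt hT0]
      exact le_of_mul_le_mul_right this hs
    calc T = √T ^ 2 := (Real.sq_sqrt hT0).symm
      _ ≤ a ^ 2 := by gcongr

/-- Exponential moments of smooth bounded functions of independent variables whose law satisfies a
Poincaré inequality. -/
theorem PoincareWith.cgf_pi_le {ν : Measure (EuclideanSpace ℝ (Fin k))} [IsProbabilityMeasure ν]
    {M : ℝ} (hP : PoincareWith M ν) (hM : 0 ≤ M) {f : (Fin n → EuclideanSpace ℝ (Fin k)) → ℝ}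
    (hf : ContDiff ℝ 1 f) {a b B l : ℝ} (ha : 0 ≤ a) (hb : 0 ≤ b) (hB : ∀ x, |f x| ≤ B)
    (H₁ : ∀ x y, |f x - f y| ≤ a * √(∑ i, ‖x i - y i‖ ^ 2))
    (H₂ : ∀ x i z, |f (Function.update x i z) - f x| ≤ b * ‖z - x i‖)
    (hl : 0 < l) (hlb : M * (l * b) ^ 2 ≤ 1) :
    cgf f (Measure.pi fun _ : Fin n => ν) l ≤
      l * ∫ x, f x ∂(Measure.pi fun _ : Fin n => ν) + mlsiConst * M * a ^ 2 * l ^ 2 := by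
  have hfm : Measurable f := hf.continuous.measurable
  have hfd : Differentiable ℝ f := hf.differentiable one_ne_zero
  refine cgf_le_of_ent_le hfm hB hl fun t ht htl => ?_
  have hK := mlsiConst_pos
  have B0 : 0 ≤ B := (abs_nonneg _).trans (hB 0)
  have hexp : ∀ x, Real.exp (-(t * B)) ≤ Real.exp (t * f x) ∧
      Real.exp (t * f x) ≤ Real.exp (t * B) := by
    intro x
    have := abs_le.1 (hB x)
    constructor <;> apply Real.exp_le_exp.2 <;> nlinarith
  have hcont : ∀ i, Continuous (partialFDeriv f i) := fun i =>
    (hf.continuous_fderiv one_ne_zero).clm_comp continuous_const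
  -- The bound of `PoincareWith.mlsi` for `t * f` in the variable `i`. Its smallness condition
  -- involves only the coordinate constant `b`, while the sum over `i` only involves `a`.
  let Γ : Fin n → (Fin n → EuclideanSpace ℝ (Fin k)) → ℝ := fun i x =>
    mlsiConst * M * (t ^ 2 * ‖partialFDeriv f i x‖ ^ 2 * Real.exp (t * f x))
  have hΓm : ∀ i, Measurable (Γ i) := fun i =>
    (continuous_const.mul ((continuous_const.mul ((hcont i).norm.pow 2)).mul
      (Real.continuous_exp.comp (continuous_const.mul hf.continuous)))).measurable
  have hΓb : ∀ i x, |Γ i x| ≤ mlsiConst * M * (t ^ 2 * b ^ 2 * Real.exp (t * B)) := by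
    intro i x
    have h1 := norm_partialFDeriv_le hfd hb H₂ i x
    have h2 := (hexp x).2
    rw [abs_of_nonneg (by positivity)]
    simp only [Γ]
    gcongr
  have key := ent_pi_le ν (Real.exp_pos (-(t * B))) n (fun x => Real.exp (t * f x)) Γ
    (by fun_prop) (fun x => (hexp x).1) (fun x => (hexp x).2) hΓm hΓb ?_
  · refine key.trans ?_
    rw [← integral_finsetSum _ fun i _ => integrable_of_measurable_of_le (hΓm i) (hΓb i),
      ← integral_const_mul]
    have hi : Integrable (fun x => Real.exp (t * f x)) (Measure.pi fun _ : Fin n => ν) :=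
      integrable_of_measurable_of_le (C := Real.exp (t * B)) (by fun_prop) fun x => by
        rw [abs_of_pos (Real.exp_pos _)]; exact (hexp x).2
    refine integral_mono (integrable_finsetSum _ fun i _ =>
      integrable_of_measurable_of_le (hΓm i) (hΓb i)) (hi.const_mul _) fun x => ?_
    have h1 := sum_norm_partialFDeriv_sq_le hfd ha H₁ x
    simp only [Γ]
    rw [← Finset.mul_sum, ← Finset.sum_mul, ← Finset.mul_sum]
    calc mlsiConst * M * (t ^ 2 * (∑ i, ‖partialFDeriv f i x‖ ^ 2) * Real.exp (t * f x))
        ≤ mlsiConst * M * (t ^ 2 * a ^ 2 * Real.exp (t * f x)) := by gcongr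
      _ = _ := by ring
  · intro i x
    have hupd : ContDiff ℝ 1 (fun z : EuclideanSpace ℝ (Fin k) => Function.update x i z) :=
      contDiff_update 1 x i
    have hfu : Differentiable ℝ fun z : EuclideanSpace ℝ (Fin k) => f (Function.update x i z) :=
      hfd.comp (hupd.differentiable one_ne_zero)
    have hder : ∀ z : EuclideanSpace ℝ (Fin k),
        fderiv ℝ (fun z => t * f (Function.update x i z)) z =
        t • partialFDeriv f i (Function.update x i z) := by
      intro z
      rw [fderiv_const_mul (hfu z), fderiv_update hfd]
    have := hP.mlsi hM (g := fun z => t * f (Function.update x i z))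
      (contDiff_const.mul (hf.comp hupd)) (B := t * B) (c := t * b)
      (fun z => by rw [abs_mul, abs_of_pos ht]; gcongr; exact hB _)
      (fun z => by
        rw [hder, norm_smul, Real.norm_eq_abs, abs_of_pos ht]
        gcongr
        exact norm_partialFDeriv_le hfd hb H₂ i _)
      (by
        refine le_trans ?_ hlb
        gcongr)
    refine this.trans_eq ?_
    rw [← integral_const_mul]
    refine integral_congr_ae (Filter.Eventually.of_forall fun z => ?_)
    simp only [Γ]
    rw [hder, norm_smul, Real.norm_eq_abs, mul_pow, sq_abs]

end Concentration

/-! ### Removal of smoothness and boundedness. -/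

section Mollify

open Metric in
/-- Smoothing of a bounded uniformly continuous function; increments are not enlarged. -/
theorem exists_contDiff_approx {V : Type*} [NormedAddCommGroup V] [NormedSpace ℝ V]
    [FiniteDimensional ℝ V] {h : V → ℝ} (hh : UniformContinuous h) {ε : ℝ} (hε : 0 < ε) :
    ∃ g : V → ℝ, ContDiff ℝ 1 g ∧ (∀ x, |g x - h x| ≤ ε) ∧
      ∀ x y C, (∀ t, |h (x - t) - h (y - t)| ≤ C) → |g x - g y| ≤ C := by
  borelize V
  let μ : Measure V := Measure.addHaar
  obtain ⟨r, hr, hr'⟩ := Metric.uniformContinuous_iff.1 hh ε hε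
  let φ : ContDiffBump (0 : V) := ⟨r / 2, r, half_pos hr, half_lt_self hr⟩
  have hloc : LocallyIntegrable h μ := hh.continuous.locallyIntegrable
  refine ⟨convolution (φ.normed μ) h (ContinuousLinearMap.lsmul ℝ ℝ) μ, ?_, ?_, ?_⟩
  · exact φ.hasCompactSupport_normed.contDiff_convolution_left _ φ.contDiff_normed hloc
  · intro x
    exact φ.dist_normed_convolution_le hloc.aestronglyMeasurable fun y hy => (hr' hy).le
  · intro x y C hC
    have hex : ConvolutionExists (φ.normed μ) h (ContinuousLinearMap.lsmul ℝ ℝ) μ :=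
      φ.hasCompactSupport_normed.convolutionExists_left _ φ.continuous_normed hloc
    have h1 : ∀ z, convolution (φ.normed μ) h (ContinuousLinearMap.lsmul ℝ ℝ) μ z =
        ∫ t, φ.normed μ t * h (z - t) ∂μ := fun z => rfl
    have hi : ∀ z, Integrable (fun t => φ.normed μ t * h (z - t)) μ := fun z => hex z
    rw [h1, h1, ← integral_sub (hi x) (hi y)]
    calc _ ≤ ∫ t, φ.normed μ t * C ∂μ := by
          rw [← Real.norm_eq_abs]
          refine norm_integral_le_of_norm_le (φ.integrable_normed.mul_const C)
            (Filter.Eventually.of_forall fun t => ?_)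
          rw [← mul_sub, norm_mul, Real.norm_of_nonneg (φ.nonneg_normed t)]
          exact mul_le_mul_of_nonneg_left (hC t) (φ.nonneg_normed t)
      _ = C := by rw [integral_mul_const, φ.integral_normed, one_mul]

variable {n k : ℕ}

theorem uniformContinuous_of_lip {f : (Fin n → EuclideanSpace ℝ (Fin k)) → ℝ} {a : ℝ} (ha : 0 ≤ a)
    (H : ∀ x y, |f x - f y| ≤ a * √(∑ i, ‖x i - y i‖ ^ 2)) : UniformContinuous f := by
  have : LipschitzWith (a * √n).toNNReal f := by
    refine LipschitzWith.of_dist_le' fun x y => ?_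
    refine (H x y).trans ?_
    rw [mul_assoc]
    gcongr
    rw [dist_eq_norm, ← Real.sqrt_sq (norm_nonneg (x - y)), ← Real.sqrt_mul (by positivity)]
    gcongr
    calc ∑ i, ‖x i - y i‖ ^ 2 ≤ ∑ _i : Fin n, ‖x - y‖ ^ 2 := by
          gcongr with i
          exact norm_le_pi_norm (x - y) i
      _ = _ := by simp
  exact this.uniformContinuous

/-- Exponential moments of Lipschitz functions of independent variables whose law satisfies a
Poincaré inequality. -/
theorem PoincareWith.exp_moment_le {ν : Measure (EuclideanSpace ℝ (Fin k))} [IsProbabilityMeasure ν]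
    {M : ℝ} (hP : PoincareWith M ν) (hM : 0 ≤ M) {f : (Fin n → EuclideanSpace ℝ (Fin k)) → ℝ}
    (hf : Integrable f (Measure.pi fun _ : Fin n => ν)) {a b l : ℝ} (ha : 0 ≤ a) (hb : 0 ≤ b)
    (H₁ : ∀ x y, |f x - f y| ≤ a * √(∑ i, ‖x i - y i‖ ^ 2))
    (H₂ : ∀ x i z, |f (Function.update x i z) - f x| ≤ b * ‖z - x i‖)
    (hl : 0 < l) (hlb : M * (l * b) ^ 2 ≤ 1) :
    ∫⁻ x, ENNReal.ofReal (Real.exp (l * f x)) ∂(Measure.pi fun _ : Fin n => ν) ≤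
      ENNReal.ofReal (Real.exp (l * ∫ x, f x ∂(Measure.pi fun _ : Fin n => ν) +
        mlsiConst * M * a ^ 2 * l ^ 2)) := by
  set P := Measure.pi fun _ : Fin n => ν with hPdef
  -- Truncation at level `N` followed by smoothing with error `1 / (N + 1)`; neither enlarges
  -- increments, so both Lipschitz hypotheses survive.
  let tr : ℕ → (Fin n → EuclideanSpace ℝ (Fin k)) → ℝ := fun N x => max (-N : ℝ) (min (f x) N)
  have hcl : ∀ (N : ℕ) (s t : ℝ), |max (-N : ℝ) (min s N) - max (-N : ℝ) (min t N)| ≤ |s - t| := by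
    intro N s t
    refine (abs_max_sub_max_le_max _ _ _ _).trans ?_
    refine max_le (by simp) ((abs_min_sub_min_le_max _ _ _ _).trans ?_)
    simp
  have htrB : ∀ N x, |tr N x| ≤ N := fun N x => by
    rw [abs_le]
    exact ⟨le_max_left _ _, max_le (by linarith [N.cast_nonneg (α := ℝ)]) (min_le_right _ _)⟩
  have htrf : ∀ N x, |tr N x| ≤ |f x| := fun N x => by
    simpa using hcl N (f x) 0
  have hf1 : ∀ N x y, |tr N x - tr N y| ≤ a * √(∑ i, ‖x i - y i‖ ^ 2) :=
    fun N x y => (hcl N _ _).trans (H₁ x y)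
  have hf2 : ∀ N x i z, |tr N (Function.update x i z) - tr N x| ≤ b * ‖z - x i‖ :=
    fun N x i z => (hcl N _ _).trans (H₂ x i z)
  have hε : ∀ N : ℕ, (0 : ℝ) < 1 / (N + 1) := fun N => Nat.one_div_pos_of_nat
  choose g hg1 hg2 hg3 using fun N =>
    exists_contDiff_approx (uniformContinuous_of_lip ha (hf1 N)) (hε N)
  have hg4 : ∀ N x y, |g N x - g N y| ≤ a * √(∑ i, ‖x i - y i‖ ^ 2) := by
    intro N x y
    refine hg3 N x y _ fun t => (hf1 N _ _).trans_eq ?_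
    simp
  have hg5 : ∀ N x i z, |g N (Function.update x i z) - g N x| ≤ b * ‖z - x i‖ := by
    intro N x i z
    refine hg3 N _ x _ fun t => ?_
    have : Function.update x i z - t = Function.update (x - t) i (z - t i) := by
      ext j : 1
      by_cases h : j = i
      · subst h; simp
      · simp [h]
    rw [this]
    refine (hf2 N _ _ _).trans_eq ?_
    simp
  have hgB : ∀ N x, |g N x| ≤ N + 1 := by
    intro N x
    have h1 := hg2 N x
    have h2 := htrB N x
    have h3 : (1 : ℝ) / (N + 1) ≤ 1 := by
      rw [div_le_one (by positivity)]; linarith [N.cast_nonneg (α := ℝ)]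
    have := abs_sub_abs_le_abs_sub (g N x) (tr N x)
    linarith
  have hgf : ∀ N x, |g N x| ≤ |f x| + 1 := by
    intro N x
    have h1 := hg2 N x
    have h2 := htrf N x
    have h3 : (1 : ℝ) / (N + 1) ≤ 1 := by
      rw [div_le_one (by positivity)]; linarith [N.cast_nonneg (α := ℝ)]
    have := abs_sub_abs_le_abs_sub (g N x) (tr N x)
    linarith
  have hlim : ∀ x, Filter.Tendsto (fun N => g N x) Filter.atTop (nhds (f x)) := by
    intro x
    have h1 : Filter.Tendsto (fun N => g N x - tr N x) Filter.atTop (nhds 0) :=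
      squeeze_zero_norm (fun N => hg2 N x) tendsto_one_div_add_atTop_nhds_zero_nat
    have h2 : Filter.Tendsto (fun N => tr N x) Filter.atTop (nhds (f x)) := by
      refine tendsto_const_nhds.congr' ?_
      obtain ⟨N₀, hN₀⟩ := exists_nat_ge |f x|
      filter_upwards [Filter.eventually_ge_atTop N₀] with N hN
      have : |f x| ≤ N := hN₀.trans (by exact_mod_cast hN)
      have := abs_le.1 this
      simp only [tr]
      rw [min_eq_left this.2, max_eq_right this.1]
    simpa using h1.add h2
  have hm : Filter.Tendsto (fun N => ∫ x, g N x ∂P) Filter.atTop (nhds (∫ x, f x ∂P)) :=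
    tendsto_integral_of_dominated_convergence (fun x => |f x| + 1)
      (fun N => (hg1 N).continuous.measurable.aestronglyMeasurable)
      (hf.abs.add (integrable_const 1)) (fun N => Filter.Eventually.of_forall (hgf N))
      (Filter.Eventually.of_forall hlim)
  have hN : ∀ N, ∫⁻ x, ENNReal.ofReal (Real.exp (l * g N x)) ∂P ≤
      ENNReal.ofReal (Real.exp (l * ∫ x, g N x ∂P + mlsiConst * M * a ^ 2 * l ^ 2)) := by
    intro N
    have h1 := hP.cgf_pi_le hM (hg1 N) ha hb (hgB N) (hg4 N) (hg5 N) hl hlb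
    have hi : Integrable (fun x => Real.exp (l * g N x)) P :=
      integrable_comp_of_le (hg1 N).continuous (hgB N) (φ := fun t => Real.exp (l * t))
        (by fun_prop)
    rw [← ofReal_integral_eq_lintegral_ofReal hi
      (Filter.Eventually.of_forall fun x => (Real.exp_pos _).le)]
    refine ENNReal.ofReal_le_ofReal ?_
    have h2 : 0 < ∫ x, Real.exp (l * g N x) ∂P := integral_exp_pos hi
    rw [← Real.exp_log h2]
    exact Real.exp_le_exp.2 h1
  have hF : ∀ x, ENNReal.ofReal (Real.exp (l * f x)) =
      Filter.liminf (fun N => ENNReal.ofReal (Real.exp (l * g N x))) Filter.atTop := by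
    intro x
    refine (Filter.Tendsto.liminf_eq ?_).symm
    exact (ENNReal.continuous_ofReal.tendsto _).comp
      ((Real.continuous_exp.tendsto _).comp ((hlim x).const_mul l))
  -- Fatou's lemma, since no exponential moment of `f` is known to be finite beforehand; the means
  -- converge by domination.
  simp_rw [hF]
  refine (lintegral_liminf_le fun N => ?_).trans ?_
  · have := (hg1 N).continuous.measurable
    fun_prop
  · refine (Filter.liminf_le_liminf (Filter.Eventually.of_forall hN)).trans_eq ?_
    refine Filter.Tendsto.liminf_eq ?_
    exact (ENNReal.continuous_ofReal.tendsto _).comp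
      ((Real.continuous_exp.tendsto _).comp ((hm.const_mul l).add_const _))

end Mollify

/-! ### Deviation of the empirical mass of a set. -/

section Discrepancy

variable {n k : ℕ}

theorem empirical_apply (x : Fin n → EuclideanSpace ℝ (Fin k)) {s : Set (EuclideanSpace ℝ (Fin k))}
    (hs : MeasurableSet s) :
    empirical x s = ENNReal.ofReal ((∑ i, s.indicator (fun _ => (1 : ℝ)) (x i)) / n) := by
  rcases Nat.eq_zero_or_pos n with rfl | hn
  · simp [empirical]
  have hn' : (0 : ℝ) < n := by exact_mod_cast hn
  have e : ∀ y, Measure.dirac y s = ENNReal.ofReal (s.indicator (fun _ => (1 : ℝ)) y) := by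
    intro y
    rw [Measure.dirac_apply' _ hs]
    by_cases h : y ∈ s <;> simp [h]
  rw [empirical, Measure.smul_apply, Measure.finsetSum_apply, ENNReal.ofReal_div_of_pos hn',
    ENNReal.ofReal_sum_of_nonneg fun i _ => Set.indicator_nonneg (fun _ _ => zero_le_one) _,
    ENNReal.div_eq_inv_mul]
  simp [e]

theorem measurable_empirical_apply {s : Set (EuclideanSpace ℝ (Fin k))} (hs : MeasurableSet s) :
    Measurable fun x : Fin n → EuclideanSpace ℝ (Fin k) => empirical x s := by
  simp_rw [fun x : Fin n → EuclideanSpace ℝ (Fin k) => empirical_apply x hs]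
  have : Measurable (s.indicator fun _ => (1 : ℝ)) := measurable_const.indicator hs
  fun_prop

/-- The mean deviation of the empirical measure of a set. -/
theorem lintegral_empirical_sub_le (hn : 1 ≤ n) (ν : Measure (EuclideanSpace ℝ (Fin k)))
    [IsProbabilityMeasure ν] {s : Set (EuclideanSpace ℝ (Fin k))} (hs : MeasurableSet s) :
    ∫⁻ x, ((ν s - empirical x s) + (empirical x s - ν s)) ∂(Measure.pi fun _ : Fin n => ν) ≤
      (ν s / n) ^ (1 / 2 : ℝ) := by
  have hn' : (0 : ℝ) < n := by exact_mod_cast hn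
  let P : Measure (Fin n → EuclideanSpace ℝ (Fin k)) := Measure.pi fun _ => ν
  let Y : EuclideanSpace ℝ (Fin k) → ℝ := s.indicator fun _ => 1
  have hYm : Measurable Y := measurable_const.indicator hs
  have hY0 : ∀ y, 0 ≤ Y y := fun y => Set.indicator_nonneg (fun _ _ => zero_le_one) _
  have hY1 : ∀ y, Y y ≤ 1 := fun y => Set.indicator_le_self' (fun _ _ => zero_le_one) _ |>.trans
    le_rfl
  have hYb : ∀ y, |Y y| ≤ 1 := fun y => by rw [abs_of_nonneg (hY0 y)]; exact hY1 y
  have hYi : Integrable Y ν := integrable_of_measurable_of_le hYm hYb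
  have hYL : MemLp Y 2 ν := MemLp.of_bound hYm.aestronglyMeasurable 1
    (Filter.Eventually.of_forall hYb)
  have hYint : ∫ y, Y y ∂ν = ν.real s := by simp [Y, integral_indicator hs]
  have hYsq : ∀ y, Y y ^ 2 = Y y := fun y => by by_cases h : y ∈ s <;> simp [Y, h]
  have hvar : variance Y ν ≤ ν.real s := by
    refine (variance_le_expectation_sq hYm.aestronglyMeasurable).trans_eq ?_
    rw [← hYint]
    simp [hYsq]
  let T : (Fin n → EuclideanSpace ℝ (Fin k)) → ℝ := ∑ i, fun x => Y (x i)
  have hT : ∀ x, T x = ∑ i, Y (x i) := fun x => by simp [T]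
  have hTm : Measurable T := by
    have : T = fun x => ∑ i, Y (x i) := funext hT
    rw [this]; fun_prop
  have hTvar : variance T P ≤ n * ν.real s := by
    have := variance_sum_pi (μ := fun _ : Fin n => ν) (X := fun _ => Y) fun _ => hYL
    refine this.trans_le ?_
    simp only [Finset.sum_const, Finset.card_univ, Fintype.card_fin, nsmul_eq_mul]
    gcongr
  have hcoord : ∀ i, ∫ x, Y (x i) ∂P = ν.real s := by
    intro i
    rw [← hYint]
    have := (measurePreserving_eval (fun _ : Fin n => ν) i)
    conv_rhs => rw [← this.map_eq]
    rw [integral_map this.measurable.aemeasurable hYm.aestronglyMeasurable]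
  have hcoordi : ∀ i, Integrable (fun x : Fin n → EuclideanSpace ℝ (Fin k) => Y (x i)) P :=
    fun i => integrable_of_measurable_of_le (by fun_prop) fun x => hYb _
  have hTmean : ∫ x, T x ∂P = n * ν.real s := by
    simp_rw [hT]
    rw [integral_finsetSum _ fun i _ => hcoordi i]
    simp [hcoord]
  let W : (Fin n → EuclideanSpace ℝ (Fin k)) → ℝ := fun x => (n : ℝ)⁻¹ * T x
  have hWm : Measurable W := by fun_prop
  have hWmean : ∫ x, W x ∂P = ν.real s := by
    rw [integral_const_mul, hTmean, inv_mul_cancel_left₀ hn'.ne']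
  have hWL : MemLp W 2 P := by
    refine MemLp.of_bound hWm.aestronglyMeasurable ((n : ℝ)⁻¹ * n)
      (Filter.Eventually.of_forall fun x => ?_)
    rw [norm_mul, Real.norm_of_nonneg (by positivity), hT]
    gcongr
    refine (norm_sum_le _ _).trans ((Finset.sum_le_sum fun i _ => hYb (x i)).trans_eq ?_)
    simp
  have hWvar : variance W P ≤ ν.real s / n := by
    have : variance W P = (n : ℝ)⁻¹ ^ 2 * variance T P := variance_const_mul _ _ _
    rw [this]
    calc (n : ℝ)⁻¹ ^ 2 * variance T P ≤ (n : ℝ)⁻¹ ^ 2 * (n * ν.real s) := by gcongr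
      _ = _ := by field_simp
  -- Of the two truncated differences one vanishes, so their sum is an absolute deviation, whose
  -- mean is at most the standard deviation.
  have hpt : ∀ x, (ν s - empirical x s) + (empirical x s - ν s) ≤ ‖W x - ∫ x, W x ∂P‖ₑ := by
    intro x
    have h1 : empirical x s = ENNReal.ofReal (W x) := by
      rw [empirical_apply x hs]; congr 1; simp only [W, hT, Y]; rw [div_eq_inv_mul]
    have hW0 : 0 ≤ W x := by
      simp only [W, hT]
      exact mul_nonneg (by positivity) (Finset.sum_nonneg fun i _ => hY0 _)
    have h2 : ν s = ENNReal.ofReal (ν.real s) := (ofReal_measureReal).symm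
    rw [h1, h2, hWmean, ← ENNReal.ofReal_sub _ hW0, ← ENNReal.ofReal_sub _ measureReal_nonneg,
      Real.enorm_eq_ofReal_abs]
    rcases le_total (W x) (ν.real s) with h | h
    · rw [ENNReal.ofReal_of_nonpos (sub_nonpos.2 h), add_zero, abs_sub_comm]
      exact ENNReal.ofReal_le_ofReal (le_abs_self _)
    · rw [ENNReal.ofReal_of_nonpos (sub_nonpos.2 h), zero_add]
      exact ENNReal.ofReal_le_ofReal (le_abs_self _)
  calc _ ≤ ∫⁻ x, ‖W x - ∫ x, W x ∂P‖ₑ ∂P := lintegral_mono hpt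
    _ = eLpNorm (fun x => W x - ∫ x, W x ∂P) 1 P := by rw [eLpNorm_one_eq_lintegral_enorm]
    _ ≤ eLpNorm (fun x => W x - ∫ x, W x ∂P) 2 P :=
        eLpNorm_le_eLpNorm_of_exponent_le (by norm_num) (by fun_prop)
    _ = (evariance W P) ^ (1 / 2 : ℝ) := by
        rw [eLpNorm_eq_lintegral_rpow_enorm_toReal (by norm_num) (by norm_num)]
        simp [evariance]
    _ ≤ (ν s / n) ^ (1 / 2 : ℝ) := by
        rw [← ofReal_variance hWL]
        gcongr
        refine (ENNReal.ofReal_le_ofReal hWvar).trans_eq ?_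
        rw [ENNReal.ofReal_div_of_pos hn', ofReal_measureReal, ENNReal.ofReal_natCast]

end Discrepancy

/-! ### Dyadic annuli and exponential tails. -/

section Annuli

variable {k : ℕ}

/-- The index `l` of the annulus `{2^(l-1) A < ‖x‖ ≤ 2^l A}` that contains `x`. -/
def annulus (A : ℝ) (x : EuclideanSpace ℝ (Fin k)) : ℕ := ⌈Real.logb 2 (‖x‖ / A)⌉₊

theorem measurable_annulus (A : ℝ) : Measurable (annulus A : EuclideanSpace ℝ (Fin k) → ℕ) := by
  unfold annulus Real.logb
  exact Nat.measurable_ceil.comp (by fun_prop)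

theorem norm_le_of_annulus {A : ℝ} (hA : 0 < A) (x : EuclideanSpace ℝ (Fin k)) :
    ‖x‖ ≤ 2 ^ annulus A x * A := by
  rcases eq_or_ne x 0 with rfl | hx
  · simp only [norm_zero]; positivity
  have h0 : 0 < ‖x‖ / A := div_pos (norm_pos_iff.2 hx) hA
  rw [← div_le_iff₀ hA]
  have := (Real.logb_le_iff_le_rpow one_lt_two h0).1 (Nat.le_ceil (Real.logb 2 (‖x‖ / A)))
  rwa [Real.rpow_natCast] at this

/-- Only positive indices have a lower bound: `⌈·⌉₊` vanishes on nonpositive numbers, so index `0`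
is the whole ball of radius `A`, and `Real.logb 2 0 = 0` puts the origin there. -/
theorem lt_norm_of_annulus {A : ℝ} (hA : 0 < A) {x : EuclideanSpace ℝ (Fin k)} {l : ℕ}
    (h : annulus A x = l + 1) : 2 ^ l * A < ‖x‖ := by
  have h1 : l < annulus A x := by omega
  rw [annulus, Nat.lt_ceil] at h1
  have hx : x ≠ 0 := by
    rintro rfl
    simp at h1
    exact absurd h1 (not_lt.2 (Nat.cast_nonneg l))
  have h0 : 0 < ‖x‖ / A := div_pos (norm_pos_iff.2 hx) hA
  rw [Real.lt_logb_iff_rpow_lt one_lt_two h0, Real.rpow_natCast, lt_div_iff₀ hA] at h1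
  exact h1

/-- The constant of the exponential tail bound. -/
def tailConst : ℝ := Real.exp (1 + mlsiConst)

/-- A Poincaré inequality implies exponential tails. -/
theorem PoincareWith.measure_norm_gt_le {ν : Measure (EuclideanSpace ℝ (Fin k))}
    [IsProbabilityMeasure ν] {M A : ℝ} (hP : PoincareWith M ν) (hM : 0 ≤ M) (hA : 0 < A)
    (hMA : M ≤ A ^ 2) (hint : Integrable (fun x => ‖x‖) ν) (hmean : ∫ x, ‖x‖ ∂ν ≤ A) (t : ℝ) :
    ν {x | t * A < ‖x‖} ≤ ENNReal.ofReal (tailConst * Real.exp (-t)) := by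
  have hmp := measurePreserving_eval (fun _ : Fin 1 => ν) 0
  have hi : Integrable (fun x : Fin 1 → EuclideanSpace ℝ (Fin k) => ‖x 0‖)
      (Measure.pi fun _ : Fin 1 => ν) := hmp.integrable_comp_of_integrable hint
  have hmean' : ∫ x : Fin 1 → EuclideanSpace ℝ (Fin k), ‖x 0‖ ∂(Measure.pi fun _ : Fin 1 => ν) =
      ∫ x, ‖x‖ ∂ν := by
    conv_rhs => rw [← hmp.map_eq]
    rw [integral_map hmp.measurable.aemeasurable (by fun_prop)]
  -- A sample of size one and the norm, which is `1`-Lipschitz; the parameter `1 / A` is admissible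
  -- because `M ≤ A ^ 2`. Markov's inequality then gives the tail.
  have key := hP.exp_moment_le hM (n := 1) (f := fun x => ‖x 0‖) hi (a := 1) (b := 1) (l := 1 / A)
    zero_le_one zero_le_one
    (fun x y => by
      simp only [Finset.univ_unique, Finset.sum_singleton, one_mul]
      rw [Real.sqrt_sq (norm_nonneg _)]
      exact abs_norm_sub_norm_le _ _)
    (fun x i z => by
      obtain rfl : i = 0 := Subsingleton.elim _ _
      rw [one_mul, Function.update_self]
      exact abs_norm_sub_norm_le _ _)
    (by positivity)
    (by rw [mul_one, one_div, inv_pow, ← div_eq_mul_inv]; exact div_le_one_of_le₀ hMA (sq_nonneg _))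
  have hle : ∫⁻ x, ENNReal.ofReal (Real.exp (1 / A * ‖x‖)) ∂ν ≤ ENNReal.ofReal tailConst := by
    conv_lhs => rw [← hmp.map_eq]
    rw [lintegral_map (by fun_prop) hmp.measurable]
    refine key.trans (ENNReal.ofReal_le_ofReal (Real.exp_le_exp.2 ?_))
    rw [hmean']
    have h1 : 1 / A * ∫ x, ‖x‖ ∂ν ≤ 1 := by
      rw [one_div, inv_mul_le_iff₀ hA]; simpa using hmean
    have h2 : M * (1 / A) ^ 2 ≤ 1 := by
      rw [one_div, inv_pow, ← div_eq_mul_inv]; exact div_le_one_of_le₀ hMA (sq_nonneg _)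
    have h3 := mul_le_mul_of_nonneg_left h2 mlsiConst_pos.le
    linarith
  have hsub : {x : EuclideanSpace ℝ (Fin k) | t * A < ‖x‖} ⊆
      {x | ENNReal.ofReal (Real.exp t) ≤ ENNReal.ofReal (Real.exp (1 / A * ‖x‖))} := by
    intro x hx
    refine ENNReal.ofReal_le_ofReal (Real.exp_le_exp.2 ?_)
    rw [one_div, le_inv_mul_iff₀ hA, mul_comm]
    exact le_of_lt hx
  have h4 := mul_meas_ge_le_lintegral₀ (μ := ν)
    (f := fun x => ENNReal.ofReal (Real.exp (1 / A * ‖x‖))) (by fun_prop)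
    (ENNReal.ofReal (Real.exp t))
  have h5 := (mul_le_mul_right (measure_mono hsub) _).trans (h4.trans hle)
  rw [mul_comm tailConst, Real.exp_neg, ENNReal.ofReal_mul (by positivity),
    ENNReal.ofReal_inv_of_pos (Real.exp_pos t)]
  rw [← ENNReal.mul_le_iff_le_inv (by simp [Real.exp_pos]) (by simp)]
  exact h5

/-- Points of index `l + 1` have norm above `2 ^ l * A`, and `2 ^ l = 2 ^ (l + 1) / 2`. At index `0`
the right side is at least one. -/
theorem PoincareWith.measure_annulus_le {ν : Measure (EuclideanSpace ℝ (Fin k))}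
    [IsProbabilityMeasure ν] {M A : ℝ} (hP : PoincareWith M ν) (hM : 0 ≤ M) (hA : 0 < A)
    (hMA : M ≤ A ^ 2) (hint : Integrable (fun x => ‖x‖) ν) (hmean : ∫ x, ‖x‖ ∂ν ≤ A) (l : ℕ) :
    ν (annulus A ⁻¹' {l}) ≤ ENNReal.ofReal (tailConst * Real.exp (-(2 ^ l / 2))) := by
  rcases l with _ | l
  · refine prob_le_one.trans ?_
    rw [← ENNReal.ofReal_one]
    refine ENNReal.ofReal_le_ofReal ?_
    rw [tailConst, ← Real.exp_add]
    refine Real.one_le_exp ?_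
    have := mlsiConst_pos
    norm_num
    linarith
  · refine (measure_mono ?_).trans (hP.measure_norm_gt_le hM hA hMA hint hmean (2 ^ l))
      |>.trans_eq ?_
    · intro x hx
      exact lt_norm_of_annulus hA hx
    · congr 3
      rw [pow_succ]; ring

/-- Decay in `exp (-(2 ^ l / 4))` beats the growth of the `p`-th powers of the radii. This is why
the sum over annuli costs only a constant depending on `p`, whatever `q` is. -/
theorem summable_annuli (p : ℝ) :
    Summable fun l : ℕ => ((2 : ℝ) ^ l) ^ p * Real.exp (-(2 ^ l / 4)) := by
  have h1 := tendsto_rpow_mul_exp_neg_mul_atTop_nhds_zero (p + 1) (1 / 4) (by norm_num)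
  have h2 : Filter.Tendsto (fun l : ℕ => (2 : ℝ) ^ l) Filter.atTop Filter.atTop :=
    tendsto_pow_atTop_atTop_of_one_lt one_lt_two
  have h3 := (h1.comp h2).isBigO_one ℝ
  have h4 : (fun l : ℕ => ((2 : ℝ) ^ l) ^ p * Real.exp (-(2 ^ l / 4))) =O[Filter.atTop]
      fun l : ℕ => ((1 : ℝ) / 2) ^ l := by
    refine ((Asymptotics.isBigO_refl (fun l : ℕ => ((1 : ℝ) / 2) ^ l) _).mul h3).congr ?_ ?_
    · intro l
      simp only [Function.comp]
      rw [Real.rpow_add (by positivity), Real.rpow_one, one_div_pow]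
      field_simp
    · intro l; simp
  exact summable_of_isBigO_nat (summable_geometric_two) h4

end Annuli

/-! ### Nested partitions of the annuli. -/

section Nets

variable {k : ℕ}

/-- The net is at a scale relative to the radius, so its size does not depend on `l` or `A`. Its
points lie in the annulus itself, so that replacing a point by its net point keeps the index;
assignment to a nearest net point is measurable. -/
theorem exists_annulus_net {A : ℝ} (hA : 0 < A) (j l : ℕ) :
    ∃ (q : ℕ → EuclideanSpace ℝ (Fin k)) (c : EuclideanSpace ℝ (Fin k) → ℕ), Measurable c ∧
      (∀ x, (c x : ℝ) + 1 ≤ (3 * 2 ^ j) ^ k) ∧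
      ∀ x, annulus A x = l → ‖x - q (c x)‖ ≤ 2 ^ l * A * (2 ^ j)⁻¹ ∧ annulus A (q (c x)) = l := by
  have h2j : (1 : ℝ) ≤ 2 ^ j := one_le_pow₀ one_le_two
  obtain ⟨s, hsS, hcard, hnet⟩ := exists_finset_net (V := EuclideanSpace ℝ (Fin k))
    (R := 2 ^ l * A) (ε := 2 ^ l * A * (2 ^ j)⁻¹) (by positivity) (by positivity)
    {x | annulus A x = l} (fun x hx => by
      have := norm_le_of_annulus hA x
      rwa [show annulus A x = l from hx] at this)
  have hcard' : (s.card : ℝ) ≤ (3 * 2 ^ j) ^ k := by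
    refine hcard.trans ?_
    rw [finrank_euclideanSpace_fin]
    gcongr
    have : 2 * (2 ^ l * A) / (2 ^ l * A * (2 ^ j)⁻¹) = 2 * 2 ^ j := by
      field_simp
    rw [this]
    linarith
  rcases s.eq_empty_or_nonempty with rfl | hne
  · refine ⟨fun _ => 0, fun _ => 0, measurable_const, fun x => ?_, fun x hx => ?_⟩
    · simp only [Nat.cast_zero, zero_add]
      exact one_le_pow₀ (by linarith)
    · obtain ⟨c, hc, -⟩ := hnet x hx
      exact absurd hc (Finset.notMem_empty c)
  · have hpos : 0 < s.card := hne.card_pos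
    -- The `min` extends the enumeration of the net to the sequence that `SimpleFunc.nearestPtInd`
    -- expects.
    let q : ℕ → EuclideanSpace ℝ (Fin k) := fun i =>
      s.equivFin.symm ⟨min i (s.card - 1), by omega⟩
    have hq : ∀ i, q i ∈ s := fun i => Subtype.coe_prop _
    refine ⟨q, SimpleFunc.nearestPtInd q (s.card - 1), SimpleFunc.measurable _, fun x => ?_,
      fun x hx => ⟨?_, hsS _ (hq _)⟩⟩
    · refine le_trans ?_ hcard'
      have := SimpleFunc.nearestPtInd_le q (s.card - 1) x
      have h : SimpleFunc.nearestPtInd q (s.card - 1) x + 1 ≤ s.card := by omega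
      exact_mod_cast h
    · obtain ⟨y, hy, hxy⟩ := hnet x hx
      let i := s.equivFin ⟨y, hy⟩
      have hi : (i : ℕ) ≤ s.card - 1 := by have := i.2; omega
      have hqi : q i = y := by
        simp only [q]
        have : (⟨min (i : ℕ) (s.card - 1), by omega⟩ : Fin s.card) = i := by
          ext; simp [hi]
        rw [this]
        simp [i]
      have h1 := SimpleFunc.edist_nearestPt_le q x hi
      rw [hqi, edist_dist, edist_dist, ENNReal.ofReal_le_ofReal_iff dist_nonneg] at h1
      rw [← dist_eq_norm, dist_comm]
      refine (h1.trans ?_)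
      rwa [dist_comm]

/-- The radii (relative to the radius of the annulus) of the cells of `exists_tree`. -/
def treeRadius (J : ℕ) : ℕ → ℝ
  | 0 => (2 ^ J)⁻¹
  | i + 1 => treeRadius J i + (2 ^ (J - i - 1))⁻¹

theorem treeRadius_nonneg (J i : ℕ) : 0 ≤ treeRadius J i := by
  induction i with
  | zero => rw [treeRadius]; positivity
  | succ i ih => rw [treeRadius]; positivity

/-- The displacements over successive levels form a geometric series dominated by twice its last
term. -/
theorem treeRadius_le (J i : ℕ) (h : i ≤ J) : treeRadius J i ≤ 2 * (2 ^ (J - i))⁻¹ := by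
  induction i with
  | zero =>
    rw [treeRadius, Nat.sub_zero]
    have : (0 : ℝ) < (2 ^ J)⁻¹ := by positivity
    linarith
  | succ i ih =>
    rw [treeRadius]
    have h1 := ih (by omega)
    have h2 : J - i = (J - i - 1) + 1 := by omega
    rw [h2, pow_succ, mul_inv] at h1
    rw [show J - (i + 1) = J - i - 1 by omega]
    linarith

/-- Coarser and coarser partitions of the annuli into few small cells. -/
theorem exists_tree {A : ℝ} (hA : 0 < A) (J : ℕ) :
    ∃ U : ℕ → EuclideanSpace ℝ (Fin k) → ℕ × ℕ, (∀ i, Measurable (U i)) ∧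
      (∀ i x y, U i x = U i y → U (i + 1) x = U (i + 1) y) ∧
      (∀ i x, (U i x).1 = annulus A x) ∧
      (∀ i x, i ≤ J → ((U i x).2 : ℝ) + 1 ≤ (3 * 2 ^ (J - i)) ^ k) ∧
      ∀ i x y, U i x = U i y → ‖x - y‖ ≤ 2 * treeRadius J i * A * 2 ^ (U i x).1 := by
  choose q c hc hcard hnet using fun j l => exists_annulus_net (k := k) hA j l
  let pt : ℕ → ℕ × ℕ → EuclideanSpace ℝ (Fin k) := fun j v => q j v.1 v.2
  let code : ℕ → EuclideanSpace ℝ (Fin k) → ℕ × ℕ := fun j x =>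
    (annulus A x, c j (annulus A x) x)
  have hcode : ∀ j, Measurable (code j) := by
    intro j
    have h1 : Measurable fun z : ℕ × EuclideanSpace ℝ (Fin k) => c j z.1 z.2 :=
      measurable_from_prod_countable_right fun l => hc j l
    exact (measurable_annulus A).prodMk (h1.comp ((measurable_annulus A).prodMk measurable_id))
  have hpt : ∀ j x, ‖x - pt j (code j x)‖ ≤ 2 ^ annulus A x * A * (2 ^ j)⁻¹ ∧
      annulus A (pt j (code j x)) = annulus A x := fun j x => hnet j _ x rfl
  -- Start at the finest scale; each further code is that of the net point of the previous cell, so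
  -- it is a function of the previous code and the partitions are nested.
  let U : ℕ → EuclideanSpace ℝ (Fin k) → ℕ × ℕ := fun i => Nat.rec (code J)
    (fun i u x => code (J - i - 1) (pt (J - i) (u x))) i
  have hU0 : U 0 = code J := rfl
  have hUs : ∀ i x, U (i + 1) x = code (J - (i + 1)) (pt (J - i) (U i x)) := fun i x => rfl
  have hform : ∀ i x, ∃ y, U i x = code (J - i) y ∧ annulus A y = annulus A x ∧
      ‖x - pt (J - i) (U i x)‖ ≤ treeRadius J i * A * 2 ^ annulus A x := by
    intro i x
    induction i with
    | zero =>
      refine ⟨x, rfl, rfl, ?_⟩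
      refine (hpt J x).1.trans_eq ?_
      rw [treeRadius]; ring
    | succ i ih =>
      obtain ⟨y, hy, hyx, hdist⟩ := ih
      have h1 := hpt (J - i) y
      rw [← hy, hyx] at h1
      have h2 := hpt (J - (i + 1)) (pt (J - i) (U i x))
      rw [← hUs, h1.2] at h2
      refine ⟨_, hUs i x, h1.2, ?_⟩
      rw [treeRadius]
      refine (norm_sub_le_norm_sub_add_norm_sub x (pt (J - i) (U i x)) _).trans ?_
      refine (add_le_add hdist h2.1).trans_eq ?_
      rw [show J - (i + 1) = J - i - 1 by omega]
      ring
  have hU1 : ∀ i x, (U i x).1 = annulus A x := by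
    intro i x
    obtain ⟨y, hy, hyx, -⟩ := hform i x
    rw [hy, ← hyx]
  refine ⟨U, ?_, ?_, hU1, ?_, ?_⟩
  · intro i
    induction i with
    | zero => exact hcode J
    | succ i ih =>
      exact (hcode _).comp ((measurable_of_countable (pt (J - i))).comp ih)
  · intro i x y h
    rw [hUs, hUs, h]
  · intro i x _
    obtain ⟨y, hy, -⟩ := hform i x
    rw [hy]
    exact hcard _ _ _
  · intro i x y h
    obtain ⟨-, -, -, hx⟩ := hform i x
    obtain ⟨-, -, -, hy⟩ := hform i y
    rw [← hU1 i] at hx hy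
    rw [← h, norm_sub_rev] at hy
    refine (norm_sub_le_norm_sub_add_norm_sub x (pt (J - i) (U i x)) y).trans ?_
    refine (add_le_add hx hy).trans_eq ?_
    ring

end Nets

/-! ### Summation over cells and annuli. -/

section MeanBound

variable {n k : ℕ}

/-- The constant in the bound of the mean, coming from the sum over the annuli. -/
def annuliConst (p : ℝ) : ℝ :=
  tailConst * ∑' l : ℕ, ((2 : ℝ) ^ l) ^ p * Real.exp (-(2 ^ l / 4))

theorem annuliConst_nonneg (p : ℝ) : 0 ≤ annuliConst p :=
  mul_nonneg (Real.exp_pos _).le (tsum_nonneg fun l => by positivity)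

theorem one_le_tailConst : 1 ≤ tailConst := by
  refine Real.one_le_exp ?_
  linarith [mlsiConst_pos]

theorem tsum_annuli_le {p h w : ℝ} (hh : 0 ≤ h) (hw : 0 ≤ w) {u : ℕ → ℝ≥0∞}
    (hu : ∀ l, u l ≤ ENNReal.ofReal (w * (tailConst * Real.exp (-(2 ^ l / 4))))) :
    ∑' l : ℕ, ENNReal.ofReal ((h * 2 ^ l) ^ p) * u l ≤
      ENNReal.ofReal (h ^ p * w * annuliConst p) := by
  have hs := (summable_annuli p).mul_left (h ^ p * w * tailConst)
  calc ∑' l : ℕ, ENNReal.ofReal ((h * 2 ^ l) ^ p) * u l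
      ≤ ∑' l : ℕ, ENNReal.ofReal (h ^ p * w * tailConst *
          (((2 : ℝ) ^ l) ^ p * Real.exp (-(2 ^ l / 4)))) := by
        refine ENNReal.tsum_le_tsum fun l => ?_
        refine (mul_le_mul_right (hu l) _).trans_eq ?_
        rw [← ENNReal.ofReal_mul (by positivity), Real.mul_rpow hh (by positivity)]
        congr 1
        ring
    _ = ENNReal.ofReal (h ^ p * w * annuliConst p) := by
        rw [← ENNReal.ofReal_tsum_of_nonneg _ hs, tsum_mul_left, annuliConst]
        · congr 1; ring
        · intro l
          have : 0 ≤ tailConst := (Real.exp_pos _).le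
          positivity

/-- Cauchy–Schwarz over the at most `N` cells of an annulus replaces the sum of the roots of their
masses by `√N` times the root of the mass of the annulus. The root halves the exponent `2 ^ l / 2`
to `2 ^ l / 4`, and `√tailConst ≤ tailConst`. -/
theorem tsum_cells_le (hn : 1 ≤ n) {ν : Measure (EuclideanSpace ℝ (Fin k))}
    [IsProbabilityMeasure ν] {A p h N : ℝ} (hh : 0 ≤ h) (hN : 0 ≤ N)
    (hν : ∀ l, ν (annulus A ⁻¹' {l}) ≤ ENNReal.ofReal (tailConst * Real.exp (-(2 ^ l / 2))))
    {V : EuclideanSpace ℝ (Fin k) → ℕ × ℕ} (hV : Measurable V) (h1 : ∀ x, (V x).1 = annulus A x)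
    (h2 : ∀ x, ((V x).2 : ℝ) + 1 ≤ N) :
    ∑' v : ℕ × ℕ, ENNReal.ofReal ((h * 2 ^ v.1) ^ p) * (ν (V ⁻¹' {v}) / n) ^ (1 / 2 : ℝ) ≤
      ENNReal.ofReal (h ^ p * √(N / n) * annuliConst p) := by
  have hn' : (0 : ℝ) < n := by exact_mod_cast hn
  refine (ENNReal.tsum_prod (f := fun l i : ℕ => ENNReal.ofReal ((h * 2 ^ l) ^ p) *
    (ν (V ⁻¹' {(l, i)}) / n) ^ (1 / 2 : ℝ))).trans_le ?_
  simp_rw [ENNReal.tsum_mul_left]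
  refine tsum_annuli_le hh (Real.sqrt_nonneg _) fun l => ?_
  have hzero : ∀ i ∉ Finset.range ⌊N⌋₊, (ν (V ⁻¹' {(l, i)}) / n) ^ (1 / 2 : ℝ) = 0 := by
    intro i hi
    rw [Finset.mem_range, not_lt] at hi
    have : V ⁻¹' {(l, i)} = ∅ := by
      ext x
      simp only [Set.mem_preimage, Set.mem_singleton_iff, Set.mem_empty_iff_false, iff_false]
      intro hx
      have h3 := h2 x
      rw [hx] at h3
      have h4 : i + 1 ≤ ⌊N⌋₊ := Nat.le_floor (by push_cast; exact h3)
      omega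
    simp [this]
  have hsum : ∑ i ∈ Finset.range ⌊N⌋₊, ν (V ⁻¹' {(l, i)}) ≤ ν (annulus A ⁻¹' {l}) := by
    rw [← measure_biUnion_finset]
    · refine measure_mono (Set.iUnion₂_subset fun i _ x hx => ?_)
      have : V x = (l, i) := hx
      simp [← h1, this]
    · intro i _ j _ hij
      refine Disjoint.preimage _ ?_
      simpa using hij
    · exact fun i _ => hV (measurableSet_singleton _)
  have hsum' : ∑ i ∈ Finset.range ⌊N⌋₊, ν (V ⁻¹' {(l, i)}) / n ≤ ν (annulus A ⁻¹' {l}) / n := by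
    simp_rw [div_eq_mul_inv]
    rw [← Finset.sum_mul]
    gcongr
  rw [tsum_eq_sum hzero]
  have hCS := ENNReal.inner_le_Lp_mul_Lq (Finset.range ⌊N⌋₊) (fun _ => (1 : ℝ≥0∞))
    (fun i => (ν (V ⁻¹' {(l, i)}) / n) ^ (1 / 2 : ℝ)) Real.HolderConjugate.two_two
  simp only [one_mul, ENNReal.one_rpow, Finset.sum_const, Finset.card_range, nsmul_eq_mul,
    mul_one, ← ENNReal.rpow_mul] at hCS
  norm_num at hCS
  have e : (1 / 2 : ℝ) = 2⁻¹ := by norm_num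
  simp only [e] at *
  refine hCS.trans ?_
  have h3 : (⌊N⌋₊ : ℝ≥0∞) ≤ ENNReal.ofReal N := by
    rw [← ENNReal.ofReal_natCast]
    exact ENNReal.ofReal_le_ofReal (Nat.floor_le hN)
  have h4 : ν (annulus A ⁻¹' {l}) / n ≤
      ENNReal.ofReal (tailConst * Real.exp (-(2 ^ l / 2)) / n) := by
    rw [ENNReal.ofReal_div_of_pos hn', ENNReal.ofReal_natCast]
    gcongr
    exact hν l
  have ht : 0 ≤ tailConst := (Real.exp_pos _).le
  calc (⌊N⌋₊ : ℝ≥0∞) ^ (2⁻¹ : ℝ) *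
        (∑ i ∈ Finset.range ⌊N⌋₊, ν (V ⁻¹' {(l, i)}) / n) ^ (2⁻¹ : ℝ)
      ≤ ENNReal.ofReal N ^ (2⁻¹ : ℝ) *
        ENNReal.ofReal (tailConst * Real.exp (-(2 ^ l / 2)) / n) ^ (2⁻¹ : ℝ) := by
        gcongr
        exact hsum'.trans h4
    _ = ENNReal.ofReal (√N * √(tailConst * Real.exp (-(2 ^ l / 2)) / n)) := by
        rw [ENNReal.ofReal_rpow_of_nonneg hN (by positivity),
          ENNReal.ofReal_rpow_of_nonneg (by positivity) (by positivity),
          ← ENNReal.ofReal_mul (by positivity), Real.sqrt_eq_rpow, Real.sqrt_eq_rpow]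
        norm_num
    _ ≤ _ := by
        refine ENNReal.ofReal_le_ofReal ?_
        rw [← Real.sqrt_mul hN, mul_div_assoc', mul_comm N, mul_div_assoc, mul_comm,
          Real.sqrt_mul (by positivity), Real.sqrt_mul ht]
        gcongr
        · rw [Real.sqrt_le_left ht]
          nlinarith [one_le_tailConst]
        · rw [Real.sqrt_le_left (Real.exp_pos _).le, ← Real.exp_nat_mul]
          apply Real.exp_le_exp.2
          push_cast
          linarith

end MeanBound

/-! ### The multi-scale bound of the mean transport cost. -/

section MultiScale

variable {n k : ℕ}

/-- The multi-scale bound of the mean transport cost of an empirical measure. -/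
theorem lintegral_wasserstein_rpow_le (hn : 1 ≤ n) {p : ℝ} (hp : 0 < p)
    {ν : Measure (EuclideanSpace ℝ (Fin k))} [IsProbabilityMeasure ν] {A : ℝ} (hA : 0 < A)
    (hν : ∀ l, ν (annulus A ⁻¹' {l}) ≤ ENNReal.ofReal (tailConst * Real.exp (-(2 ^ l / 2))))
    (J : ℕ) :
    ∫⁻ x, wasserstein p (empirical x) ν ^ p ∂(Measure.pi fun _ : Fin n => ν) ≤
      ENNReal.ofReal (annuliConst p * (8 * A) ^ p * (((2 : ℝ) ^ J)⁻¹ ^ p +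
        ∑ j ∈ Finset.range (J + 1), ((2 : ℝ) ^ j)⁻¹ ^ p * √((3 * 2 ^ j) ^ k / n))) := by
  obtain ⟨U, hUm, hUn, hU1, hU2, hUd⟩ := exists_tree (k := k) hA J
  -- Both costs depend on a cell only through the index of its annulus, which is the same at all
  -- levels; hence `D (i + 1)` may be evaluated at a cell of level `i`.
  let D : ℕ → ℕ × ℕ → ℝ≥0∞ := fun i v => ENNReal.ofReal ((2 * treeRadius J i * A * 2 ^ v.1) ^ p)
  let F : ℕ × ℕ → ℝ≥0∞ := fun v => ENNReal.ofReal ((2 * A * 2 ^ v.1) ^ p)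
  have hr : ∀ i, 0 ≤ treeRadius J i := treeRadius_nonneg J
  have hdisc : ∀ (G : ℕ × ℕ → ℝ≥0∞) (i : ℕ),
      ∫⁻ x, ∑' v, G v * ((ν (U i ⁻¹' {v}) - empirical x (U i ⁻¹' {v})) +
        (empirical x (U i ⁻¹' {v}) - ν (U i ⁻¹' {v}))) ∂(Measure.pi fun _ : Fin n => ν) ≤
      ∑' v, G v * (ν (U i ⁻¹' {v}) / n) ^ (1 / 2 : ℝ) := by
    intro G i
    have hm : ∀ v, Measurable fun x : Fin n → EuclideanSpace ℝ (Fin k) =>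
        empirical x (U i ⁻¹' {v}) := fun v =>
      measurable_empirical_apply (hUm i (measurableSet_singleton v))
    have hm' : ∀ v, Measurable fun x : Fin n → EuclideanSpace ℝ (Fin k) =>
        ((ν (U i ⁻¹' {v}) - empirical x (U i ⁻¹' {v})) +
        (empirical x (U i ⁻¹' {v}) - ν (U i ⁻¹' {v}))) := fun v =>
      ((measurable_const.sub (hm v)).add ((hm v).sub measurable_const))
    rw [lintegral_tsum fun v => ((hm' v).const_mul _).aemeasurable]
    refine ENNReal.tsum_le_tsum fun v => ?_
    rw [lintegral_const_mul _ (hm' v)]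
    gcongr
    exact lintegral_empirical_sub_le hn ν (hUm i (measurableSet_singleton v))
  have hpt : ∀ x : Fin n → EuclideanSpace ℝ (Fin k), wasserstein p (empirical x) ν ^ p ≤
      ∫⁻ y, D 0 (U 0 y) ∂ν +
        ∑ i ∈ Finset.range J, ∑' v, D (i + 1) v *
          ((ν (U i ⁻¹' {v}) - empirical x (U i ⁻¹' {v})) +
            (empirical x (U i ⁻¹' {v}) - ν (U i ⁻¹' {v}))) +
        ∑' v, F v * ((ν (U J ⁻¹' {v}) - empirical x (U J ⁻¹' {v})) +
          (empirical x (U J ⁻¹' {v}) - ν (U J ⁻¹' {v}))) := by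
    intro x
    have := isProbabilityMeasure_empirical hn x
    obtain ⟨γ, hγ1, hγ2, hγ3⟩ := exists_coupling_tree (ι := ℕ × ℕ)
      (c := fun z : EuclideanSpace ℝ (Fin k) × EuclideanSpace ℝ (Fin k) => ‖z.1 - z.2‖ₑ ^ p)
      (F := F) J ν (empirical x)
      inferInstance inferInstance (by simp) U D (fun i => D (i + 1)) hUm hUn
      (fun i y z h => by
        simp only [D]
        rw [← ofReal_norm, ENNReal.ofReal_rpow_of_nonneg (norm_nonneg _) hp.le]
        exact ENNReal.ofReal_le_ofReal
          (Real.rpow_le_rpow (norm_nonneg _) (hUd i y z h) hp.le))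
      (fun i y z => by
        simp only [F, hU1]
        rw [← ofReal_norm, ENNReal.ofReal_rpow_of_nonneg (norm_nonneg _) hp.le,
          ← ENNReal.ofReal_add (by positivity) (by positivity)]
        refine ENNReal.ofReal_le_ofReal ?_
        have h1 := norm_le_of_annulus hA y
        have h2 := norm_le_of_annulus hA z
        have h3 := norm_sub_le y z
        have h4 : (0 : ℝ) ≤ (2 * A * 2 ^ annulus A y) ^ p := by positivity
        have h5 : (0 : ℝ) ≤ (2 * A * 2 ^ annulus A z) ^ p := by positivity
        rcases le_total ((2 : ℝ) ^ annulus A y * A) (2 ^ annulus A z * A) with h | h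
        · refine (Real.rpow_le_rpow (norm_nonneg _) ?_ hp.le).trans (le_add_of_nonneg_left h4)
          linarith
        · refine (Real.rpow_le_rpow (norm_nonneg _) ?_ hp.le).trans (le_add_of_nonneg_right h5)
          linarith)
      (fun i y => by simp only [D, hU1]; exact le_rfl)
    rw [wasserstein_comm hp]
    refine (wasserstein_rpow_le_of_mem_couplings hp ⟨hγ1, hγ2⟩).trans (hγ3.trans ?_)
    gcongr
    exact le_self_add
  have hbase : ∫⁻ y, D 0 (U 0 y) ∂ν ≤
      ENNReal.ofReal ((2 * treeRadius J 0 * A) ^ p * 1 * annuliConst p) := by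
    have h1 : ∀ y, D 0 (U 0 y) = (fun l : ℕ => ENNReal.ofReal
        ((2 * treeRadius J 0 * A * 2 ^ l) ^ p)) (annulus A y) := fun y => by
      simp only [D, hU1]
    simp_rw [h1]
    rw [lintegral_comp_countable ν (measurable_annulus A) fun l : ℕ => ENNReal.ofReal
        ((2 * treeRadius J 0 * A * 2 ^ l) ^ p)]
    refine tsum_annuli_le (mul_nonneg (mul_nonneg zero_le_two (hr 0)) hA.le) zero_le_one
      fun l => (hν l).trans (ENNReal.ofReal_le_ofReal ?_)
    rw [one_mul]
    have : 0 < tailConst := Real.exp_pos _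
    have h2 : (0 : ℝ) < 2 ^ l := by positivity
    gcongr
    norm_num
  have hmeas : ∀ (G : ℕ × ℕ → ℝ≥0∞) (i : ℕ), Measurable fun x : Fin n →
      EuclideanSpace ℝ (Fin k) => ∑' v, G v * ((ν (U i ⁻¹' {v}) - empirical x (U i ⁻¹' {v})) +
        (empirical x (U i ⁻¹' {v}) - ν (U i ⁻¹' {v}))) := by
    intro G i
    refine Measurable.tsum fun v => Measurable.const_mul ?_ _
    have hm := measurable_empirical_apply (n := n) (hUm i (measurableSet_singleton v))
    exact (measurable_const.sub hm).add (hm.sub measurable_const)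
  have hA8 : (0 : ℝ) ≤ 8 * A := by positivity
  have hc := annuliConst_nonneg p
  calc ∫⁻ x, wasserstein p (empirical x) ν ^ p ∂(Measure.pi fun _ : Fin n => ν)
      ≤ ∫⁻ y, D 0 (U 0 y) ∂ν +
        ∑ i ∈ Finset.range J, ∑' v, D (i + 1) v * (ν (U i ⁻¹' {v}) / n) ^ (1 / 2 : ℝ) +
        ∑' v, F v * (ν (U J ⁻¹' {v}) / n) ^ (1 / 2 : ℝ) := by
        refine (lintegral_mono hpt).trans ?_
        rw [lintegral_add_right _ (hmeas F J), lintegral_add_left measurable_const,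
          lintegral_const, measure_univ, mul_one,
          lintegral_finsetSum _ fun i _ => hmeas (D (i + 1)) i]
        gcongr with i hi
        · exact hdisc _ i
        · exact hdisc _ J
    _ ≤ ENNReal.ofReal ((2 * treeRadius J 0 * A) ^ p * 1 * annuliConst p) +
        ∑ i ∈ Finset.range J, ENNReal.ofReal ((2 * treeRadius J (i + 1) * A) ^ p *
          √((3 * 2 ^ (J - i)) ^ k / n) * annuliConst p) +
        ENNReal.ofReal ((2 * A) ^ p * √((3 * 2 ^ (J - J)) ^ k / n) * annuliConst p) := by
        gcongr with i hi
        · have := Finset.mem_range.1 hi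
          exact tsum_cells_le hn (mul_nonneg (mul_nonneg zero_le_two (hr _)) hA.le) (by positivity)
            hν (hUm i) (hU1 i) fun x => hU2 i x (by omega)
        · exact tsum_cells_le hn (by positivity) (by positivity) hν (hUm J) (hU1 J)
            fun x => hU2 J x le_rfl
    _ = ENNReal.ofReal ((2 * treeRadius J 0 * A) ^ p * 1 * annuliConst p +
        ∑ i ∈ Finset.range J, ((2 * treeRadius J (i + 1) * A) ^ p *
          √((3 * 2 ^ (J - i)) ^ k / n) * annuliConst p) +
        (2 * A) ^ p * √((3 * 2 ^ (J - J)) ^ k / n) * annuliConst p) := by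
        have hterm : ∀ i : ℕ, 0 ≤ (2 * treeRadius J (i + 1) * A) ^ p *
            √((3 * 2 ^ (J - i)) ^ k / n) * annuliConst p := fun i => by
          have := hr (i + 1)
          positivity
        have h0 : 0 ≤ (2 * treeRadius J 0 * A) ^ p * 1 * annuliConst p := by
          have := hr 0
          positivity
        rw [ENNReal.ofReal_add (add_nonneg h0 (Finset.sum_nonneg fun i _ => hterm i))
          (by positivity), ENNReal.ofReal_add h0 (Finset.sum_nonneg fun i _ => hterm i),
          ENNReal.ofReal_sum_of_nonneg fun i _ => hterm i]
    _ ≤ _ := by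
        refine ENNReal.ofReal_le_ofReal ?_
        rw [Finset.sum_range_succ', ← Finset.sum_range_reflect (fun j =>
          ((2 : ℝ) ^ (j + 1))⁻¹ ^ p * √((3 * 2 ^ (j + 1)) ^ k / n)), mul_add, mul_add,
          Finset.mul_sum, ← add_assoc]
        refine add_le_add (add_le_add ?_ (Finset.sum_le_sum ?_)) ?_
        · rw [treeRadius, mul_one, mul_comm, mul_assoc (annuliConst p),
            ← Real.mul_rpow (x := 8 * A) (by positivity) (by positivity)]
          gcongr ?_ * ?_ ^ p
          have : (0 : ℝ) < (2 ^ J)⁻¹ := by positivity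
          nlinarith
        · intro i hi
          have hi' := Finset.mem_range.1 hi
          have h1 := treeRadius_le J (i + 1) (by omega)
          have e : J - 1 - i + 1 = J - i := by omega
          have e2 : J - i = J - (i + 1) + 1 := by omega
          rw [e]
          -- A discrepancy at level `i` pays the diameter of a cell of the next, coarser level,
          -- hence the factor `8`.
          have h2 : 2 * treeRadius J (i + 1) * A ≤ 8 * A * (2 ^ (J - i))⁻¹ := by
            rw [e2, pow_succ, mul_inv]
            have h3 : (0 : ℝ) < (2 ^ (J - (i + 1)))⁻¹ := by positivity
            nlinarith
          have h0 : 0 ≤ 2 * treeRadius J (i + 1) * A := by have := hr (i + 1); positivity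
          have h4 := Real.rpow_le_rpow h0 h2 hp.le
          rw [Real.mul_rpow (x := 8 * A) (by positivity) (by positivity)] at h4
          calc _ ≤ (8 * A) ^ p * ((2 ^ (J - i))⁻¹) ^ p * √((3 * 2 ^ (J - i)) ^ k / n) *
                annuliConst p := by gcongr
            _ = _ := by ring
        · rw [Nat.sub_self]
          have h4 : (2 * A) ^ p ≤ (8 * A) ^ p := by gcongr; norm_num
          calc _ ≤ (8 * A) ^ p * √((3 * 2 ^ 0) ^ k / n) * annuliConst p := by gcongr
            _ = _ := by simp; ring

end MultiScale

/-! ### Choice of the finest scale. -/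

section Rates

/-- The multi-scale sum of `lintegral_wasserstein_rpow_le`. -/
def scaleSum (p : ℝ) (k n J : ℕ) : ℝ :=
  ((2 : ℝ) ^ J)⁻¹ ^ p +
    ∑ j ∈ Finset.range (J + 1), ((2 : ℝ) ^ j)⁻¹ ^ p * √((3 * 2 ^ j) ^ k / n)

/-- In the variable `3 * 2 ^ j` no factor exponential in `k` remains; this keeps the constants
independent of the dimension. -/
theorem scaleSum_term (p : ℝ) (k n j : ℕ) :
    ((2 : ℝ) ^ j)⁻¹ ^ p * √((3 * 2 ^ j) ^ k / n) =
      3 ^ p * (n : ℝ) ^ (-(1 / 2) : ℝ) * (3 * 2 ^ j) ^ ((k : ℝ) / 2 - p) := by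
  have h2 : (0 : ℝ) < 2 ^ j := by positivity
  rw [Real.sqrt_div (by positivity), Real.rpow_sub (by positivity), Real.sqrt_eq_rpow,
    ← Real.rpow_natCast (3 * 2 ^ j : ℝ) k, ← Real.rpow_mul (by positivity),
    Real.mul_rpow (x := (3 : ℝ)) (z := p) (by norm_num) h2.le, Real.inv_rpow h2.le,
    Real.rpow_neg (by positivity), Real.sqrt_eq_rpow]
  have h3 : (0 : ℝ) < 3 ^ p := by positivity
  have h4 : (0 : ℝ) < (2 ^ j) ^ p := by positivity
  field_simp

theorem sum_pow_le_of_lt_one {r : ℝ} (h0 : 0 ≤ r) (h1 : r < 1) (m : ℕ) :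
    ∑ j ∈ Finset.range m, r ^ j ≤ (1 - r)⁻¹ := by
  rw [← tsum_geometric_of_lt_one h0 h1]
  exact (summable_geometric_of_lt_one h0 h1).sum_le_tsum _ fun _ _ => by positivity

theorem inv_two_pow_clog_rpow_le {p : ℝ} (hp : 1 ≤ p) {n : ℕ} (hn : 1 ≤ n) :
    ((2 : ℝ) ^ Nat.clog 2 n)⁻¹ ^ p ≤ (n : ℝ) ^ (-(1 / 2) : ℝ) := by
  have hn' : (1 : ℝ) ≤ n := by exact_mod_cast hn
  have h1 : (n : ℝ) ≤ 2 ^ Nat.clog 2 n := by exact_mod_cast Nat.le_pow_clog one_lt_two n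
  calc ((2 : ℝ) ^ Nat.clog 2 n)⁻¹ ^ p ≤ (n : ℝ)⁻¹ ^ p := by gcongr
    _ = (n : ℝ) ^ (-p) := by rw [Real.inv_rpow (by positivity), Real.rpow_neg (by positivity)]
    _ ≤ _ := by
        apply Real.rpow_le_rpow_of_exponent_le hn'
        linarith

/-- The terms decrease geometrically in `j`. As `k` is an integer, `p - k/2` is at least a gap `δ >
0` depending only on `p`, which makes the constant uniform in `k`. -/
theorem scaleSum_le_of_lt {p : ℝ} (hp : 1 ≤ p) :
    ∃ C : ℝ, 0 ≤ C ∧ ∀ k n : ℕ, 1 ≤ n → (k : ℝ) < 2 * p →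
      ∃ J, scaleSum p k n J ≤ C * (n : ℝ) ^ (-(1 / 2) : ℝ) := by
  set δ : ℝ := p - (⌈2 * p⌉₊ - 1) / 2 with hδ
  have hδ0 : 0 < δ := by
    have := Nat.ceil_lt_add_one (by linarith : 0 ≤ 2 * p)
    linarith
  have hr0 : (0 : ℝ) ≤ 2 ^ (-δ) := by positivity
  have hr1 : (2 : ℝ) ^ (-δ) < 1 := Real.rpow_lt_one_of_one_lt_of_neg one_lt_two (by linarith)
  have hinv : 0 ≤ (1 - (2 : ℝ) ^ (-δ))⁻¹ := inv_nonneg.2 (by linarith)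
  refine ⟨1 + 3 ^ p * (1 - (2 : ℝ) ^ (-δ))⁻¹, by positivity, fun k n hn hk =>
    ⟨Nat.clog 2 n, ?_⟩⟩
  have hs : (k : ℝ) / 2 - p ≤ -δ := by
    have h1 : k < ⌈2 * p⌉₊ := Nat.lt_ceil.2 hk
    have h2 : (k : ℝ) + 1 ≤ ⌈2 * p⌉₊ := by exact_mod_cast h1
    linarith
  rw [scaleSum, add_mul, one_mul]
  refine add_le_add (inv_two_pow_clog_rpow_le hp hn) ?_
  simp_rw [scaleSum_term]
  rw [← Finset.mul_sum, mul_assoc, mul_assoc, mul_comm (1 - (2 : ℝ) ^ (-δ))⁻¹]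
  gcongr
  refine le_trans (Finset.sum_le_sum fun j _ => ?_) (sum_pow_le_of_lt_one hr0 hr1 _)
  have h2 : (1 : ℝ) ≤ 2 ^ j := one_le_pow₀ one_le_two
  calc (3 * 2 ^ j : ℝ) ^ ((k : ℝ) / 2 - p) ≤ (3 * 2 ^ j : ℝ) ^ (-δ) :=
        Real.rpow_le_rpow_of_exponent_le (by linarith) hs
    _ ≤ (2 ^ j : ℝ) ^ (-δ) := by
        apply Real.rpow_le_rpow_of_nonpos (by positivity) (by linarith) (by linarith)
    _ = _ := by
        rw [← Real.rpow_natCast, ← Real.rpow_natCast, ← Real.rpow_mul (by norm_num),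
          ← Real.rpow_mul (by norm_num), mul_comm]

/-- All terms of the sum are equal, and their number is of order `log n`. -/
theorem scaleSum_le_of_eq {p : ℝ} (hp : 1 ≤ p) {k n : ℕ} (hn : 2 ≤ n) (hk : (k : ℝ) = 2 * p) :
    scaleSum p k n (Nat.clog 2 n) ≤ 10 * 3 ^ p * (n : ℝ) ^ (-(1 / 2) : ℝ) * Real.log n := by
  have hn' : (2 : ℝ) ≤ n := by exact_mod_cast hn
  have hl2 := Real.log_two_gt_d9
  have hln : Real.log 2 ≤ Real.log n := Real.log_le_log (by norm_num) hn'
  have hJ : (Nat.clog 2 n : ℝ) * Real.log 2 ≤ Real.log n + Real.log 2 := by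
    have h1 : 2 ^ (Nat.clog 2 n - 1) < n := Nat.pow_pred_clog_lt_self one_lt_two (by omega)
    have h2 : 0 < Nat.clog 2 n := Nat.clog_pos one_lt_two hn
    have h3 : ((2 : ℝ) ^ (Nat.clog 2 n - 1)) ≤ n := by exact_mod_cast h1.le
    have h4 := Real.log_le_log (by positivity) h3
    rw [Real.log_pow, Nat.cast_sub h2] at h4
    push_cast at h4
    linarith
  have hp3 : (1 : ℝ) ≤ 3 ^ p := Real.one_le_rpow (by norm_num) (by linarith)
  have hn0 : 0 ≤ (n : ℝ) ^ (-(1 / 2) : ℝ) := by positivity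
  rw [scaleSum]
  simp_rw [scaleSum_term]
  have hs : (k : ℝ) / 2 - p = 0 := by linarith
  simp_rw [hs, Real.rpow_zero, mul_one, Finset.sum_const, Finset.card_range, nsmul_eq_mul]
  have h1 := inv_two_pow_clog_rpow_le hp (by omega : 1 ≤ n)
  have hJ' : (Nat.clog 2 n : ℝ) + 2 ≤ 10 * Real.log n := by nlinarith
  push_cast
  calc _ ≤ 3 ^ p * (n : ℝ) ^ (-(1 / 2) : ℝ) +
        ((Nat.clog 2 n : ℝ) + 1) * (3 ^ p * (n : ℝ) ^ (-(1 / 2) : ℝ)) := by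
        gcongr
        exact h1.trans (le_mul_of_one_le_left hn0 hp3)
    _ = ((Nat.clog 2 n : ℝ) + 2) * (3 ^ p * (n : ℝ) ^ (-(1 / 2) : ℝ)) := by ring
    _ ≤ (10 * Real.log n) * (3 ^ p * (n : ℝ) ^ (-(1 / 2) : ℝ)) := by gcongr
    _ = _ := by ring

/-- The terms increase geometrically, with a gap depending only on `p`, so the last one dominates.
The scale is chosen by `3 * 2 ^ J ≤ n ^ (1/k) < 3 * 2 ^ (J + 1)`, possible only if `n ^ (1/k) ≥ 3`;
it absorbs the factor `3 ^ k` of the covering numbers. -/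
theorem scaleSum_le_of_gt {p : ℝ} (hp : 1 ≤ p) :
    ∃ C : ℝ, 0 ≤ C ∧ ∀ k n : ℕ, 1 ≤ n → 2 * p < k → 3 ≤ (n : ℝ) ^ (1 / (k : ℝ)) →
      ∃ J, scaleSum p k n J ≤ C * ((n : ℝ) ^ (-(1 / (k : ℝ)))) ^ p := by
  set δ : ℝ := (⌊2 * p⌋₊ + 1) / 2 - p with hδ
  have hδ0 : 0 < δ := by
    have := Nat.lt_floor_add_one (2 * p)
    linarith
  have hr0 : (0 : ℝ) ≤ 2 ^ (-δ) := by positivity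
  have hr1 : (2 : ℝ) ^ (-δ) < 1 := Real.rpow_lt_one_of_one_lt_of_neg one_lt_two (by linarith)
  have hinv : 0 ≤ (1 - (2 : ℝ) ^ (-δ))⁻¹ := inv_nonneg.2 (by linarith)
  refine ⟨6 ^ p + 3 ^ p * (1 - (2 : ℝ) ^ (-δ))⁻¹, by positivity, fun k n hn hk hN => ?_⟩
  have hn' : (1 : ℝ) ≤ n := by exact_mod_cast hn
  have hk0 : (0 : ℝ) < k := by linarith
  set y := (n : ℝ) ^ (1 / (k : ℝ)) with hy
  have hy0 : 0 < y := by linarith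
  have hyinv : (n : ℝ) ^ (-(1 / (k : ℝ))) = y⁻¹ := Real.rpow_neg (by positivity) _
  have hyk : (n : ℝ) ^ (-(1 / 2) : ℝ) = y ^ (-((k : ℝ) / 2)) := by
    rw [hy, ← Real.rpow_mul (by positivity)]
    congr 1
    field_simp
  have hs : δ ≤ (k : ℝ) / 2 - p := by
    have h1 : ⌊2 * p⌋₊ < k := (Nat.floor_lt (by linarith)).2 hk
    have h2 : (⌊2 * p⌋₊ : ℝ) + 1 ≤ k := by exact_mod_cast h1
    linarith
  obtain ⟨J, hJ1, hJ2⟩ := exists_nat_pow_near (by linarith : 1 ≤ y / 3) one_lt_two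
  have hJ1' : 3 * 2 ^ J ≤ y := by linarith
  refine ⟨J, ?_⟩
  rw [scaleSum, hyinv, add_mul]
  refine add_le_add ?_ ?_
  · rw [← Real.mul_rpow (by norm_num) (by positivity)]
    gcongr
    rw [pow_succ] at hJ2
    rw [← div_eq_mul_inv, le_div_iff₀ hy0, inv_mul_le_iff₀ (by positivity)]
    linarith
  · simp_rw [scaleSum_term]
    rw [← Finset.mul_sum, mul_assoc, mul_assoc, hyk]
    refine mul_le_mul_of_nonneg_left ?_ (by positivity)
    have hterm : ∀ j ∈ Finset.range (J + 1), (3 * 2 ^ j : ℝ) ^ ((k : ℝ) / 2 - p) ≤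
        y ^ ((k : ℝ) / 2 - p) * ((2 : ℝ) ^ (-δ)) ^ (J + 1 - 1 - j) := by
      intro j hj
      have hjJ : j ≤ J := by have := Finset.mem_range.1 hj; omega
      have e1 : (3 * 2 ^ j : ℝ) = (3 * 2 ^ J) * (2 ^ (J - j))⁻¹ := by
        rw [mul_assoc, ← pow_sub₀ _ two_ne_zero (by omega)]
        congr 2
        omega
      rw [e1, Real.mul_rpow (by positivity) (by positivity)]
      refine mul_le_mul (Real.rpow_le_rpow (by positivity) hJ1' (by linarith)) ?_
        (by positivity) (by positivity)
      have h2 : (1 : ℝ) ≤ 2 ^ (J - j) := one_le_pow₀ one_le_two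
      calc ((2 : ℝ) ^ (J - j))⁻¹ ^ ((k : ℝ) / 2 - p) ≤ ((2 : ℝ) ^ (J - j))⁻¹ ^ δ :=
            Real.rpow_le_rpow_of_exponent_ge (by positivity) (inv_le_one_of_one_le₀ h2) hs
        _ = ((2 : ℝ) ^ (-δ)) ^ (J + 1 - 1 - j) := by
            rw [Real.inv_rpow (by positivity), ← Real.rpow_neg (by positivity),
              ← Real.rpow_natCast, ← Real.rpow_natCast, ← Real.rpow_mul (by norm_num),
              ← Real.rpow_mul (by norm_num), mul_comm, Nat.add_sub_cancel]
    calc y ^ (-((k : ℝ) / 2)) * ∑ j ∈ Finset.range (J + 1), (3 * 2 ^ j : ℝ) ^ ((k : ℝ) / 2 - p)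
        ≤ y ^ (-((k : ℝ) / 2)) * (y ^ ((k : ℝ) / 2 - p) * (1 - (2 : ℝ) ^ (-δ))⁻¹) := by
          gcongr
          refine (Finset.sum_le_sum hterm).trans ?_
          rw [← Finset.mul_sum, Finset.sum_range_reflect (fun j => ((2 : ℝ) ^ (-δ)) ^ j)]
          gcongr
          exact sum_pow_le_of_lt_one hr0 hr1 _
      _ = (1 - (2 : ℝ) ^ (-δ))⁻¹ * y⁻¹ ^ p := by
          rw [← mul_assoc, ← Real.rpow_add hy0, Real.inv_rpow hy0.le, ← Real.rpow_neg hy0.le,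
            mul_comm]
          congr 2
          ring

end Rates

/-! ### Comparison of moments. -/

section Jensen

theorem lintegral_rpow_rpow_le {Ω : Type*} [MeasurableSpace Ω] (P : Measure Ω)
    [IsProbabilityMeasure P] {h : Ω → ℝ≥0∞} (hh : Measurable h) {p q : ℝ} (hp : 0 < p)
    (hpq : p ≤ q) : (∫⁻ ω, h ω ^ p ∂P) ^ (1 / p) ≤ (∫⁻ ω, h ω ^ q ∂P) ^ (1 / q) := by
  have := eLpNorm'_le_eLpNorm'_of_exponent_le (f := h) hp hpq P
    hh.aestronglyMeasurable
  simpa [eLpNorm'] using this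

theorem moment_rpow_le {d : ℕ} (μ : Measure (EuclideanSpace ℝ (Fin d)))
    [IsProbabilityMeasure μ] {p q : ℝ} (hp : 0 < p) (hpq : p ≤ q) :
    moment p μ ^ (1 / p) ≤ moment q μ ^ (1 / q) :=
  lintegral_rpow_rpow_le μ (by fun_prop) hp hpq

/-- Jensen's inequality moves the root outside; the mean of the empirical moment is the moment. -/
theorem lintegral_moment_empirical_le {d n : ℕ} (hn : 1 ≤ n)
    (μ : Measure (EuclideanSpace ℝ (Fin d))) [IsProbabilityMeasure μ] {p : ℝ} (hp : 1 ≤ p) :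
    ∫⁻ x, moment p (empirical x) ^ (1 / p) ∂(Measure.pi fun _ : Fin n => μ) ≤
      moment p μ ^ (1 / p) := by
  have hp0 : 0 < p := by linarith
  have hm : Measurable fun x : Fin n → EuclideanSpace ℝ (Fin d) =>
      moment p (empirical x) ^ (1 / p) := by
    simp only [moment, lintegral_empirical]
    fun_prop
  have h1 := lintegral_rpow_rpow_le (Measure.pi fun _ : Fin n => μ) hm one_pos hp
  simp only [ENNReal.rpow_one, div_one] at h1
  refine h1.trans (le_of_eq ?_)
  congr 1
  simp only [← ENNReal.rpow_mul, one_div, inv_mul_cancel₀ hp0.ne', ENNReal.rpow_one]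
  simp only [moment, lintegral_empirical]
  rw [lintegral_const_mul _ (by fun_prop), lintegral_finsetSum _ (by fun_prop)]
  have : ∀ i : Fin n, ∫⁻ x : Fin n → EuclideanSpace ℝ (Fin d), ‖x i‖ₑ ^ p
      ∂(Measure.pi fun _ : Fin n => μ) = ∫⁻ y, ‖y‖ₑ ^ p ∂μ := fun i =>
    (measurePreserving_eval (fun _ : Fin n => μ) i).lintegral_comp
      (f := fun y => ‖y‖ₑ ^ p) (by fun_prop)
  simp only [this, Finset.sum_const, Finset.card_univ, Fintype.card_fin, nsmul_eq_mul]
  rw [← mul_assoc, ENNReal.inv_mul_cancel (by simp; omega) (by simp), one_mul]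

end Jensen

/-! ### Lipschitz dependence of the Wasserstein distance on the sample. -/

section LipschitzDiscrepancy

/-- The normalized `ℓ^p` mean is at most `n ^ (-1 / (2 ∨ p))` times the `ℓ²` norm. -/
theorem rpow_mean_le_sqrt {n : ℕ} {p : ℝ} (hp : 1 ≤ p) (hn : 1 ≤ n) {a : Fin n → ℝ}
    (ha : ∀ i, 0 ≤ a i) :
    ((n : ℝ)⁻¹ * ∑ i, a i ^ p) ^ (1 / p) ≤
      (n : ℝ) ^ (-(1 / max 2 p)) * √(∑ i, a i ^ 2) := by
  have hp0 : 0 < p := by linarith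
  have hn0 : (0 : ℝ) < n := by exact_mod_cast hn
  have hS : 0 ≤ ∑ i, a i ^ 2 := Finset.sum_nonneg fun i _ => by positivity
  have hSp : 0 ≤ ∑ i, a i ^ p := Finset.sum_nonneg fun i _ => Real.rpow_nonneg (ha i) _
  rcases le_total p 2 with h | h
  · rw [max_eq_left h]
    -- For `p ≤ 2`, means of order `p` are at most means of order `2`.
    have hJ := Real.rpow_arith_mean_le_arith_mean_rpow Finset.univ (fun _ : Fin n => (n : ℝ)⁻¹)
      (fun i => a i ^ p) (fun _ _ => by positivity) (by simp [hn0.ne'])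
      (fun i _ => Real.rpow_nonneg (ha i) _) (p := 2 / p) (by rw [le_div_iff₀ hp0]; linarith)
    rw [← Finset.mul_sum, ← Finset.mul_sum] at hJ
    have e : ∀ i, (a i ^ p) ^ (2 / p) = a i ^ 2 := by
      intro i
      rw [← Real.rpow_mul (ha i), mul_div_cancel₀ _ hp0.ne']
      norm_num
    simp only [e] at hJ
    have h2 := Real.rpow_le_rpow (by positivity) hJ (show (0 : ℝ) ≤ 1 / 2 by norm_num)
    rw [← Real.rpow_mul (by positivity), Real.mul_rpow (by positivity) hS] at h2
    rw [Real.sqrt_eq_rpow, Real.rpow_neg hn0.le, ← Real.inv_rpow hn0.le]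
    refine le_trans (le_of_eq ?_) h2
    congr 1
    field_simp
  · rw [max_eq_right h]
    -- For `p ≥ 2`, the unnormalized `ℓ^p` norm is at most the `ℓ²` norm.
    have key : ∑ i, a i ^ p ≤ (∑ i, a i ^ 2) ^ (p / 2) := by
      have e : (∑ i, a i ^ 2) ^ (p / 2) =
          ∑ i, a i ^ 2 * (∑ i, a i ^ 2) ^ (p / 2 - 1) := by
        rw [← Finset.sum_mul]
        rcases hS.eq_or_lt with h0 | h0
        · rw [← h0, zero_mul, Real.zero_rpow (by positivity)]
        · rw [Real.rpow_sub h0, Real.rpow_one]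
          field_simp
      rw [e]
      refine Finset.sum_le_sum fun i _ => ?_
      have h1 : a i ^ p = a i ^ 2 * (a i ^ 2) ^ (p / 2 - 1) := by
        rcases (ha i).eq_or_lt with h0 | h0
        · rw [← h0, Real.zero_rpow hp0.ne']; simp
        · rw [← Real.rpow_natCast, ← Real.rpow_mul h0.le, ← Real.rpow_add h0]
          congr 1
          push_cast
          ring
      rw [h1]
      gcongr
      · linarith
      · exact Finset.single_le_sum (f := fun i => a i ^ 2) (fun i _ => by positivity)
          (Finset.mem_univ i)
    rw [Real.mul_rpow (by positivity) hSp, Real.rpow_neg hn0.le, Real.inv_rpow hn0.le]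
    gcongr
    calc (∑ i, a i ^ p) ^ (1 / p) ≤ ((∑ i, a i ^ 2) ^ (p / 2)) ^ (1 / p) := by gcongr
      _ = _ := by
        rw [← Real.rpow_mul hS, Real.sqrt_eq_rpow]
        congr 1
        field_simp

variable {k n : ℕ}

theorem wasserstein_empirical_lt_top {p : ℝ} (hp : 1 ≤ p) (hn : 1 ≤ n)
    {ν : Measure (EuclideanSpace ℝ (Fin k))} [IsProbabilityMeasure ν] (hν : moment p ν < ∞)
    (x : Fin n → EuclideanSpace ℝ (Fin k)) : wasserstein p (empirical x) ν < ∞ := by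
  have := isProbabilityMeasure_empirical hn x
  refine (wasserstein_le_moment hp _ _).trans_lt (ENNReal.add_lt_top.2 ⟨?_, ?_⟩)
  · refine ENNReal.rpow_lt_top_of_nonneg (by positivity) (ne_of_lt ?_)
    rw [moment, lintegral_empirical]
    refine ENNReal.mul_lt_top (by simp; omega) (ENNReal.sum_lt_top.2 fun i _ => ?_)
    exact ENNReal.rpow_lt_top_of_nonneg (by positivity) enorm_ne_top
  · exact ENNReal.rpow_lt_top_of_nonneg (by positivity) hν.ne

theorem mean_enorm_rpow {p : ℝ} (hp : 0 < p) (hn : 1 ≤ n)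
    (v : Fin n → EuclideanSpace ℝ (Fin k)) :
    ((n : ℝ≥0∞)⁻¹ * ∑ i, ‖v i‖ₑ ^ p) ^ (1 / p) =
      ENNReal.ofReal (((n : ℝ)⁻¹ * ∑ i, ‖v i‖ ^ p) ^ (1 / p)) := by
  have hn0 : (0 : ℝ) < n := by exact_mod_cast hn
  have hs : 0 ≤ ∑ i, ‖v i‖ ^ p := Finset.sum_nonneg fun i _ => by positivity
  have e : ∀ i, ‖v i‖ₑ ^ p = ENNReal.ofReal (‖v i‖ ^ p) := fun i => by
    rw [← ENNReal.ofReal_rpow_of_nonneg (norm_nonneg _) hp.le, ofReal_norm]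
  simp only [e]
  rw [← ENNReal.ofReal_rpow_of_nonneg (by positivity) (by positivity),
    ENNReal.ofReal_mul (by positivity), ENNReal.ofReal_inv_of_pos hn0, ENNReal.ofReal_natCast,
    ENNReal.ofReal_sum_of_nonneg (fun i _ => by positivity)]

theorem wasserstein_empirical_toReal_sub_le {p : ℝ} (hp : 1 ≤ p) (hn : 1 ≤ n)
    {ν : Measure (EuclideanSpace ℝ (Fin k))} [IsProbabilityMeasure ν] (hν : moment p ν < ∞)
    (x y : Fin n → EuclideanSpace ℝ (Fin k)) :
    |(wasserstein p (empirical x) ν).toReal - (wasserstein p (empirical y) ν).toReal| ≤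
      ((n : ℝ)⁻¹ * ∑ i, ‖x i - y i‖ ^ p) ^ (1 / p) := by
  have hp0 : 0 < p := by linarith
  have key : ∀ x y : Fin n → EuclideanSpace ℝ (Fin k),
      (wasserstein p (empirical x) ν).toReal ≤ (wasserstein p (empirical y) ν).toReal +
        ((n : ℝ)⁻¹ * ∑ i, ‖x i - y i‖ ^ p) ^ (1 / p) := by
    intro x y
    have := isProbabilityMeasure_empirical hn y
    have hs : 0 ≤ ∑ i, ‖x i - y i‖ ^ p := Finset.sum_nonneg fun i _ => by positivity
    have h1 := (wasserstein_triangle hp (empirical x) (empirical y) ν).trans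
      (add_le_add_left (wasserstein_empirical_le hp0 x y) _)
    rw [mean_enorm_rpow hp0 hn (fun i => x i - y i), add_comm] at h1
    have h2 := (wasserstein_empirical_lt_top hp hn hν y).ne
    have h3 := ENNReal.toReal_mono (ENNReal.add_ne_top.2 ⟨h2, ENNReal.ofReal_ne_top⟩) h1
    rwa [ENNReal.toReal_add h2 ENNReal.ofReal_ne_top,
      ENNReal.toReal_ofReal (by positivity)] at h3
  rw [abs_sub_le_iff]
  constructor
  · linarith [key x y]
  · have := key y x
    simp_rw [norm_sub_rev (y _) (x _)] at this
    linarith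

theorem wasserstein_empirical_lipschitz {p : ℝ} (hp : 1 ≤ p) (hn : 1 ≤ n)
    {ν : Measure (EuclideanSpace ℝ (Fin k))} [IsProbabilityMeasure ν] (hν : moment p ν < ∞)
    (x y : Fin n → EuclideanSpace ℝ (Fin k)) :
    |(wasserstein p (empirical x) ν).toReal - (wasserstein p (empirical y) ν).toReal| ≤
      (n : ℝ) ^ (-(1 / max 2 p)) * √(∑ i, ‖x i - y i‖ ^ 2) :=
  (wasserstein_empirical_toReal_sub_le hp hn hν x y).trans
    (rpow_mean_le_sqrt hp hn fun _ => norm_nonneg _)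

/-- Moving one point leaves a single summand in the index-wise cost. The resulting constant `n ^
(-(1 / p))` limits the exponential parameter and so produces the last term of the rate. -/
theorem wasserstein_empirical_update_le {p : ℝ} (hp : 1 ≤ p) (hn : 1 ≤ n)
    {ν : Measure (EuclideanSpace ℝ (Fin k))} [IsProbabilityMeasure ν] (hν : moment p ν < ∞)
    (x : Fin n → EuclideanSpace ℝ (Fin k)) (i : Fin n) (z : EuclideanSpace ℝ (Fin k)) :
    |(wasserstein p (empirical (Function.update x i z)) ν).toReal -
        (wasserstein p (empirical x) ν).toReal| ≤ (n : ℝ) ^ (-(1 / p)) * ‖z - x i‖ := by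
  have hp0 : 0 < p := by linarith
  refine (wasserstein_empirical_toReal_sub_le hp hn hν _ _).trans (le_of_eq ?_)
  rw [Finset.sum_eq_single i]
  · rw [Function.update_self, Real.mul_rpow (by positivity) (by positivity),
      ← Real.rpow_mul (norm_nonneg _), mul_one_div_cancel hp0.ne', Real.rpow_one,
      Real.inv_rpow (by positivity), Real.rpow_neg (by positivity)]
  · intro j _ hj
    rw [Function.update_of_ne hj, sub_self, norm_zero, Real.zero_rpow hp0.ne']
  · simp

theorem continuous_wasserstein_empirical {p : ℝ} (hp : 1 ≤ p) (hn : 1 ≤ n)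
    {ν : Measure (EuclideanSpace ℝ (Fin k))} [IsProbabilityMeasure ν] (hν : moment p ν < ∞) :
    Continuous fun x : Fin n → EuclideanSpace ℝ (Fin k) => wasserstein p (empirical x) ν := by
  have h1 : Continuous fun x : Fin n → EuclideanSpace ℝ (Fin k) =>
      (wasserstein p (empirical x) ν).toReal :=
    (uniformContinuous_of_lip (by positivity)
      (wasserstein_empirical_lipschitz hp hn hν)).continuous
  refine (ENNReal.continuous_ofReal.comp h1).congr fun x => ?_
  exact ENNReal.ofReal_toReal (wasserstein_empirical_lt_top hp hn hν x).ne

/-- The mean is at most the sum of the two moments. -/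
theorem lintegral_wasserstein_le_moment {p : ℝ} (hp : 1 ≤ p) (hn : 1 ≤ n)
    (ν : Measure (EuclideanSpace ℝ (Fin k))) [IsProbabilityMeasure ν] :
    ∫⁻ x, wasserstein p (empirical x) ν ∂(Measure.pi fun _ : Fin n => ν) ≤
      2 * moment p ν ^ (1 / p) := by
  calc ∫⁻ x, wasserstein p (empirical x) ν ∂(Measure.pi fun _ : Fin n => ν)
      ≤ ∫⁻ x, (moment p (empirical x) ^ (1 / p) + moment p ν ^ (1 / p))
          ∂(Measure.pi fun _ : Fin n => ν) := by
        refine lintegral_mono fun x => ?_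
        have := isProbabilityMeasure_empirical hn x
        exact wasserstein_le_moment hp _ _
    _ = ∫⁻ x, moment p (empirical x) ^ (1 / p) ∂(Measure.pi fun _ : Fin n => ν) +
          moment p ν ^ (1 / p) := by
        rw [lintegral_add_right _ measurable_const]
        simp
    _ ≤ moment p ν ^ (1 / p) + moment p ν ^ (1 / p) := by
        gcongr
        exact lintegral_moment_empirical_le hn ν hp
    _ = _ := (two_mul _).symm

end LipschitzDiscrepancy

/-! ### Rate of the mean, and comparison with the stated rate. -/

section MeanRate

open Classical in
/-- The rate of the mean of the Wasserstein distance under a Poincaré inequality. -/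
def meanRate (p : ℝ) (k n : ℕ) : ℝ :=
  (n : ℝ) ^ (-(1 / max (2 * p) k)) * if (k : ℝ) = 2 * p then Real.log n ^ (1 / p) else 1

theorem log_natCast_pos {n : ℕ} (hn : 2 ≤ n) : 0 < Real.log n :=
  Real.log_pos (by exact_mod_cast hn)

theorem meanRate_nonneg (p : ℝ) (k n : ℕ) : 0 ≤ meanRate p k n := by
  unfold meanRate
  have := Real.log_natCast_nonneg n
  split_ifs <;> positivity

theorem lintegral_wasserstein_le_of_scaleSum_le {k n : ℕ} {ν : Measure (EuclideanSpace ℝ (Fin k))}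
    [IsProbabilityMeasure ν] (hn : 1 ≤ n) {p A : ℝ} (hp : 1 ≤ p) (hA : 0 < A)
    (hpν : moment p ν < ∞)
    (hν : ∀ l, ν (annulus A ⁻¹' {l}) ≤
      ENNReal.ofReal (tailConst * Real.exp (-(2 ^ l / 2)))) {C t : ℝ} (hC : 0 ≤ C) (ht : 0 ≤ t)
    {J : ℕ} (h : scaleSum p k n J ≤ C * t ^ p) :
    ∫⁻ x, wasserstein p (empirical x) ν ∂(Measure.pi fun _ : Fin n => ν) ≤
      ENNReal.ofReal ((annuliConst p * C) ^ (1 / p) * 8 * A * t) := by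
  have hp0 : 0 < p := by linarith
  have hK := annuliConst_nonneg p
  have h1 := lintegral_rpow_rpow_le (Measure.pi fun _ : Fin n => ν)
    (continuous_wasserstein_empirical hp hn hpν).measurable one_pos hp
  simp only [ENNReal.rpow_one, div_one] at h1
  have h2 := lintegral_wasserstein_rpow_le hn hp0 hA hν J
  calc _ ≤ _ := h1
    _ ≤ ENNReal.ofReal (annuliConst p * (8 * A) ^ p * (C * t ^ p)) ^ (1 / p) := by
        refine ENNReal.rpow_le_rpow (h2.trans (ENNReal.ofReal_le_ofReal ?_)) (by positivity)
        exact mul_le_mul_of_nonneg_left h (by positivity)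
    _ = _ := by
        rw [ENNReal.ofReal_rpow_of_nonneg (by positivity) (by positivity)]
        congr 1
        rw [show annuliConst p * (8 * A) ^ p * (C * t ^ p) =
          (annuliConst p * C) * ((8 * A) ^ p * t ^ p) by ring,
          ← Real.mul_rpow (by positivity) ht, Real.mul_rpow (by positivity) (by positivity),
          ← Real.rpow_mul (by positivity), mul_one_div_cancel hp0.ne', Real.rpow_one]
        ring

/-- The mean of the Wasserstein distance between an empirical measure and a measure with a
Poincaré inequality, with a constant that does not depend on the dimension. -/
theorem exists_lintegral_wasserstein_le {p : ℝ} (hp : 1 ≤ p) :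
    ∃ C : ℝ, 0 ≤ C ∧ ∀ (k n : ℕ), 2 ≤ n →
      ∀ (ν : Measure (EuclideanSpace ℝ (Fin k))) [IsProbabilityMeasure ν] (M A : ℝ),
        0 ≤ M → 0 < A → M ≤ A ^ 2 → PoincareWith M ν →
        moment p ν ^ (1 / p) ≤ ENNReal.ofReal A →
        ∫⁻ x, wasserstein p (empirical x) ν ∂(Measure.pi fun _ : Fin n => ν) ≤
          ENNReal.ofReal (C * A * meanRate p k n) := by
  have hp0 : 0 < p := by linarith
  obtain ⟨C₁, hC₁, H₁⟩ := scaleSum_le_of_lt hp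
  obtain ⟨C₂, hC₂, H₂⟩ := scaleSum_le_of_gt hp
  have hK := annuliConst_nonneg p
  set D₁ := (annuliConst p * C₁) ^ (1 / p) * 8 with hD₁
  set D₂ := (annuliConst p * C₂) ^ (1 / p) * 8 with hD₂
  set D₃ := (annuliConst p * (10 * 3 ^ p)) ^ (1 / p) * 8 with hD₃
  have hD₁' : 0 ≤ D₁ := by positivity
  have hD₂' : 0 ≤ D₂ := by positivity
  have hD₃' : 0 ≤ D₃ := by positivity
  refine ⟨D₁ + D₂ + D₃ + 6, by positivity, ?_⟩
  intro k n hn ν _ M A hM hA hMA hP hmom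
  have hn1 : 1 ≤ n := by omega
  have hn0 : (0 : ℝ) < n := by exact_mod_cast hn1
  have hlog := log_natCast_pos hn
  have hpν : moment p ν < ∞ := by
    have := hmom.trans_lt ENNReal.ofReal_lt_top
    rwa [ENNReal.rpow_lt_top_iff_of_pos (by positivity)] at this
  have hm1 : ∫⁻ x, ‖x‖ₑ ∂ν ≤ ENNReal.ofReal A := by
    have := moment_rpow_le ν one_pos hp
    simp only [moment, ENNReal.rpow_one, div_one] at this
    exact this.trans hmom
  have hint : Integrable (fun x => ‖x‖) ν := by
    refine ⟨by fun_prop, ?_⟩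
    simpa [HasFiniteIntegral] using hm1.trans_lt ENNReal.ofReal_lt_top
  have hmean : ∫ x, ‖x‖ ∂ν ≤ A := by
    rw [integral_norm_eq_lintegral_enorm (by fun_prop)]
    exact ENNReal.toReal_le_of_le_ofReal hA.le hm1
  have hann := hP.measure_annulus_le hM hA hMA hint hmean
  have hr := meanRate_nonneg p k n
  have fin : ∀ D, 0 ≤ D → D ≤ D₁ + D₂ + D₃ + 6 →
      ENNReal.ofReal (D * A * meanRate p k n) ≤
        ENNReal.ofReal ((D₁ + D₂ + D₃ + 6) * A * meanRate p k n) := by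
    intro D _ h
    gcongr
  rcases lt_trichotomy (k : ℝ) (2 * p) with hk | hk | hk
  · obtain ⟨J, hJ⟩ := H₁ k n hn1 hk
    refine le_trans ?_ (fin D₁ hD₁' (by linarith))
    have e : meanRate p k n = (n : ℝ) ^ (-(1 / (2 * p))) := by
      rw [meanRate, if_neg hk.ne, max_eq_left hk.le, mul_one]
    rw [e]
    refine lintegral_wasserstein_le_of_scaleSum_le hn1 hp hA hpν hann hC₁ (by positivity)
      (hJ.trans_eq ?_)
    rw [← Real.rpow_mul hn0.le]
    congr 2
    field_simp
  · refine le_trans ?_ (fin D₃ hD₃' (by linarith))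
    have e : meanRate p k n = (n : ℝ) ^ (-(1 / (2 * p))) * Real.log n ^ (1 / p) := by
      rw [meanRate, if_pos hk, hk, max_self]
    rw [e]
    refine lintegral_wasserstein_le_of_scaleSum_le hn1 hp hA hpν hann (by positivity)
      (by positivity) ((scaleSum_le_of_eq hp hn hk).trans_eq ?_)
    rw [Real.mul_rpow (by positivity) (by positivity), ← Real.rpow_mul hn0.le,
      ← Real.rpow_mul hlog.le, one_div_mul_cancel hp0.ne', Real.rpow_one, mul_assoc (10 * 3 ^ p)]
    congr 3
    field_simp
  · have e : meanRate p k n = (n : ℝ) ^ (-(1 / (k : ℝ))) := by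
      rw [meanRate, if_neg hk.ne', max_eq_right hk.le, mul_one]
    -- If `n ^ (1/k) < 3`, the rate exceeds `1/3` and the moment bound suffices. Here the dimension
    -- may be arbitrarily large.
    by_cases h3 : 3 ≤ (n : ℝ) ^ (1 / (k : ℝ))
    · obtain ⟨J, hJ⟩ := H₂ k n hn1 hk h3
      refine le_trans ?_ (fin D₂ hD₂' (by linarith))
      rw [e]
      exact lintegral_wasserstein_le_of_scaleSum_le hn1 hp hA hpν hann hC₂ (by positivity) hJ
    · refine le_trans ?_ (fin 6 (by norm_num) (by linarith))
      refine (lintegral_wasserstein_le_moment hp hn1 ν).trans ?_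
      calc 2 * moment p ν ^ (1 / p) ≤ ENNReal.ofReal 2 * ENNReal.ofReal A := by
            gcongr
            simp
        _ = ENNReal.ofReal (2 * A) := (ENNReal.ofReal_mul (by norm_num)).symm
        _ ≤ _ := by
            apply ENNReal.ofReal_le_ofReal
            rw [e]
            have h4 : 1 ≤ 3 * (n : ℝ) ^ (-(1 / (k : ℝ))) := by
              rw [Real.rpow_neg hn0.le, ← div_eq_mul_inv, one_le_div (by positivity)]
              linarith
            nlinarith

theorem zeta_cases (p q : ℝ) (k : ℕ) : zeta p q k = 0 ∨ zeta p q k = 1 ∨ zeta p q k = 2 := by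
  unfold zeta
  split_ifs <;> simp

theorem iprwRate_nonneg (p q : ℝ) (k n : ℕ) : 0 ≤ iprwRate p q k n := by
  have := Real.log_natCast_nonneg n
  unfold iprwRate
  positivity

/-- As `log 2 < 1`, powers of `log n` are not bounded below by one at `n = 2`; `log 2` is a lower
bound uniform in the exponent. -/
theorem log_two_le_log_rpow {n : ℕ} (hn : 2 ≤ n) {s : ℝ} (h0 : 0 ≤ s) (h1 : s ≤ 1) :
    Real.log 2 ≤ Real.log n ^ s := by
  have h2 : (0 : ℝ) < Real.log 2 := Real.log_pos (by norm_num)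
  have h3 : Real.log 2 ≤ 1 := by linarith [Real.log_two_lt_d9]
  calc Real.log 2 = Real.log 2 ^ (1 : ℝ) := (Real.rpow_one _).symm
    _ ≤ Real.log 2 ^ s := Real.rpow_le_rpow_of_exponent_ge h2 h3 h1
    _ ≤ _ := by
      gcongr
      exact_mod_cast hn

/-- The power of `n` in `meanRate` is never larger, so only logarithms matter, and `meanRate` has
one only for `k = 2p`. Then `zeta` is at least one unless `q < 2p`; in that case `1/p - 1/q <
1/(2p)` strictly, and the gap between the powers absorbs the logarithm. -/
theorem exists_meanRate_le {p q : ℝ} (hp : 1 ≤ p) (hpq : p ≤ q) :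
    ∃ C : ℝ, 0 ≤ C ∧ ∀ k n : ℕ, 2 ≤ n → meanRate p k n ≤ C * iprwRate p q k n := by
  have hp0 : 0 < p := by linarith
  have hl2 : (0 : ℝ) < Real.log 2 := Real.log_pos (by norm_num)
  -- The gap in the last case, independent of `k`. It may be nonpositive in the other cases, whence
  -- the absolute value in the constant.
  set ε : ℝ := p * (1 / (2 * p) - (1 / p - 1 / q)) with hε
  refine ⟨(Real.log 2)⁻¹ + |(1 / ε) ^ (1 / p)|, by positivity, fun k n hn => ?_⟩
  have hn1 : (1 : ℝ) ≤ n := by exact_mod_cast (by omega : 1 ≤ n)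
  have hn0 : (0 : ℝ) < n := by linarith
  have hlog := log_natCast_pos hn
  have hipos := iprwRate_nonneg p q k n
  have hpow : (n : ℝ) ^ (-(1 / max (2 * p) k)) ≤
      (n : ℝ) ^ (-(min (1 / max (2 * p) k) (1 / p - 1 / q))) :=
    Real.rpow_le_rpow_of_exponent_le hn1 (neg_le_neg (min_le_left _ _))
  have hp1 : 1 / p ≤ 1 := (div_le_one hp0).2 hp
  have first : meanRate p k n ≤ (Real.log 2)⁻¹ * iprwRate p q k n →
      meanRate p k n ≤ ((Real.log 2)⁻¹ + |(1 / ε) ^ (1 / p)|) * iprwRate p q k n := fun h =>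
    h.trans (by gcongr; linarith [abs_nonneg ((1 / ε) ^ (1 / p))])
  by_cases hk : (k : ℝ) = 2 * p
  · rcases zeta_cases p q k with h | h | h
    · have hq : q < 2 * p := by
        rcases lt_trichotomy q (2 * p) with h' | h' | h'
        · exact h'
        · rw [zeta, if_pos ⟨hk.trans h'.symm, h'⟩] at h
          norm_num at h
        · rw [zeta, if_neg (by rintro ⟨_, h2⟩; linarith), if_pos (.inr ⟨by linarith, hk⟩)] at h
          norm_num at h
      have hb : 1 / p - 1 / q < 1 / (2 * p) := by
        have h1 : 1 / (2 * p) < 1 / q := one_div_lt_one_div_of_lt (by linarith) hq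
        have h2 : 1 / p = 1 / (2 * p) + 1 / (2 * p) := by field_simp; norm_num
        linarith
      have hε0 : 0 < ε := by
        rw [hε]
        have : 0 < 1 / (2 * p) - (1 / p - 1 / q) := by linarith
        positivity
      have hl : Real.log n ^ (1 / p) ≤
          (n : ℝ) ^ (1 / (2 * p) - (1 / p - 1 / q)) * (1 / ε) ^ (1 / p) := by
        have h1 := Real.log_le_rpow_div hn0.le hε0
        rw [div_eq_mul_one_div] at h1
        have h2 := Real.rpow_le_rpow hlog.le h1 (by positivity : 0 ≤ 1 / p)
        rw [Real.mul_rpow (by positivity) (by positivity), ← Real.rpow_mul hn0.le] at h2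
        refine h2.trans_eq ?_
        congr 2
        rw [hε]
        field_simp
      rw [meanRate, if_pos hk, iprwRate, h, hk, max_self, min_eq_right hb.le, zero_div,
        Real.rpow_zero, mul_one]
      calc (n : ℝ) ^ (-(1 / (2 * p))) * Real.log n ^ (1 / p)
          ≤ (n : ℝ) ^ (-(1 / (2 * p))) *
            ((n : ℝ) ^ (1 / (2 * p) - (1 / p - 1 / q)) * (1 / ε) ^ (1 / p)) := by gcongr
        _ = (1 / ε) ^ (1 / p) * (n : ℝ) ^ (-(1 / p - 1 / q)) := by
            rw [← mul_assoc, ← Real.rpow_add hn0, mul_comm]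
            congr 2
            ring
        _ ≤ _ := by
            gcongr
            have := le_abs_self ((1 / ε) ^ (1 / p))
            have : 0 < (Real.log 2)⁻¹ := by positivity
            linarith
    · apply first
      rw [meanRate, if_pos hk, iprwRate, h, ← mul_assoc]
      have h5 : 1 ≤ (Real.log 2)⁻¹ :=
        (one_le_inv₀ hl2).2 (by linarith [Real.log_two_lt_d9])
      gcongr
      refine hpow.trans (le_mul_of_one_le_left (by positivity) h5)
    · apply first
      rw [meanRate, if_pos hk, iprwRate, h]
      have h5 : Real.log n ^ (1 / p) ≤ (Real.log 2)⁻¹ * Real.log n ^ (2 / p) := by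
        rw [show 2 / p = 1 / p + 1 / p by ring, Real.rpow_add hlog, ← mul_assoc]
        refine le_mul_of_one_le_left (by positivity) ?_
        rw [inv_mul_eq_div, one_le_div hl2]
        exact log_two_le_log_rpow hn (by positivity) hp1
      calc _ ≤ _ := mul_le_mul hpow h5 (by positivity) (by positivity)
        _ = _ := by ring
  · apply first
    have hz : 0 ≤ zeta p q k / p ∧ zeta p q k / p ≤ 1 := by
      rcases zeta_cases p q k with h | h | h
      · rw [h]; simp
      · rw [h]; exact ⟨by positivity, hp1⟩
      · exfalso
        rw [zeta, if_neg (by rintro ⟨h1, h2⟩; exact hk (h1.trans h2))] at h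
        split_ifs at h <;> norm_num at h
    have h6 := log_two_le_log_rpow hn hz.1 hz.2
    rw [meanRate, if_neg hk, mul_one, iprwRate]
    rw [inv_mul_eq_div, le_div_iff₀ hl2]
    exact mul_le_mul hpow h6 hl2.le (by positivity)

end MeanRate

/-! ### The Stiefel manifold and dependence on the projection. -/

section Projections

variable {d k n : ℕ}

/-- The map `proj E` as a continuous linear map. -/
def projCLM (E : Matrix (Fin d) (Fin k) ℝ) :
    EuclideanSpace ℝ (Fin d) →L[ℝ] EuclideanSpace ℝ (Fin k) :=
  LinearMap.toContinuousLinearMap (Matrix.toEuclideanLin E.transpose)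

theorem coe_projCLM (E : Matrix (Fin d) (Fin k) ℝ) : ⇑(projCLM E) = proj E := rfl

/-- Since `E Eᵀ` is an orthogonal projection, `‖x‖² - ‖Eᵀ x‖² = ‖x - E Eᵀ x‖² ≥ 0`. -/
theorem norm_proj_le {E : Matrix (Fin d) (Fin k) ℝ} (hE : E ∈ stiefel d k)
    (x : EuclideanSpace ℝ (Fin d)) : ‖proj E x‖ ≤ ‖x‖ := by
  have hE' : E.transpose * E = 1 := hE
  have hn : ∀ {m : ℕ} (v : EuclideanSpace ℝ (Fin m)), ‖v‖ ^ 2 = v.ofLp ⬝ᵥ v.ofLp := by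
    intro m v
    rw [EuclideanSpace.real_norm_sq_eq]
    simp [dotProduct, sq]
  set y := E.transpose.mulVec x.ofLp with hy
  have h1 : x.ofLp ⬝ᵥ E.mulVec y = y ⬝ᵥ y := by
    rw [Matrix.dotProduct_mulVec, ← Matrix.mulVec_transpose]
  have h2 : E.mulVec y ⬝ᵥ E.mulVec y = y ⬝ᵥ y := by
    rw [Matrix.dotProduct_mulVec, ← Matrix.mulVec_transpose, Matrix.mulVec_mulVec, hE',
      Matrix.one_mulVec]
  have h3 : 0 ≤ (x.ofLp - E.mulVec y) ⬝ᵥ (x.ofLp - E.mulVec y) :=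
    Finset.sum_nonneg fun i _ => mul_self_nonneg _
  rw [sub_dotProduct, dotProduct_sub, dotProduct_sub, h1, h2,
    dotProduct_comm (E.mulVec y), h1] at h3
  refine abs_le_of_sq_le_sq' ?_ (norm_nonneg _) |>.2
  rw [hn, hn]
  change y ⬝ᵥ y ≤ _
  linarith

theorem norm_projCLM_le {E : Matrix (Fin d) (Fin k) ℝ} (hE : E ∈ stiefel d k) :
    ‖projCLM E‖ ≤ 1 :=
  ContinuousLinearMap.opNorm_le_bound _ zero_le_one fun x => by
    rw [one_mul]; exact norm_proj_le hE x

theorem finrank_continuousLinearMap_euclideanSpace :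
    Module.finrank ℝ (EuclideanSpace ℝ (Fin d) →L[ℝ] EuclideanSpace ℝ (Fin k)) = d * k := by
  rw [← (LinearMap.toContinuousLinearMap (𝕜 := ℝ) (E := EuclideanSpace ℝ (Fin d))
    (F' := EuclideanSpace ℝ (Fin k))).finrank_eq, Module.finrank_linearMap]
  simp

/-- A net of the Stiefel manifold at scale `1/n`. -/
theorem exists_stiefel_net (hn : 2 ≤ n) :
    ∃ s : Finset (EuclideanSpace ℝ (Fin d) →L[ℝ] EuclideanSpace ℝ (Fin k)),
      (∀ L ∈ s, ∃ F ∈ stiefel d k, projCLM F = L) ∧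
      (s.card : ℝ) ≤ Real.exp (3 * (d * k * Real.log n)) ∧
      ∀ E ∈ stiefel d k, ∃ L ∈ s, ‖projCLM E - L‖ ≤ (n : ℝ)⁻¹ := by
  have hn2 : (2 : ℝ) ≤ n := by exact_mod_cast hn
  have hn0 : (0 : ℝ) < n := by linarith
  obtain ⟨s, hs, hcard, hnet⟩ := exists_finset_net (R := 1) (ε := (n : ℝ)⁻¹) zero_le_one
    (by positivity) (projCLM '' stiefel d k) (by
      rintro _ ⟨E, hE, rfl⟩; exact norm_projCLM_le hE)
  refine ⟨s, fun L hL => hs L hL, hcard.trans ?_, fun E hE => ?_⟩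
  · rw [finrank_continuousLinearMap_euclideanSpace]
    -- The covering number is `(1 + 2n)^(dk)`, and `1 + 2n ≤ n³` for `n ≥ 2`; hence the factor `3`
    -- in the exponent.
    have h1 : 1 + 2 * 1 / (n : ℝ)⁻¹ ≤ (n : ℝ) ^ 3 := by
      rw [div_inv_eq_mul]
      nlinarith [mul_nonneg (by linarith : (0:ℝ) ≤ n - 2) (sq_nonneg (n : ℝ))]
    calc (1 + 2 * 1 / (n : ℝ)⁻¹) ^ (d * k) ≤ ((n : ℝ) ^ 3) ^ (d * k) := by gcongr
      _ = Real.exp (Real.log n) ^ (3 * (d * k)) := by rw [Real.exp_log hn0, ← pow_mul]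
      _ = _ := by
        rw [← Real.exp_nat_mul]
        push_cast
        ring_nf
  · obtain ⟨L, hL, hd⟩ := hnet _ ⟨E, hE, rfl⟩
    exact ⟨L, hL, by rwa [← dist_eq_norm]⟩

theorem moment_map_le {L : EuclideanSpace ℝ (Fin d) →L[ℝ] EuclideanSpace ℝ (Fin k)}
    (hL : ‖L‖ ≤ 1) {p : ℝ} (hp : 0 < p) (μ : Measure (EuclideanSpace ℝ (Fin d))) :
    moment p (μ.map L) ≤ moment p μ := by
  rw [moment, lintegral_map (by fun_prop) L.continuous.measurable]
  refine lintegral_mono fun x => ENNReal.rpow_le_rpow ?_ hp.le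
  have h : ‖L x‖ ≤ ‖x‖ := (L.le_of_opNorm_le hL x).trans_eq (one_mul _)
  rw [← ofReal_norm, ← ofReal_norm]
  exact ENNReal.ofReal_le_ofReal h

theorem wasserstein_map_continuousLinearMap_le
    (L L' : EuclideanSpace ℝ (Fin d) →L[ℝ] EuclideanSpace ℝ (Fin k)) {p : ℝ} (hp : 0 < p)
    (μ : Measure (EuclideanSpace ℝ (Fin d))) :
    wasserstein p (μ.map L) (μ.map L') ≤ ‖L - L'‖ₑ * moment p μ ^ (1 / p) := by
  refine (wasserstein_map_map_le hp μ L.continuous.measurable L'.continuous.measurable).trans ?_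
  calc (∫⁻ x, ‖L x - L' x‖ₑ ^ p ∂μ) ^ (1 / p)
      ≤ (∫⁻ x, ‖L - L'‖ₑ ^ p * ‖x‖ₑ ^ p ∂μ) ^ (1 / p) := by
        gcongr with x
        rw [← ENNReal.mul_rpow_of_nonneg _ _ hp.le]
        gcongr
        exact (L - L').le_opENorm x
    _ = _ := by
        rw [lintegral_const_mul _ (by fun_prop), ENNReal.mul_rpow_of_nonneg _ _ (by positivity),
          ← ENNReal.rpow_mul, mul_one_div_cancel hp.ne', ENNReal.rpow_one, moment]

/-- Both images of one measure are coupled through the same point, at a cost `‖L - L'‖` times its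
moment. This is the price of replacing a projection by a point of the net. -/
theorem wasserstein_map_le_add
    (L L' : EuclideanSpace ℝ (Fin d) →L[ℝ] EuclideanSpace ℝ (Fin k)) {p : ℝ} (hp : 1 ≤ p)
    (μ ν : Measure (EuclideanSpace ℝ (Fin d))) [IsProbabilityMeasure μ] [IsProbabilityMeasure ν] :
    wasserstein p (μ.map L) (ν.map L) ≤ wasserstein p (μ.map L') (ν.map L') +
      ‖L - L'‖ₑ * (moment p μ ^ (1 / p) + moment p ν ^ (1 / p)) := by
  have hp0 : 0 < p := by linarith
  calc wasserstein p (μ.map L) (ν.map L)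
      ≤ wasserstein p (μ.map L) (μ.map L') + wasserstein p (μ.map L') (ν.map L) :=
        wasserstein_triangle hp _ _ _
    _ ≤ wasserstein p (μ.map L) (μ.map L') + (wasserstein p (μ.map L') (ν.map L') +
          wasserstein p (ν.map L) (ν.map L')) := by
        rw [wasserstein_comm hp0 (ν.map L)]
        gcongr
        exact wasserstein_triangle hp _ _ _
    _ ≤ ‖L - L'‖ₑ * moment p μ ^ (1 / p) + (wasserstein p (μ.map L') (ν.map L') +
          ‖L - L'‖ₑ * moment p ν ^ (1 / p)) := by
        gcongr <;> exact wasserstein_map_continuousLinearMap_le _ _ hp0 _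
    _ = _ := by ring

theorem prw_le_moment {p : ℝ} (hp : 1 ≤ p) (μ ν : Measure (EuclideanSpace ℝ (Fin d)))
    [IsProbabilityMeasure μ] [IsProbabilityMeasure ν] :
    prw p k μ ν ≤ moment p μ ^ (1 / p) + moment p ν ^ (1 / p) := by
  have hp0 : 0 < p := by linarith
  refine iSup₂_le fun E hE => ?_
  have h := norm_projCLM_le hE
  have := Measure.isProbabilityMeasure_map (μ := μ) (measurable_proj E).aemeasurable
  have := Measure.isProbabilityMeasure_map (μ := ν) (measurable_proj E).aemeasurable
  refine (wasserstein_le_moment hp _ _).trans ?_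
  rw [← coe_projCLM]
  gcongr <;> exact moment_map_le h hp0 _

theorem lintegral_prw_le_moment {p : ℝ} (hp : 1 ≤ p) (hn : 1 ≤ n)
    (μ : Measure (EuclideanSpace ℝ (Fin d))) [IsProbabilityMeasure μ] :
    ∫⁻ x, prw p k (empirical x) μ ∂(Measure.pi fun _ : Fin n => μ) ≤
      2 * moment p μ ^ (1 / p) := by
  calc ∫⁻ x, prw p k (empirical x) μ ∂(Measure.pi fun _ : Fin n => μ)
      ≤ ∫⁻ x, (moment p (empirical x) ^ (1 / p) + moment p μ ^ (1 / p))
          ∂(Measure.pi fun _ : Fin n => μ) := by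
        refine lintegral_mono fun x => ?_
        have := isProbabilityMeasure_empirical hn x
        exact prw_le_moment hp _ _
    _ = ∫⁻ x, moment p (empirical x) ^ (1 / p) ∂(Measure.pi fun _ : Fin n => μ) +
          moment p μ ^ (1 / p) := by
        rw [lintegral_add_right _ measurable_const]
        simp
    _ ≤ moment p μ ^ (1 / p) + moment p μ ^ (1 / p) := by
        gcongr
        exact lintegral_moment_empirical_le hn μ hp
    _ = _ := (two_mul _).symm

/-- The supremum is uncountable, but a supremum of continuous functions is lower semicontinuous,
hence measurable. -/
theorem measurable_prw_empirical {p : ℝ} (hp : 1 ≤ p) (hn : 1 ≤ n)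
    {μ : Measure (EuclideanSpace ℝ (Fin d))} [IsProbabilityMeasure μ] (hμ : moment p μ < ∞) :
    Measurable fun x : Fin n → EuclideanSpace ℝ (Fin d) => prw p k (empirical x) μ := by
  have hp0 : 0 < p := by linarith
  have hE : ∀ E ∈ stiefel d k, LowerSemicontinuous fun x : Fin n → EuclideanSpace ℝ (Fin d) =>
      wasserstein p ((empirical x).map (proj E)) (μ.map (proj E)) := by
    intro E hE
    have := Measure.isProbabilityMeasure_map (μ := μ) (measurable_proj E).aemeasurable
    have h : moment p (μ.map (proj E)) < ∞ :=
      (moment_map_le (norm_projCLM_le hE) hp0 μ).trans_lt hμ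
    have hc : Continuous fun (x : Fin n → EuclideanSpace ℝ (Fin d)) i => proj E (x i) :=
      continuous_pi fun i => (projCLM E).continuous.comp (continuous_apply i)
    simp only [empirical_map _ (measurable_proj E)]
    exact ((continuous_wasserstein_empirical hp hn h).comp hc).lowerSemicontinuous
  unfold prw
  exact (lowerSemicontinuous_biSup hE).measurable

theorem map_pi_eq_pi_map {L : EuclideanSpace ℝ (Fin d) → EuclideanSpace ℝ (Fin k)}
    (hL : Measurable L) (μ : Measure (EuclideanSpace ℝ (Fin d))) [IsProbabilityMeasure μ] :
    (Measure.pi fun _ : Fin n => μ).map (fun x i => L (x i)) =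
      Measure.pi fun _ : Fin n => μ.map L := by
  have := Measure.isProbabilityMeasure_map (μ := μ) hL.aemeasurable
  exact (Measure.pi_map_pi (μ := fun _ : Fin n => μ) (f := fun _ => L)
    fun _ => hL.aemeasurable)

end Projections

/-! ### A maximal inequality from exponential moments. -/

section MaximalInequality

/-- A function dominated, up to an error, by the maximum of at most `exp u` functions whose
exponential moments are at most `exp B`. -/
theorem lintegral_le_of_exp_moment_le {Ω ι : Type*} [MeasurableSpace Ω] (P : Measure Ω)
    [IsProbabilityMeasure P] (s : Finset ι) {f : ι → Ω → ℝ} (hf : ∀ i ∈ s, Measurable (f i))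
    {l u B : ℝ} (hl : 0 < l) (hB : 1 ≤ u + B) (hs : (s.card : ℝ) ≤ Real.exp u)
    (hexp : ∀ i ∈ s, ∫⁻ ω, ENNReal.ofReal (Real.exp (l * f i ω)) ∂P ≤
      ENNReal.ofReal (Real.exp B))
    {g h : Ω → ℝ≥0∞} (hh : Measurable h)
    (hg : ∀ ω, g ω ≤ (⨆ i ∈ s, ENNReal.ofReal (f i ω)) + h ω) :
    ∫⁻ ω, g ω ∂P ≤ ENNReal.ofReal ((u + B) / l) + ∫⁻ ω, h ω ∂P := by
  set c := u + B with hc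
  -- The tangent bound `l f ≤ exp (l f - c) + c - 1`, summed over `s`. With `c = u + B` the
  -- exponentials have total mean at most one; `1 ≤ c` keeps the constant `c - 1` nonnegative in
  -- `ℝ≥0∞`.
  have hS : ∀ ω, g ω ≤ ENNReal.ofReal (l⁻¹ * Real.exp (-c)) *
      (∑ i ∈ s, ENNReal.ofReal (Real.exp (l * f i ω))) + ENNReal.ofReal ((c - 1) / l) + h ω := by
    intro ω
    refine (hg ω).trans ?_
    gcongr
    refine iSup₂_le fun i hi => ?_
    calc ENNReal.ofReal (f i ω)
        ≤ ENNReal.ofReal (l⁻¹ * Real.exp (-c) * Real.exp (l * f i ω) + (c - 1) / l) := by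
          apply ENNReal.ofReal_le_ofReal
          rw [mul_assoc, ← Real.exp_add, inv_mul_eq_div, ← add_div, le_div_iff₀ hl]
          have := Real.add_one_le_exp (-c + l * f i ω)
          linarith
      _ = ENNReal.ofReal (l⁻¹ * Real.exp (-c)) * ENNReal.ofReal (Real.exp (l * f i ω)) +
            ENNReal.ofReal ((c - 1) / l) := by
          rw [ENNReal.ofReal_add (by positivity) (div_nonneg (by linarith) hl.le),
            ENNReal.ofReal_mul (by positivity)]
      _ ≤ _ := by
          gcongr
          exact Finset.single_le_sum (f := fun i => ENNReal.ofReal (Real.exp (l * f i ω)))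
            (fun _ _ => zero_le) hi
  have hmeas : ∀ i ∈ s, Measurable fun ω => ENNReal.ofReal (Real.exp (l * f i ω)) := fun i hi =>
    (Real.measurable_exp.comp ((hf i hi).const_mul l)).ennreal_ofReal
  calc ∫⁻ ω, g ω ∂P
      ≤ ∫⁻ ω, (ENNReal.ofReal (l⁻¹ * Real.exp (-c)) *
          (∑ i ∈ s, ENNReal.ofReal (Real.exp (l * f i ω))) +
            ENNReal.ofReal ((c - 1) / l) + h ω) ∂P :=
        lintegral_mono hS
    _ = ENNReal.ofReal (l⁻¹ * Real.exp (-c)) *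
          (∑ i ∈ s, ∫⁻ ω, ENNReal.ofReal (Real.exp (l * f i ω)) ∂P) +
            ENNReal.ofReal ((c - 1) / l) + ∫⁻ ω, h ω ∂P := by
        rw [lintegral_add_right _ hh, lintegral_add_right _ measurable_const,
          lintegral_const_mul _ (Finset.measurable_sum _ hmeas), lintegral_finsetSum _ hmeas]
        simp
    _ ≤ ENNReal.ofReal (l⁻¹ * Real.exp (-c)) *
          (∑ _i ∈ s, ENNReal.ofReal (Real.exp B)) +
            ENNReal.ofReal ((c - 1) / l) + ∫⁻ ω, h ω ∂P := by
        gcongr with i hi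
        exact hexp i hi
    _ ≤ _ := by
        gcongr
        rw [Finset.sum_const, nsmul_eq_mul, ← ENNReal.ofReal_natCast,
          ← ENNReal.ofReal_mul (by positivity), ← ENNReal.ofReal_mul (by positivity),
          ← ENNReal.ofReal_add (by positivity) (div_nonneg (by linarith) hl.le)]
        apply ENNReal.ofReal_le_ofReal
        have h1 : (s.card : ℝ) * Real.exp B ≤ Real.exp c := by
          rw [hc, Real.exp_add]
          gcongr
        have h2 : Real.exp (-c) * ((s.card : ℝ) * Real.exp B) ≤ 1 := by
          calc _ ≤ Real.exp (-c) * Real.exp c := by gcongr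
            _ = 1 := by rw [← Real.exp_add]; simp
        rw [mul_assoc, inv_mul_eq_div, ← add_div]
        gcongr
        linarith

end MaximalInequality

/-! ### Exponential moments of the Wasserstein distance. -/

section Concentration

variable {d k n : ℕ}

/-- Exponential moments of the Wasserstein distance between the empirical measure and a measure
with a Poincaré inequality. -/
theorem PoincareWith.exp_moment_wasserstein_le {ν : Measure (EuclideanSpace ℝ (Fin k))}
    [IsProbabilityMeasure ν] {M p l m : ℝ} (hP : PoincareWith M ν) (hM : 0 ≤ M) (hp : 1 ≤ p)
    (hn : 1 ≤ n) (hν : moment p ν < ∞) (hm0 : 0 ≤ m)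
    (hm : ∫⁻ x, wasserstein p (empirical x) ν ∂(Measure.pi fun _ : Fin n => ν) ≤
      ENNReal.ofReal m) (hl : 0 < l) (hlb : M * (l * (n : ℝ) ^ (-(1 / p))) ^ 2 ≤ 1) :
    ∫⁻ x, ENNReal.ofReal (Real.exp (l * (wasserstein p (empirical x) ν).toReal))
        ∂(Measure.pi fun _ : Fin n => ν) ≤
      ENNReal.ofReal (Real.exp (l * m +
        mlsiConst * M * ((n : ℝ) ^ (-(1 / max 2 p))) ^ 2 * l ^ 2)) := by
  have hmeas := (continuous_wasserstein_empirical (n := n) hp hn hν).measurable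
  have hfin := hm.trans_lt ENNReal.ofReal_lt_top
  refine (hP.exp_moment_le hM (integrable_toReal_of_lintegral_ne_top hmeas.aemeasurable hfin.ne)
    (by positivity) (by positivity) (wasserstein_empirical_lipschitz hp hn hν)
    (wasserstein_empirical_update_le hp hn hν) hl hlb).trans ?_
  apply ENNReal.ofReal_le_ofReal
  gcongr
  rw [integral_toReal hmeas.aemeasurable
    (.of_forall fun x => wasserstein_empirical_lt_top hp hn hν x)]
  exact ENNReal.toReal_le_of_le_ofReal hm0 hm

/-- The projected sample is an independent sample of the projected law, to which the Poincaré
inequality applies. -/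
theorem exp_moment_wasserstein_proj_le {μ : Measure (EuclideanSpace ℝ (Fin d))}
    [IsProbabilityMeasure μ] {M p l m : ℝ} (hP : ProjPoincareWith M k μ) (hM : 0 ≤ M) (hp : 1 ≤ p)
    (hn : 1 ≤ n) (hμ : moment p μ < ∞) (hm0 : 0 ≤ m) {F : Matrix (Fin d) (Fin k) ℝ}
    (hF : F ∈ stiefel d k)
    (hm : ∫⁻ x, wasserstein p (empirical x) (μ.map (proj F))
      ∂(Measure.pi fun _ : Fin n => μ.map (proj F)) ≤ ENNReal.ofReal m)
    (hl : 0 < l) (hlb : M * (l * (n : ℝ) ^ (-(1 / p))) ^ 2 ≤ 1) :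
    ∫⁻ x, ENNReal.ofReal (Real.exp (l * (wasserstein p ((empirical x).map (proj F))
        (μ.map (proj F))).toReal)) ∂(Measure.pi fun _ : Fin n => μ) ≤
      ENNReal.ofReal (Real.exp (l * m +
        mlsiConst * M * ((n : ℝ) ^ (-(1 / max 2 p))) ^ 2 * l ^ 2)) := by
  have := Measure.isProbabilityMeasure_map (μ := μ) (measurable_proj F).aemeasurable
  have hν : moment p (μ.map (proj F)) < ∞ :=
    (moment_map_le (norm_projCLM_le hF) (by linarith) μ).trans_lt hμ
  refine le_trans (le_of_eq ?_)
    ((hP F hF).exp_moment_wasserstein_le hM hp hn hν hm0 hm hl hlb)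
  have hmeas := (continuous_wasserstein_empirical (n := n) hp hn hν).measurable
  have hpr : Measurable fun (x : Fin n → EuclideanSpace ℝ (Fin d)) i => proj F (x i) :=
    measurable_pi_lambda _ fun i => (measurable_proj F).comp (measurable_pi_apply i)
  rw [← map_pi_eq_pi_map (measurable_proj F), lintegral_map (by fun_prop) hpr]
  simp only [empirical_map _ (measurable_proj F)]

end Concentration

/-! ### The bound of the mean of the supremum. -/

section Main

variable {d k n : ℕ}

/-- The choice of the exponential parameter. -/
theorem exists_exp_parameter {M a b u K : ℝ} (hM : 0 < M) (ha : 0 < a) (hb : 0 < b) (hu : 0 < u)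
    (hK : 0 ≤ K) :
    ∃ l : ℝ, 0 < l ∧ M * (l * b) ^ 2 ≤ 1 ∧
      u / l + K * M * a ^ 2 * l ≤ (1 + K) * (√M * a * √u) + √M * (b * u) := by
  have hM' : 0 < √M := Real.sqrt_pos.2 hM
  have hu' : 0 < √u := Real.sqrt_pos.2 hu
  have eM : √M ^ 2 = M := Real.sq_sqrt hM.le
  have eu : √u ^ 2 = u := Real.sq_sqrt hu.le
  -- The first value balances the two terms up to constants; the second is the largest admissible
  -- one. Whichever is attained bounds `u / l` by one of the two summands.
  set l := min (√u / (√M * a)) (1 / (√M * b)) with hl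
  have hl0 : 0 < l := lt_min (by positivity) (by positivity)
  refine ⟨l, hl0, ?_, ?_⟩
  · have h1 : l ≤ 1 / (√M * b) := min_le_right _ _
    rw [le_div_iff₀ (by positivity)] at h1
    calc M * (l * b) ^ 2 = (l * (√M * b)) ^ 2 := by rw [← eM, Real.sqrt_sq hM'.le]; ring
      _ ≤ 1 ^ 2 := by gcongr
      _ = 1 := one_pow _
  · have h1 : l ≤ √u / (√M * a) := min_le_left _ _
    have h2 : K * M * a ^ 2 * l ≤ K * (√M * a * √u) := by
      calc K * M * a ^ 2 * l ≤ K * M * a ^ 2 * (√u / (√M * a)) := by gcongr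
        _ = K * √M ^ 2 * a ^ 2 * (√u / (√M * a)) := by rw [eM]
        _ = _ := by field_simp
    have h3 : u / l ≤ √M * a * √u + √M * (b * u) := by
      rcases min_choice (√u / (√M * a)) (1 / (√M * b)) with h | h
      · rw [hl, h]
        have : u / (√u / (√M * a)) = √M * a * √u := by
          nth_rewrite 1 [← eu]
          field_simp
        rw [this]
        have : 0 ≤ √M * (b * u) := by positivity
        linarith
      · rw [hl, h]
        have : u / (1 / (√M * b)) = √M * (b * u) := by field_simp
        rw [this]
        have : 0 ≤ √M * a * √u := by positivity
        linarith
    linarith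

/-- The maximal inequality over the net of projections. The passage to the net costs `1 / n` times
two moments, random but of mean at most `2 * A` in total. -/
theorem lintegral_prw_le_of_exp_parameter {μ : Measure (EuclideanSpace ℝ (Fin d))}
    [IsProbabilityMeasure μ] {M A p l m B : ℝ} (hP : ProjPoincareWith M k μ) (hM : 0 ≤ M)
    (hA : 0 ≤ A) (hp : 1 ≤ p) (hn : 2 ≤ n) (hmom : moment p μ ^ (1 / p) ≤ ENNReal.ofReal A)
    (hm0 : 0 ≤ m)
    (hmean : ∀ F ∈ stiefel d k, ∫⁻ x, wasserstein p (empirical x) (μ.map (proj F))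
      ∂(Measure.pi fun _ : Fin n => μ.map (proj F)) ≤ ENNReal.ofReal m)
    (hl : 0 < l) (hlb : M * (l * (n : ℝ) ^ (-(1 / p))) ^ 2 ≤ 1)
    (hB : B = l * m + mlsiConst * M * ((n : ℝ) ^ (-(1 / max 2 p))) ^ 2 * l ^ 2)
    (hB1 : 1 ≤ 3 * (d * k * Real.log n) + B) :
    ∫⁻ x, prw p k (empirical x) μ ∂(Measure.pi fun _ : Fin n => μ) ≤
      ENNReal.ofReal ((3 * (d * k * Real.log n) + B) / l) +
        ENNReal.ofReal ((n : ℝ)⁻¹ * (2 * A)) := by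
  have hp0 : 0 < p := by linarith
  have hn' : 1 ≤ n := by omega
  have hμ : moment p μ < ∞ := by
    have := hmom.trans_lt ENNReal.ofReal_lt_top
    rwa [ENNReal.rpow_lt_top_iff_of_pos (by positivity)] at this
  obtain ⟨s, hs, hcard, hnet⟩ := exists_stiefel_net (d := d) (k := k) hn
  set f : (EuclideanSpace ℝ (Fin d) →L[ℝ] EuclideanSpace ℝ (Fin k)) →
    (Fin n → EuclideanSpace ℝ (Fin d)) → ℝ := fun L x =>
      (wasserstein p ((empirical x).map L) (μ.map L)).toReal with hf
  have hfm : ∀ L ∈ s, (Measurable (f L)) ∧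
      ∀ x : Fin n → EuclideanSpace ℝ (Fin d),
        wasserstein p ((empirical x).map L) (μ.map L) < ∞ := by
    intro L hL
    obtain ⟨F, hF, rfl⟩ := hs L hL
    have := Measure.isProbabilityMeasure_map (μ := μ) (measurable_proj F).aemeasurable
    have hν : moment p (μ.map (proj F)) < ∞ :=
      (moment_map_le (norm_projCLM_le hF) hp0 μ).trans_lt hμ
    have hmeas := (continuous_wasserstein_empirical (n := n) hp hn' hν).measurable
    simp only [hf, coe_projCLM, empirical_map _ (measurable_proj F)]
    refine ⟨?_, fun x => wasserstein_empirical_lt_top hp hn' hν _⟩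
    exact (hmeas.comp (measurable_pi_lambda _ fun i =>
      (measurable_proj F).comp (measurable_pi_apply i))).ennreal_toReal
  set h : (Fin n → EuclideanSpace ℝ (Fin d)) → ℝ≥0∞ := fun x =>
    ENNReal.ofReal (n : ℝ)⁻¹ * (moment p (empirical x) ^ (1 / p) + moment p μ ^ (1 / p)) with hh
  have hmm : Measurable fun x : Fin n → EuclideanSpace ℝ (Fin d) =>
      moment p (empirical x) ^ (1 / p) := by
    simp only [moment, lintegral_empirical]
    fun_prop
  have hhm : Measurable h := (hmm.add_const _).const_mul _
  have hdom : ∀ x, ∀ E ∈ stiefel d k, ∃ L ∈ s,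
      wasserstein p ((empirical x).map (proj E)) (μ.map (proj E)) ≤
        ENNReal.ofReal (f L x) + h x := by
    intro x E hE
    have := isProbabilityMeasure_empirical hn' x
    obtain ⟨L, hL, hd⟩ := hnet E hE
    refine ⟨L, hL, ?_⟩
    rw [hf, ENNReal.ofReal_toReal ((hfm L hL).2 x).ne, ← coe_projCLM]
    refine (wasserstein_map_le_add (projCLM E) L hp (empirical x) μ).trans ?_
    simp only [hh]
    gcongr
    rw [← ofReal_norm]
    exact ENNReal.ofReal_le_ofReal hd
  have hsup : ∀ x, prw p k (empirical x) μ ≤ (⨆ L ∈ s, ENNReal.ofReal (f L x)) + h x := by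
    intro x
    refine iSup₂_le fun E hE => ?_
    obtain ⟨L, hL, hle⟩ := hdom x E hE
    refine hle.trans ?_
    gcongr
    exact le_iSup₂ (f := fun L (_ : L ∈ s) => ENNReal.ofReal (f L x)) L hL
  have hhint : ∫⁻ x, h x ∂(Measure.pi fun _ : Fin n => μ) ≤
      ENNReal.ofReal ((n : ℝ)⁻¹ * (2 * A)) := by
    rw [lintegral_const_mul _ (hmm.add_const _), lintegral_add_right _ measurable_const,
      ENNReal.ofReal_mul (by positivity), two_mul, ENNReal.ofReal_add hA hA]
    gcongr
    · exact (lintegral_moment_empirical_le hn' μ hp).trans hmom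
    · simpa using hmom
  refine (lintegral_le_of_exp_moment_le (Measure.pi fun _ : Fin n => μ) s
    (f := f) (fun L hL => (hfm L hL).1) (l := l) (B := B) hl hB1 hcard
    (fun L hL => ?_) hhm hsup).trans (add_le_add_right hhint _)
  obtain ⟨F, hF, rfl⟩ := hs L hL
  rw [hB]
  exact exp_moment_wasserstein_proj_le hP hM hp hn' hμ hm0 hF (hmean F hF) hl hlb

/-- This makes the entropy `3 dk log n` of the net at least one, as the maximal inequality requires,
and lets error terms be absorbed. -/
theorem half_le_mul_log (hk : 1 ≤ k) (hkd : k ≤ d) (hn : 2 ≤ n) :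
    (1 / 2 : ℝ) ≤ d * k * Real.log n := by
  have h1 : (1 : ℝ) ≤ k := by exact_mod_cast hk
  have h2 : (1 : ℝ) ≤ d := by exact_mod_cast hk.trans hkd
  have h3 : (1 / 2 : ℝ) ≤ Real.log n := by
    have : Real.log 2 ≤ Real.log n := Real.log_le_log (by norm_num) (by exact_mod_cast hn)
    linarith [Real.log_two_gt_d9]
  have h4 : (1 : ℝ) ≤ d * k := one_le_mul_of_one_le_of_one_le h2 h1
  nlinarith

theorem exists_lintegral_prw_le {p : ℝ} (hp : 1 ≤ p) :
    ∃ C : ℝ, 0 ≤ C ∧ ∀ (d k n : ℕ), 1 ≤ k → k ≤ d → 2 ≤ n →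
      ∀ (μ : Measure (EuclideanSpace ℝ (Fin d))) [IsProbabilityMeasure μ] (M A : ℝ),
        0 < M → √M ≤ A → ProjPoincareWith M k μ →
        moment p μ ^ (1 / p) ≤ ENNReal.ofReal A →
        ∫⁻ x, prw p k (empirical x) μ ∂(Measure.pi fun _ : Fin n => μ) ≤
          ENNReal.ofReal (C * A * (meanRate p k n +
            (n : ℝ) ^ (-(1 / max 2 p)) * √(d * k * Real.log n) +
            (n : ℝ) ^ (-(1 / p)) * (d * k * Real.log n))) := by
  have hp0 : 0 < p := by linarith
  obtain ⟨C₀, hC₀, H₀⟩ := exists_lintegral_wasserstein_le hp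
  have hK : 0 ≤ mlsiConst := mlsiConst_pos.le
  refine ⟨C₀ + 2 * mlsiConst + 6, by positivity, ?_⟩
  intro d k n hk hkd hn μ _ M A hM hMA hP hmom
  have hn1 : 1 ≤ n := by omega
  have hn2 : (2 : ℝ) ≤ n := by exact_mod_cast hn
  have hn0 : (0 : ℝ) < n := by linarith
  have hA : 0 < A := (Real.sqrt_pos.2 hM).trans_le hMA
  have hMA2 : M ≤ A ^ 2 := by
    rw [← Real.sq_sqrt hM.le]; gcongr
  set v : ℝ := d * k * Real.log n with hv
  set a : ℝ := (n : ℝ) ^ (-(1 / max 2 p)) with ha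
  set b : ℝ := (n : ℝ) ^ (-(1 / p)) with hb
  set m : ℝ := C₀ * A * meanRate p k n with hm
  have hr := meanRate_nonneg p k n
  have hm0 : 0 ≤ m := by positivity
  have ha0 : 0 < a := by positivity
  have hb0 : 0 < b := by positivity
  have hv2 : (1 / 2 : ℝ) ≤ v := half_le_mul_log hk hkd hn
  have hmean : ∀ F ∈ stiefel d k, ∫⁻ x, wasserstein p (empirical x) (μ.map (proj F))
      ∂(Measure.pi fun _ : Fin n => μ.map (proj F)) ≤ ENNReal.ofReal m := by
    intro F hF
    have := Measure.isProbabilityMeasure_map (μ := μ) (measurable_proj F).aemeasurable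
    refine H₀ k n hn (μ.map (proj F)) M A hM.le hA hMA2 (hP F hF) (le_trans ?_ hmom)
    gcongr
    exact moment_map_le (norm_projCLM_le hF) hp0 μ
  obtain ⟨l, hl, hlb, hlu⟩ := exists_exp_parameter (u := 3 * v) hM ha0 hb0 (by linarith) hK
  have hmain := lintegral_prw_le_of_exp_parameter hP hM.le hA.le hp hn hmom hm0 hmean hl hlb rfl
    (le_add_of_le_of_nonneg (by linarith) (by positivity))
  refine hmain.trans ?_
  rw [← ENNReal.ofReal_add (by positivity) (by positivity)]
  apply ENNReal.ofReal_le_ofReal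
  have e1 : (3 * v + (l * m + mlsiConst * M * a ^ 2 * l ^ 2)) / l =
      m + (3 * v / l + mlsiConst * M * a ^ 2 * l) := by
    field_simp
    ring
  have hsv : 0 < √v := Real.sqrt_pos.2 (by linarith)
  have h3 : √(3 * v) ≤ 2 * √v := by
    rw [Real.sqrt_mul (by norm_num)]
    gcongr
    rw [Real.sqrt_le_left (by norm_num)]
    norm_num
  -- The error of the net is absorbed by the second term of the rate.
  have hna : (n : ℝ)⁻¹ ≤ 2 * (a * √v) := by
    have h4 : (n : ℝ)⁻¹ ≤ a := by
      rw [← Real.rpow_neg_one, ha]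
      apply Real.rpow_le_rpow_of_exponent_le (by linarith)
      have : 1 / max 2 p ≤ 1 := (div_le_one (by positivity)).2 (by simp)
      linarith
    have h5 : 1 / 2 ≤ √v := Real.le_sqrt_of_sq_le (by linarith)
    nlinarith
  have h6 : √M * a * √(3 * v) ≤ A * (2 * (a * √v)) := by
    calc √M * a * √(3 * v) ≤ A * a * (2 * √v) := by gcongr
      _ = _ := by ring
  have h7 : √M * (b * (3 * v)) ≤ A * (3 * (b * v)) := by
    calc √M * (b * (3 * v)) ≤ A * (b * (3 * v)) := by gcongr
      _ = _ := by ring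
  have h8 : (n : ℝ)⁻¹ * (2 * A) ≤ A * (4 * (a * √v)) := by
    calc _ ≤ 2 * (a * √v) * (2 * A) := by gcongr
      _ = _ := by ring
  have h9 : (1 + mlsiConst) * (√M * a * √(3 * v)) ≤
      (1 + mlsiConst) * (A * (2 * (a * √v))) := by gcongr
  rw [e1]
  calc _ ≤ C₀ * (A * meanRate p k n) + ((1 + mlsiConst) * (A * (2 * (a * √v))) +
        A * (3 * (b * v))) + A * (4 * (a * √v)) := by
        have : m = C₀ * (A * meanRate p k n) := by rw [hm, mul_assoc]
        linarith
    _ = (C₀ + 2 * mlsiConst + 6) * (A * (meanRate p k n + a * √v + b * v)) -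
          ((2 * mlsiConst + 6) * (A * meanRate p k n) + C₀ * (A * (a * √v)) +
            (C₀ + 2 * mlsiConst + 3) * (A * (b * v))) := by ring
    _ ≤ (C₀ + 2 * mlsiConst + 6) * (A * (meanRate p k n + a * √v + b * v)) :=
        sub_le_self _ (by positivity)
    _ = _ := by ring

end Main

/-! ### Transfer to the sample, and the case `p = 1`. -/

section Sample

variable {d k n : ℕ}

theorem map_sample_eq_pi {Ω : Type*} [MeasurableSpace Ω] {P : Measure Ω} [IsProbabilityMeasure P]
    {μ : Measure (EuclideanSpace ℝ (Fin d))} {X : Fin n → Ω → EuclideanSpace ℝ (Fin d)}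
    (hX : ∀ i, HasLaw (X i) μ P) (hind : iIndepFun X P) :
    P.map (fun ω i => X i ω) = Measure.pi fun _ => μ := by
  rw [(iIndepFun_iff_map_fun_eq_pi_map fun i => (hX i).aemeasurable).1 hind]
  simp only [(hX _).map_eq]

theorem prwRate_one {p q : ℝ} (h : zeta p q k = 0) : prwRate p q d k 1 = 1 := by
  simp [prwRate, iprwRate, h]

/-- For `p = 1` and `k ≠ 2` the last term of the rate can be dropped, at the price of the
trivial bound when `dk log n > n`. -/
theorem min_one_rate_le (hk : 1 ≤ k) (hkd : k ≤ d) (hk2 : k ≠ 2) (hn : 2 ≤ n) :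
    min 1 (meanRate 1 k n + (n : ℝ) ^ (-(1 / max 2 1) : ℝ) * √(d * k * Real.log n) +
        (n : ℝ) ^ (-(1 / 1) : ℝ) * (d * k * Real.log n)) ≤
      4 * ((n : ℝ) ^ (-(1 / (k : ℝ))) + (n : ℝ) ^ (-(1 / 2 : ℝ)) * √(d * k * Real.log n)) := by
  have hn0 : (0 : ℝ) < n := by positivity
  have hv := half_le_mul_log hk hkd hn
  set v : ℝ := d * k * Real.log n with hv'
  have hv0 : 0 ≤ v := by linarith
  have hs : 1 / 2 ≤ √v := Real.le_sqrt_of_sq_le (by linarith)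
  have ha : (n : ℝ) ^ (-(1 / 2 : ℝ)) = (√n)⁻¹ := by
    rw [Real.rpow_neg hn0.le, Real.sqrt_eq_rpow]
  have hsn : 0 < √(n : ℝ) := Real.sqrt_pos.2 hn0
  have hpos : 0 < (n : ℝ) ^ (-(1 / (k : ℝ))) := by positivity
  rcases le_total v n with h | h
  · refine (min_le_right _ _).trans ?_
    -- For `k = 1` the mean is of order `n ^ (-1/2)`, absorbed by the second term since `√v ≥ 1/2`;
    -- for `k ≥ 3` it is `n ^ (-1/k)`.
    have h1 : meanRate 1 k n ≤ (n : ℝ) ^ (-(1 / (k : ℝ))) + 2 * ((√n)⁻¹ * √v) := by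
      have hk2' : (k : ℝ) ≠ 2 * 1 := by rw [mul_one]; exact_mod_cast hk2
      rw [meanRate, if_neg hk2', mul_one, mul_one]
      rcases Nat.lt_or_ge k 2 with h' | h'
      · rw [max_eq_left (by exact_mod_cast h'.le), ha]
        have : (√(n : ℝ))⁻¹ * (1 / 2) ≤ (√n)⁻¹ * √v := by gcongr
        linarith
      · rw [max_eq_right (by exact_mod_cast h')]
        have : 0 ≤ (√(n : ℝ))⁻¹ * √v := by positivity
        linarith
    -- For `v ≤ n`, `v / n ≤ √(v / n)`.
    have h2 : (n : ℝ) ^ (-(1 / 1) : ℝ) * v ≤ (√n)⁻¹ * √v := by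
      have e1 : (n : ℝ) ^ (-(1 / 1) : ℝ) = (√n)⁻¹ * (√n)⁻¹ := by
        rw [← mul_inv, Real.mul_self_sqrt hn0.le, div_one, Real.rpow_neg_one]
      have e2 : v = √v * √v := (Real.mul_self_sqrt hv0).symm
      rw [e1, e2, Real.sqrt_mul_self (Real.sqrt_nonneg v)]
      have h3 : (√(n : ℝ))⁻¹ * √v ≤ 1 := by
        rw [inv_mul_eq_div]
        exact (div_le_one hsn).2 (Real.sqrt_le_sqrt h)
      calc (√(n : ℝ))⁻¹ * (√n)⁻¹ * (√v * √v) = (√n)⁻¹ * √v * ((√n)⁻¹ * √v) := by ring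
        _ ≤ (√n)⁻¹ * √v * 1 := by gcongr
        _ = _ := mul_one _
    rw [max_eq_left (by norm_num : (1 : ℝ) ≤ 2), ha]
    linarith
  · refine (min_le_left _ _).trans ?_
    have h3 : 1 ≤ (√(n : ℝ))⁻¹ * √v := by
      rw [inv_mul_eq_div]
      exact (one_le_div hsn).2 (Real.sqrt_le_sqrt h)
    rw [ha]
    linarith

end Sample

end ProjOT

end

/-! ### The theorem. -/

theorem mainTheorem4 (p q : ℝ) (hp : 1 ≤ p) (hpq : p ≤ q) :
    ∃ C : ℝ, 0 < C ∧
      ∀ (d k n : ℕ), 1 ≤ k → k ≤ d → 1 ≤ n →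
      ∀ (μ : Measure (EuclideanSpace ℝ (Fin d))), IsProbabilityMeasure μ →
        ProjOT.moment q μ < ∞ →
      ∀ M : ℝ, 0 < M → ProjOT.ProjPoincareWith M k μ →
      ∀ (Ω : Type*) (mΩ : MeasurableSpace Ω) (P : Measure Ω), IsProbabilityMeasure P →
      ∀ X : Fin n → Ω → EuclideanSpace ℝ (Fin d),
        (∀ i, HasLaw (X i) μ P) → iIndepFun X P →
        AEMeasurable (fun ω => ProjOT.prw p k (ProjOT.empirical (fun i => X i ω)) μ) P ∧
        ((ProjOT.zeta p q k ≠ 0 → 2 ≤ n) →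
          ∫⁻ ω, ProjOT.prw p k (ProjOT.empirical (fun i => X i ω)) μ ∂P ≤
            ENNReal.ofReal
              (C * ((ProjOT.moment q μ).toReal ^ (1 / q) + √M) * ProjOT.prwRate p q d k n)) ∧
        (p = 1 → k ≠ 2 →
          ∫⁻ ω, ProjOT.prw p k (ProjOT.empirical (fun i => X i ω)) μ ∂P ≤
            ENNReal.ofReal
              (C * ((ProjOT.moment q μ).toReal ^ (1 / q) + √M) *
                ((n : ℝ) ^ (-(1 / (k : ℝ)))
                  + (n : ℝ) ^ (-(1 / 2 : ℝ)) * √(d * k * Real.log n)))) := by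
  obtain ⟨C₁, hC₁, H₁⟩ := ProjOT.exists_lintegral_prw_le hp
  obtain ⟨C₂, hC₂, H₂⟩ := ProjOT.exists_meanRate_le hp hpq
  -- `C₁ * C₂` serves the general rate, `4 * C₁` the case `p = 1`, and `8` the trivial bound `2 * A`
  -- multiplied by the factor `4` of `ProjOT.min_one_rate_le`.
  refine ⟨4 * C₁ + C₁ * C₂ + 8, by positivity, ?_⟩
  intro d k n hk hkd hn μ _ hq M hM hP Ω _ P _ X hX hind
  have hp0 : 0 < p := by linarith
  have hq0 : 0 < q := by linarith
  set A := (ProjOT.moment q μ).toReal ^ (1 / q) + √M with hA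
  have hA0 : 0 < A := add_pos_of_nonneg_of_pos (by positivity) (Real.sqrt_pos.2 hM)
  have hMA : √M ≤ A := le_add_of_nonneg_left (by positivity)
  have hmom : ProjOT.moment p μ ^ (1 / p) ≤ ENNReal.ofReal A := by
    refine (ProjOT.moment_rpow_le μ hp0 hpq).trans ?_
    calc ProjOT.moment q μ ^ (1 / q)
        = ENNReal.ofReal ((ProjOT.moment q μ).toReal ^ (1 / q)) := by
          rw [← ENNReal.ofReal_rpow_of_nonneg ENNReal.toReal_nonneg (by positivity),
            ENNReal.ofReal_toReal hq.ne]
      _ ≤ _ := ENNReal.ofReal_le_ofReal (le_add_of_nonneg_right (Real.sqrt_nonneg M))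
  have hμ : ProjOT.moment p μ < ∞ := by
    have := hmom.trans_lt ENNReal.ofReal_lt_top
    rwa [ENNReal.rpow_lt_top_iff_of_pos (by positivity)] at this
  have hmeas := ProjOT.measurable_prw_empirical (k := k) hp hn hμ
  have hXm : AEMeasurable (fun ω i => X i ω) P :=
    aemeasurable_pi_lambda _ fun i => (hX i).aemeasurable
  have htransfer : ∫⁻ ω, ProjOT.prw p k (ProjOT.empirical fun i => X i ω) μ ∂P =
      ∫⁻ x, ProjOT.prw p k (ProjOT.empirical x) μ ∂(Measure.pi fun _ : Fin n => μ) := by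
    rw [← ProjOT.map_sample_eq_pi hX hind, lintegral_map' hmeas.aemeasurable hXm]
  have htriv : ∫⁻ x, ProjOT.prw p k (ProjOT.empirical x) μ ∂(Measure.pi fun _ : Fin n => μ) ≤
      ENNReal.ofReal (2 * A) := by
    refine (ProjOT.lintegral_prw_le_moment hp hn μ).trans ?_
    rw [ENNReal.ofReal_mul zero_le_two, ENNReal.ofReal_ofNat]
    gcongr
  have hCC : 0 ≤ C₁ * C₂ := by positivity
  refine ⟨hmeas.comp_aemeasurable hXm, fun hz => ?_, fun hp1 hk2 => ?_⟩ <;> rw [htransfer]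
  -- For `n = 1` and `zeta` zero the rate is exactly one, as `0 ^ 0 = 1`, and the trivial bound is
  -- enough.
  · rcases hn.eq_or_lt with rfl | hn2
    · have hz0 : ProjOT.zeta p q k = 0 := by
        by_contra h
        exact absurd (hz h) (by norm_num)
      refine htriv.trans (ENNReal.ofReal_le_ofReal ?_)
      rw [ProjOT.prwRate_one hz0, mul_one]
      gcongr
      linarith
    · refine (H₁ d k n hk hkd hn2 μ M A hM hMA hP hmom).trans (ENNReal.ofReal_le_ofReal ?_)
      have hv := ProjOT.half_le_mul_log hk hkd hn2
      have hi := ProjOT.iprwRate_nonneg p q k n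
      rw [ProjOT.prwRate]
      set v : ℝ := d * k * Real.log n
      have hv0 : 0 ≤ v := by linarith
      set S : ℝ := (n : ℝ) ^ (-(1 / max 2 p)) * √v with hS
      set T : ℝ := (n : ℝ) ^ (-(1 / p)) * v with hT
      have hS0 : 0 ≤ S := by positivity
      have hT0 : 0 ≤ T := by positivity
      calc C₁ * A * (ProjOT.meanRate p k n + S + T)
          ≤ C₁ * A * (C₂ * ProjOT.iprwRate p q k n + S + T) := by
            gcongr
            exact H₂ k n hn2
        _ = (C₁ * C₂) * (A * ProjOT.iprwRate p q k n) + C₁ * (A * (S + T)) := by ring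
        _ ≤ (4 * C₁ + C₁ * C₂ + 8) * (A * ProjOT.iprwRate p q k n) +
              (4 * C₁ + C₁ * C₂ + 8) * (A * (S + T)) := by
            gcongr <;> linarith
        _ = _ := by ring
  · subst hp1
    rcases hn.eq_or_lt with rfl | hn2
    · refine htriv.trans (ENNReal.ofReal_le_ofReal ?_)
      simp only [Nat.cast_one, Real.one_rpow, Real.log_one, mul_zero, Real.sqrt_zero, add_zero,
        mul_one]
      gcongr
      linarith
    · have hmain := H₁ d k n hk hkd hn2 μ M A hM hMA hP hmom
      have hmin := ProjOT.min_one_rate_le hk hkd hk2 hn2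
      set R := ProjOT.meanRate 1 k n + (n : ℝ) ^ (-(1 / max 2 1) : ℝ) * √(d * k * Real.log n) +
        (n : ℝ) ^ (-(1 / 1) : ℝ) * (d * k * Real.log n)
      set Q := (n : ℝ) ^ (-(1 / (k : ℝ))) + (n : ℝ) ^ (-(1 / 2 : ℝ)) * √(d * k * Real.log n)
        with hQ
      have hQ0 : 0 ≤ Q := by positivity
      have hQ1 : 0 ≤ A * Q := by positivity
      rcases min_choice 1 R with h | h <;> rw [h] at hmin
      · refine htriv.trans (ENNReal.ofReal_le_ofReal ?_)
        calc 2 * A = 2 * A * 1 := (mul_one _).symm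
          _ ≤ 2 * A * (4 * Q) := by gcongr
          _ = 8 * (A * Q) := by ring
          _ ≤ (4 * C₁ + C₁ * C₂ + 8) * (A * Q) := by gcongr; linarith
          _ = _ := by ring
      · refine hmain.trans (ENNReal.ofReal_le_ofReal ?_)
        calc C₁ * A * R ≤ C₁ * A * (4 * Q) := by gcongr
          _ = 4 * C₁ * (A * Q) := by ring
          _ ≤ (4 * C₁ + C₁ * C₂ + 8) * (A * Q) := by gcongr; linarith
          _ = _ := by ring
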